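/- Let $\mathsf{T}$ be either the category of all topological spaces or the category of compactly generated topological spaces, with the open-cover topology. A stack over $\mathsf{T}$ is a category fibered in groupoids over $\mathsf{T}$ in which objects and morphisms satisfy descent along open covers; a space $T$ of $\mathsf{T}$ is identified with the stack that it represents. A morphism $\mathcal{Y}\to\mathcal{X}$ is representable if for every morphism $T\to\mathcal{X}$ from a space $T$ the $2$-fiber product $T\times_{\mathcal{X}}\mathcal{Y}$ is equivalent to a space; it is an epimorphism if every object of $\mathcal{X}$ over a space lifts to $\mathcal{Y}$, up to isomorphism, locally on that space. An atlas of $\mathcal{X}$ is an epimorphism $S\to\mathcal{X}$ from a space $S$. A topological stack is a stack whose diagonal $\mathcal{X}\to\mathcal{X}\times\mathcal{X}$ is representable and which admits an atlas. Let $G$ be a topological group (a group object of $\mathsf{T}$) and let $\mathcal{X}$ be a topological stack with a weak left action of $G$: a morphism $\mu\colon G\times\mathcal{X}\to\mathcal{X}$, written $g\cdot x$, and invertible $2$-morphisms with components $\alpha_{g,h}^x\colon g\cdot(h\cdot x)\to(gh)\cdot x$ and $\mathfrak{a}^x\colon x\to 1\cdot x$ such that, for all spaces $T$, all $g,h,k\in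 G(T)$ and all $x\in\mathcal{X}(T)$ (compositions written from left to right), $$(g\cdot\alpha_{h,k}^x)\,\alpha_{g,hk}^x=\alpha_{g,h}^{k\cdot x}\,\alpha_{gh,k}^x,\qquad (g\cdot\mathfrak{a}^x)\,\alpha_{g,1}^x=1_{g\cdot x}=\mathfrak{a}^{g\cdot x}\,\alpha_{1,g}^x .$$ Let $\lfloor G\backslash\mathcal{X}\rfloor$ be the category fibered in groupoids over $\mathsf{T}$ whose objects over $T$ are those of $\mathcal{X}(T)$, whose arrows $x\to y$ over $T$ are the pairs $(\gamma,g)$ with $g\in G(T)$ and $\gamma\colon x\to g\cdot y$ an arrow of $\mathcal{X}(T)$, and whose composition is $(\gamma,g)(\delta,h)=(\gamma\,(g\cdot\delta)\,\alpha_{g,h}^z,\;gh)$ for $(\gamma,g)\colon x\to y$ and $(\delta,h)\colon y\to z$. Let $[G\backslash\mathcal{X}]$ be its stackification and let $q\colon\mathcal{X}\to[G\backslash\mathcal{X}]$ be the canonical morphism. Then $[G\backslash\mathcal{X}]$ is a topological stack: it is a stack, its diagonal is representable, and it admits an atlas. Moreover, for every atlas $p\colon S\to\mathcal{X}$ of $\mathcal{X}$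 the composite $q\circ p\colon S\to[G\backslash\mathcal{X}]$ is an atlas of $[G\backslash\mathcal{X}]$. -/

import Mathlib

open CategoryTheory Opposite

namespace TopStack

universe r v₁ u₁ v₂ u₂ v₃ u₃ v₄ u₄

section FiberedGroupoids

variable {C : Type u₁} [Category.{v₁} C]

/-- Objects of the fiber of `X` over `T`. -/
structure Fib (X : BasedCategory.{v₂, u₂} C) (T : C) where
  obj : X.obj
  obj_eq : X.p.obj obj = T

/-- An object of `X`, as an object of the fiber over its base. -/
abbrev Fib.of {X : BasedCategory.{v₂, u₂} C} (x : X.obj) : Fib X (X.p.obj x) := ⟨x, rfl⟩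

/-- The image of an object of the fiber over `T` under a based functor. -/
abbrev Fib.map {X : BasedCategory.{v₂, u₂} C} {Y : BasedCategory.{v₃, u₃} C} (F : X ⥤ᵇ Y) {T : C}
    (x : Fib X T) : Fib Y T :=
  ⟨F.obj x.obj, (F.w_obj x.obj).trans x.obj_eq⟩

/-- A based category over `C` is fibered in groupoids: it is a fibered category, and every arrow
of a fiber is invertible. -/
structure IsFiberedInGroupoids (X : BasedCategory.{v₂, u₂} C) : Prop where
  isFibered : X.p.IsFibered
  isIso : ∀ (T : C) (a b : X.obj) (φ : a ⟶ b), X.p.IsHomLift (𝟙 T) φ → IsIso φ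

/-- Two based categories are equivalent over `C`. -/
def AreEquivalent (X : BasedCategory.{v₂, u₂} C) (Y : BasedCategory.{v₃, u₃} C) : Prop :=
  ∃ (F : X ⥤ᵇ Y) (H : Y ⥤ᵇ X),
    Nonempty (F.comp H ≅ BasedFunctor.id X) ∧ Nonempty (H.comp F ≅ BasedFunctor.id Y)

/-- The fibered category represented by an object `T`: its objects are the arrows `U ⟶ T`. -/
abbrev rep (T : C) : BasedCategory.{v₁, max u₁ v₁} C where
  obj := Over T
  p := Over.forget T

/-- The fibered category given by a sieve `R` on `T`: its objects are the arrows `U ⟶ T`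
that belong to `R`. -/
abbrev sieveCat {T : C} (R : Sieve T) : BasedCategory.{v₁, max u₁ v₁} C where
  obj := R.arrows.category
  p := R.arrows.diagram

/-- The inclusion of a sieve on `T` in the fibered category represented by `T`. -/
abbrev sieveIncl {T : C} (R : Sieve T) : sieveCat R ⥤ᵇ rep T where
  toFunctor := ObjectProperty.ι _
  w := rfl

/-- Restriction of morphisms `T ⟶ X` to a sieve `R` on `T`. -/
def restrictToSieve {T : C} (R : Sieve T) (X : BasedCategory.{v₂, u₂} C) :
    (rep T ⥤ᵇ X) ⥤ (sieveCat R ⥤ᵇ X) where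
  obj s := (sieveIncl R).comp s
  map α := BasedCategory.whiskerLeft (sieveIncl R) α

/-- A stack: a category fibered in groupoids that satisfies descent. Objects of `X` over `T` are
morphisms `T ⟶ X`, and objects with descent data relative to a covering sieve `R` of `T` are
morphisms `R ⟶ X`; descent says that restriction is an equivalence between the two. -/
structure IsStack (J : GrothendieckTopology C) (X : BasedCategory.{v₂, u₂} C) : Prop where
  isFiberedInGroupoids : IsFiberedInGroupoids X
  descent : ∀ (T : C) (R : Sieve T), R ∈ J T → (restrictToSieve R X).IsEquivalence

/-- A morphism `F : X ⟶ Y` of fibered groupoids is an epimorphism if every object of `Y`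
lifts locally, up to isomorphism, to `X`. (An arrow `F x ⟶ y` over `a` is the same as an
isomorphism between `F x` and the pullback of `y` along `a`.) -/
def IsEpimorphism (J : GrothendieckTopology C) {X : BasedCategory.{v₂, u₂} C}
    {Y : BasedCategory.{v₃, u₃} C} (F : X ⥤ᵇ Y) : Prop :=
  ∀ y : Y.obj, ∃ R : Sieve (Y.p.obj y), R ∈ J (Y.p.obj y) ∧
    ∀ ⦃U : C⦄ (a : U ⟶ Y.p.obj y), R a → ∃ (x : X.obj) (φ : F.obj x ⟶ y), Y.p.IsHomLift a φ

end FiberedGroupoids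

section Products

variable {C : Type u₁} [Category.{v₁} C]

/-- Objects of the product of two based categories: pairs of objects over the same base. -/
structure ProdObj (X : BasedCategory.{v₂, u₂} C) (Y : BasedCategory.{v₃, u₃} C) where
  base : C
  fst : Fib X base
  snd : Fib Y base

/-- Arrows of the product: pairs of arrows over the same arrow of the base. -/
@[ext]
structure ProdHom {X : BasedCategory.{v₂, u₂} C} {Y : BasedCategory.{v₃, u₃} C}
    (a b : ProdObj X Y) where
  base : a.base ⟶ b.base
  fst : a.fst.obj ⟶ b.fst.obj
  snd : a.snd.obj ⟶ b.snd.obj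
  fst_lift : X.p.IsHomLift base fst
  snd_lift : Y.p.IsHomLift base snd

instance (X : BasedCategory.{v₂, u₂} C) (Y : BasedCategory.{v₃, u₃} C) :
    Category (ProdObj X Y) where
  Hom := ProdHom
  id a := ⟨𝟙 _, 𝟙 _, 𝟙 _, IsHomLift.id a.fst.obj_eq, IsHomLift.id a.snd.obj_eq⟩
  comp f g := ⟨f.base ≫ g.base, f.fst ≫ g.fst, f.snd ≫ g.snd,
    have := f.fst_lift; have := g.fst_lift; inferInstance,
    have := f.snd_lift; have := g.snd_lift; inferInstance⟩
  id_comp _ := ProdHom.ext (Category.id_comp _) (Category.id_comp _) (Category.id_comp _)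
  comp_id _ := ProdHom.ext (Category.comp_id _) (Category.comp_id _) (Category.comp_id _)
  assoc _ _ _ := ProdHom.ext (Category.assoc _ _ _) (Category.assoc _ _ _) (Category.assoc _ _ _)

/-- The product `X × Y` of two based categories. -/
abbrev prodCat (X : BasedCategory.{v₂, u₂} C) (Y : BasedCategory.{v₃, u₃} C) :
    BasedCategory.{max v₁ v₂ v₃, max u₁ u₂ u₃} C where
  obj := ProdObj X Y
  p :=
    { obj a := a.base
      map f := ProdHom.base f }

/-- The diagonal `X ⟶ X × X`. -/
def diag (X : BasedCategory.{v₂, u₂} C) : X ⥤ᵇ prodCat X X where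
  toFunctor :=
    { obj x := ⟨X.p.obj x, Fib.of x, Fib.of x⟩
      map φ := ⟨X.p.map φ, φ, φ, .map φ, .map φ⟩
      map_id _ := ProdHom.ext (X.p.map_id _) rfl rfl
      map_comp _ _ := ProdHom.ext (X.p.map_comp _ _) rfl rfl }
  w := rfl

/-- Objects of the 2-fiber product of `F : Y ⟶ X` and `H : Z ⟶ X`: triples `(y, z, α)` over the
same base, with `α : H z ⟶ F y` an arrow of the fiber. -/
structure FiberProdObj {X : BasedCategory.{v₂, u₂} C} {Y : BasedCategory.{v₃, u₃} C}
    {Z : BasedCategory.{v₄, u₄} C} (F : Y ⥤ᵇ X) (H : Z ⥤ᵇ X) where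
  base : C
  fst : Fib Y base
  snd : Fib Z base
  arr : H.obj snd.obj ⟶ F.obj fst.obj
  arr_lift : X.p.IsHomLift (𝟙 base) arr

/-- Arrows of the 2-fiber product: pairs of arrows over the same arrow of the base that form
a commutative square with the given arrows of `X`. -/
@[ext]
structure FiberProdHom {X : BasedCategory.{v₂, u₂} C} {Y : BasedCategory.{v₃, u₃} C}
    {Z : BasedCategory.{v₄, u₄} C} {F : Y ⥤ᵇ X} {H : Z ⥤ᵇ X} (a b : FiberProdObj F H) where
  base : a.base ⟶ b.base
  fst : a.fst.obj ⟶ b.fst.obj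
  snd : a.snd.obj ⟶ b.snd.obj
  fst_lift : Y.p.IsHomLift base fst
  snd_lift : Z.p.IsHomLift base snd
  comm : a.arr ≫ F.map fst = H.map snd ≫ b.arr

instance {X : BasedCategory.{v₂, u₂} C} {Y : BasedCategory.{v₃, u₃} C}
    {Z : BasedCategory.{v₄, u₄} C} (F : Y ⥤ᵇ X) (H : Z ⥤ᵇ X) : Category (FiberProdObj F H) where
  Hom := FiberProdHom
  id a := ⟨𝟙 _, 𝟙 _, 𝟙 _, IsHomLift.id a.fst.obj_eq, IsHomLift.id a.snd.obj_eq, by simp⟩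
  comp {a b c} f g := ⟨f.base ≫ g.base, f.fst ≫ g.fst, f.snd ≫ g.snd,
    have := f.fst_lift; have := g.fst_lift; inferInstance,
    have := f.snd_lift; have := g.snd_lift; inferInstance, by
    rw [F.map_comp, H.map_comp, Category.assoc, ← g.comm, ← Category.assoc, f.comm,
      Category.assoc]⟩
  id_comp _ := FiberProdHom.ext (Category.id_comp _) (Category.id_comp _) (Category.id_comp _)
  comp_id _ := FiberProdHom.ext (Category.comp_id _) (Category.comp_id _) (Category.comp_id _)
  assoc _ _ _ :=
    FiberProdHom.ext (Category.assoc _ _ _) (Category.assoc _ _ _) (Category.assoc _ _ _)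

/-- The 2-fiber product of two morphisms of based categories. -/
abbrev fiberProd {X : BasedCategory.{v₂, u₂} C} {Y : BasedCategory.{v₃, u₃} C}
    {Z : BasedCategory.{v₄, u₄} C} (F : Y ⥤ᵇ X) (H : Z ⥤ᵇ X) :
    BasedCategory.{max v₁ v₃ v₄, max u₁ u₃ u₄ v₂} C where
  obj := FiberProdObj F H
  p :=
    { obj a := a.base
      map f := FiberProdHom.base f }

/-- A morphism `F : X ⟶ Y` is representable if its base extension along every morphism from a
representable `T` is equivalent to a representable one. -/
def IsRepresentable {X : BasedCategory.{v₂, u₂} C} {Y : BasedCategory.{v₃, u₃} C}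
    (F : X ⥤ᵇ Y) : Prop :=
  ∀ (T : C) (t : rep T ⥤ᵇ Y), ∃ S : C, AreEquivalent (fiberProd t F) (rep S)

/-- A morphism from a representable `A` is an atlas if it is an epimorphism. -/
def IsAtlas (J : GrothendieckTopology C) {X : BasedCategory.{v₂, u₂} C} {A : C}
    (p : rep A ⥤ᵇ X) : Prop :=
  IsEpimorphism J p

/-- Over a category of topological spaces: a topological stack is a stack whose diagonal is
representable and which admits an atlas. -/
structure IsTopologicalStack (J : GrothendieckTopology C) (X : BasedCategory.{v₂, u₂} C) :
    Prop where
  isStack : IsStack J X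
  isRepresentable_diag : IsRepresentable (diag X)
  exists_atlas : ∃ (A : C) (p : rep A ⥤ᵇ X), IsAtlas J p

end Products

section Actions

variable {C : Type u₁} [Category.{v₁} C]

/-- Objects over `T` of the product of a presheaf of groups `G` with `X`: pairs of
a section of `G` over `T` and an object of `X` over `T`. -/
structure GrpProdObj (G : Cᵒᵖ ⥤ GrpCat.{r}) (X : BasedCategory.{v₂, u₂} C) where
  base : C
  grp : G.obj (op base)
  fib : Fib X base

/-- Arrows of `G × X`: arrows of `X` whose base arrow is compatible with the sections of `G`. -/
@[ext]
structure GrpProdHom {G : Cᵒᵖ ⥤ GrpCat.{r}} {X : BasedCategory.{v₂, u₂} C}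
    (a b : GrpProdObj G X) where
  base : a.base ⟶ b.base
  arr : a.fib.obj ⟶ b.fib.obj
  grp_eq : G.map base.op b.grp = a.grp
  lift : X.p.IsHomLift base arr

instance (G : Cᵒᵖ ⥤ GrpCat.{r}) (X : BasedCategory.{v₂, u₂} C) : Category (GrpProdObj G X) where
  Hom := GrpProdHom
  id a := ⟨𝟙 _, 𝟙 _, by simp, IsHomLift.id a.fib.obj_eq⟩
  comp f g := ⟨f.base ≫ g.base, f.arr ≫ g.arr, by
    simp [← f.grp_eq, ← g.grp_eq],
    have := f.lift; have := g.lift; inferInstance⟩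
  id_comp _ := GrpProdHom.ext (Category.id_comp _) (Category.id_comp _)
  comp_id _ := GrpProdHom.ext (Category.comp_id _) (Category.comp_id _)
  assoc _ _ _ := GrpProdHom.ext (Category.assoc _ _ _) (Category.assoc _ _ _)

/-- The product `G × X` of a presheaf of groups `G` (as a fibered category) with `X`. -/
abbrev grpProd (G : Cᵒᵖ ⥤ GrpCat.{r}) (X : BasedCategory.{v₂, u₂} C) :
    BasedCategory.{max v₁ v₂, max u₁ u₂ r} C where
  obj := GrpProdObj G X
  p :=
    { obj a := a.base
      map f := GrpProdHom.base f }

/-- The presheaf of groups `G × G`. -/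
def grpSq (G : Cᵒᵖ ⥤ GrpCat.{r}) : Cᵒᵖ ⥤ GrpCat.{r} where
  obj T := GrpCat.of (G.obj T × G.obj T)
  map f := GrpCat.ofHom ((G.map f).hom.prodMap (G.map f).hom)

variable {G : Cᵒᵖ ⥤ GrpCat.{r}} {X : BasedCategory.{v₂, u₂} C}

/-- `m × id : G × G × X ⟶ G × X`. -/
def mulProd (G : Cᵒᵖ ⥤ GrpCat.{r}) (X : BasedCategory.{v₂, u₂} C) :
    grpProd (grpSq G) X ⥤ᵇ grpProd G X where
  toFunctor :=
    { obj a := ⟨a.base, a.grp.1 * a.grp.2, a.fib⟩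
      map f := ⟨f.base, f.arr, by
        rw [map_mul, ← f.grp_eq]; rfl, f.lift⟩ }
  w := rfl

/-- `1 × id : X ⟶ G × X`. -/
def oneProd (G : Cᵒᵖ ⥤ GrpCat.{r}) (X : BasedCategory.{v₂, u₂} C) : X ⥤ᵇ grpProd G X where
  toFunctor :=
    { obj x := ⟨X.p.obj x, 1, Fib.of x⟩
      map φ := ⟨X.p.map φ, φ, map_one _, .map φ⟩
      map_id _ := GrpProdHom.ext (X.p.map_id _) rfl
      map_comp _ _ := GrpProdHom.ext (X.p.map_comp _ _) rfl }
  w := rfl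

/-- An arrow of `G × X`, from its components. -/
abbrev homMk {S T : C} {g : G.obj (op S)} {g' : G.obj (op T)} {x : Fib X S} {y : Fib X T}
    (f : S ⟶ T) (e : G.map f.op g' = g) (φ : x.obj ⟶ y.obj) (hφ : X.p.IsHomLift f φ) :
    (⟨S, g, x⟩ : GrpProdObj G X) ⟶ ⟨T, g', y⟩ :=
  ⟨f, φ, e, hφ⟩

/-- The object `g · x` of the fiber over `T`. -/
abbrev act (μ : grpProd G X ⥤ᵇ X) {T : C} (g : G.obj (op T)) (x : Fib X T) : Fib X T :=
  ⟨μ.obj ⟨T, g, x⟩, μ.w_obj ⟨T, g, x⟩⟩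

/-- The arrow `g · x ⟶ g' · y` over `f` obtained from `φ : x ⟶ y` over `f` if `g = f^* g'`. -/
abbrev actMap (μ : grpProd G X ⥤ᵇ X) {S T : C} {g : G.obj (op S)} {g' : G.obj (op T)}
    {x : Fib X S} {y : Fib X T} (f : S ⟶ T) (e : G.map f.op g' = g) (φ : x.obj ⟶ y.obj)
    (hφ : X.p.IsHomLift f φ) : (act μ g x).obj ⟶ (act μ g' y).obj :=
  μ.map (homMk f e φ hφ)

theorem actMap_lift (μ : grpProd G X ⥤ᵇ X) {S T : C} {g : G.obj (op S)} {g' : G.obj (op T)}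
    {x : Fib X S} {y : Fib X T} (f : S ⟶ T) (e : G.map f.op g' = g) (φ : x.obj ⟶ y.obj)
    (hφ : X.p.IsHomLift f φ) : X.p.IsHomLift f (actMap μ f e φ hφ) :=
  have : (grpProd G X).p.IsHomLift f (homMk f e φ hφ) :=
    IsHomLift.map (grpProd G X).p (homMk f e φ hφ)
  μ.preserves_isHomLift f _

/-- `id × μ : G × G × X ⟶ G × X`. -/
def prodAct (μ : grpProd G X ⥤ᵇ X) : grpProd (grpSq G) X ⥤ᵇ grpProd G X where
  toFunctor :=
    { obj a := ⟨a.base, a.grp.1, act μ a.grp.2 a.fib⟩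
      map f := ⟨f.base,
        actMap μ f.base (congrArg Prod.snd f.grp_eq) f.arr f.lift,
        congrArg Prod.fst f.grp_eq, actMap_lift _ _ _ _ _⟩
      map_id _ := GrpProdHom.ext rfl (μ.map_id _)
      map_comp f g := GrpProdHom.ext rfl (μ.map_comp (homMk _ _ f.arr f.lift)
        (homMk _ _ g.arr g.lift)) }
  w := rfl

/-- The data `(μ, α, 𝔞)` of a (weak, left) action of `G` on `X`, without its axioms. -/
structure ActionData (G : Cᵒᵖ ⥤ GrpCat.{r}) (X : BasedCategory.{v₂, u₂} C) where
  /-- the morphism `μ : G × X ⟶ X` -/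
  μ : grpProd G X ⥤ᵇ X
  /-- the 2-morphism `α`, with components `g · (h · x) ⟶ (g h) · x` -/
  α : (prodAct μ).comp μ ≅ (mulProd G X).comp μ
  /-- the 2-morphism `𝔞`, with components `x ⟶ 1 · x` -/
  unit : BasedFunctor.id X ≅ (oneProd G X).comp μ

namespace ActionData

variable (A : ActionData G X)

/-- The component `α_{g,h}^x : g · (h · x) ⟶ (g h) · x`. -/
def assoc {T : C} (g h : G.obj (op T)) (x : Fib X T) :
    (act A.μ g (act A.μ h x)).obj ≅ (act A.μ (g * h) x).obj :=
  ((BasedNatTrans.forgetful _ _).mapIso A.α).app ⟨T, (g, h), x⟩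

/-- The component `𝔞^x : x ⟶ 1 · x`. -/
def unitor : ∀ {T : C} (x : Fib X T), x.obj ≅ (act A.μ 1 x).obj
  | _, ⟨x, rfl⟩ => ((BasedNatTrans.forgetful _ _).mapIso A.unit).app x

theorem assoc_lift {T : C} (g h : G.obj (op T)) (x : Fib X T) :
    X.p.IsHomLift (𝟙 T) (A.assoc g h x).hom :=
  A.α.hom.isHomLift' ⟨T, (g, h), x⟩

theorem unitor_lift {T : C} (x : Fib X T) : X.p.IsHomLift (𝟙 T) (A.unitor x).hom := by
  obtain ⟨x, rfl⟩ := x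
  exact A.unit.hom.isHomLift' x

/-- The arrow `g · φ : g · x ⟶ g · y` for an arrow `φ : x ⟶ y` of the fiber over `T`. -/
abbrev actFib {T : C} (g : G.obj (op T)) {x y : Fib X T} (φ : x.obj ⟶ y.obj)
    (hφ : X.p.IsHomLift (𝟙 T) φ) : (act A.μ g x).obj ⟶ (act A.μ g y).obj :=
  actMap A.μ (𝟙 T) (by simp) φ hφ

end ActionData

/-- A (weak, left) action of a presheaf of groups `G` on `X`. The arrows `eqToHom` only identify
`(g (h k)) · x` with `((g h) k) · x`, and `(g 1) · x`, `(1 g) · x` with `g · x`. -/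
structure GroupAction (G : Cᵒᵖ ⥤ GrpCat.{r}) (X : BasedCategory.{v₂, u₂} C) extends
    ActionData G X where
  assoc_assoc : ∀ {T : C} (g h k : G.obj (op T)) (x : Fib X T),
    toActionData.actFib g (toActionData.assoc h k x).hom (toActionData.assoc_lift h k x) ≫
        (toActionData.assoc g (h * k) x).hom ≫ eqToHom (by rw [mul_assoc]) =
      (toActionData.assoc g h (act μ k x)).hom ≫ (toActionData.assoc (g * h) k x).hom
  act_unit : ∀ {T : C} (g : G.obj (op T)) (x : Fib X T),
    toActionData.actFib g (toActionData.unitor x).hom (toActionData.unitor_lift x) ≫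
      (toActionData.assoc g 1 x).hom = eqToHom (by rw [mul_one])
  unit_act : ∀ {T : C} (g : G.obj (op T)) (x : Fib X T),
    (toActionData.unitor (act μ g x)).hom ≫ (toActionData.assoc 1 g x).hom =
      eqToHom (by rw [one_mul])

namespace GroupAction

variable (A : GroupAction G X)

theorem actMap_comp {S T U : C} {g : G.obj (op S)} {g' : G.obj (op T)} {g'' : G.obj (op U)}
    {x : Fib X S} {y : Fib X T} {z : Fib X U} (μ : grpProd G X ⥤ᵇ X)
    (f : S ⟶ T) (e : G.map f.op g' = g) (φ : x.obj ⟶ y.obj) (hφ : X.p.IsHomLift f φ)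
    (f' : T ⟶ U) (e' : G.map f'.op g'' = g') (φ' : y.obj ⟶ z.obj) (hφ' : X.p.IsHomLift f' φ') :
    actMap μ f e φ hφ ≫ actMap μ f' e' φ' hφ' =
      actMap μ (x := x) (y := z) (f ≫ f') (by simp [e, e']) (φ ≫ φ')
        (IsHomLift.comp X.p f f' φ φ') :=
  (μ.map_comp _ _).symm

theorem assoc_naturality {S T : C} {g h : G.obj (op S)} {g' h' : G.obj (op T)}
    {x : Fib X S} {y : Fib X T} (f : S ⟶ T) (e : G.map f.op g' = g) (e' : G.map f.op h' = h)
    (φ : x.obj ⟶ y.obj) (hφ : X.p.IsHomLift f φ) :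
    actMap A.μ f e (actMap A.μ f e' φ hφ) (actMap_lift _ _ _ _ _) ≫ (A.assoc g' h' y).hom =
      (A.assoc g h x).hom ≫ actMap A.μ f (by rw [map_mul, e, e']) φ hφ :=
  A.α.hom.naturality (X := ⟨S, (g, h), x⟩) (Y := ⟨T, (g', h'), y⟩)
    ⟨f, φ, Prod.ext e e', hφ⟩

theorem unitor_naturality {S T : C} {x : Fib X S} {y : Fib X T} (f : S ⟶ T)
    (φ : x.obj ⟶ y.obj) (hφ : X.p.IsHomLift f φ) :
    φ ≫ (A.unitor y).hom = (A.unitor x).hom ≫ actMap A.μ f (map_one _) φ hφ := by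
  obtain ⟨x, rfl⟩ := x
  obtain ⟨y, rfl⟩ := y
  obtain rfl := IsHomLift.eq_of_isHomLift X.p f φ
  exact A.unit.hom.naturality φ

/-- The objects of the transformation prestack: those of `X`. -/
structure TransObj (A : GroupAction G X) where
  obj : X.obj

/-- An arrow from `x` to `y` over `f : S ⟶ T` in the transformation prestack is a pair of a
section `g` of `G` over `S` and an arrow `δ : g · x ⟶ y` over `f`. For `f = 𝟙`, this is the inverse
of the arrow `(δ⁻¹, g, x)`, that is `y ⟶ g · x ⇢ x`, of the transformation groupoid
`[G(S)\X(S)]`. -/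
structure TransHom {A : GroupAction G X} (x y : A.TransObj) where
  base : X.p.obj x.obj ⟶ X.p.obj y.obj
  grp : G.obj (op (X.p.obj x.obj))
  arr : (act A.μ grp (Fib.of x.obj)).obj ⟶ y.obj
  lift : X.p.IsHomLift base arr

theorem TransHom.ext' {A : GroupAction G X} {x y : A.TransObj} {f g : TransHom x y}
    (h₁ : f.base = g.base) (h₂ : f.grp = g.grp)
    (h₃ : f.arr = eqToHom (by rw [h₂]) ≫ g.arr) : f = g := by
  obtain ⟨b, k, φ, hφ⟩ := f
  obtain ⟨b', k', φ', hφ'⟩ := g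
  obtain rfl : b = b' := h₁
  obtain rfl : k = k' := h₂
  obtain rfl : φ = φ' := h₃.trans (Category.id_comp _)
  rfl

theorem assoc_inv_lift {T : C} (g h : G.obj (op T)) (x : Fib X T) :
    X.p.IsHomLift (𝟙 T) (A.assoc g h x).inv :=
  have := A.assoc_lift g h x
  IsHomLift.lift_id_inv X.p T _

theorem unitor_inv_lift {T : C} (x : Fib X T) :
    X.p.IsHomLift (𝟙 T) (A.unitor x).inv :=
  have := A.unitor_lift x
  IsHomLift.lift_id_inv X.p T _

/-- The identity `(1, 1 · x ⟶ x)`. -/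
def TransHom.id (x : A.TransObj) : TransHom x x :=
  ⟨𝟙 _, 1, (A.unitor (Fib.of x.obj)).inv, A.unitor_inv_lift _⟩

/-- The composition
`(f, g, δ) ≫ (f', h, ε) = (f ≫ f', f^*h g, (f^*h g) · x ⟶ f^*h · (g · x) ⟶ h · y ⟶ z)`. -/
def TransHom.comp {A : GroupAction G X} {x y z : A.TransObj} (a : TransHom x y)
    (b : TransHom y z) : TransHom x z where
  base := a.base ≫ b.base
  grp := G.map a.base.op b.grp * a.grp
  arr := (A.assoc (G.map a.base.op b.grp) a.grp (Fib.of x.obj)).inv ≫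
    actMap A.μ (y := Fib.of y.obj) a.base rfl a.arr a.lift ≫ b.arr
  lift :=
    have := A.assoc_inv_lift (G.map a.base.op b.grp) a.grp (Fib.of x.obj)
    have := actMap_lift A.μ (y := Fib.of y.obj) a.base (rfl : _ = G.map a.base.op b.grp)
      a.arr a.lift
    have := b.lift
    inferInstance

/-- Changing the group element and the object does not change `g · φ`. -/
theorem actMap_eqToHom {S T : C} {g k : G.obj (op S)} {g' : G.obj (op T)}
    {x : Fib X S} {y : Fib X T} (μ : grpProd G X ⥤ᵇ X) (h : k = g)
    (f : S ⟶ T) (e : G.map f.op g' = g) (φ : x.obj ⟶ y.obj) (hφ : X.p.IsHomLift f φ) :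
    eqToHom (by rw [h]) ≫ actMap μ f e φ hφ =
      actMap μ (x := x) (y := y) (g := k) f (e.trans h.symm) φ hφ := by
  subst h; exact Category.id_comp _

theorem assoc_inv_naturality {S T : C} {g h : G.obj (op S)} {g' h' : G.obj (op T)}
    {x : Fib X S} {y : Fib X T} (f : S ⟶ T) (e : G.map f.op g' = g) (e' : G.map f.op h' = h)
    (φ : x.obj ⟶ y.obj) (hφ : X.p.IsHomLift f φ) :
    actMap A.μ f (by rw [map_mul, e, e']) φ hφ ≫ (A.assoc g' h' y).inv =
      (A.assoc g h x).inv ≫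
        actMap A.μ f e (actMap A.μ f e' φ hφ) (actMap_lift _ _ _ _ _) := by
  rw [Iso.comp_inv_eq, Category.assoc, A.assoc_naturality f e e' φ hφ, Iso.inv_hom_id_assoc]

theorem unitor_inv_naturality {S T : C} {x : Fib X S} {y : Fib X T} (f : S ⟶ T)
    (φ : x.obj ⟶ y.obj) (hφ : X.p.IsHomLift f φ) :
    actMap A.μ f (map_one _) φ hφ ≫ (A.unitor y).inv = (A.unitor x).inv ≫ φ := by
  rw [Iso.comp_inv_eq, Category.assoc, A.unitor_naturality f φ hφ, Iso.inv_hom_id_assoc]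

theorem assoc_inv_congr {T : C} {g g' h h' : G.obj (op T)} (x : Fib X T) (e : g = g')
    (e' : h = h') :
    (A.assoc g h x).inv =
      eqToHom (by rw [e, e']) ≫ (A.assoc g' h' x).inv ≫ eqToHom (by rw [e, e']) := by
  subst e e'; simp

theorem actFib_comp_eq_id {T : C} (g : G.obj (op T)) {x y : Fib X T} (φ : x.obj ⟶ y.obj)
    (hφ : X.p.IsHomLift (𝟙 T) φ) (ψ : y.obj ⟶ x.obj) (hψ : X.p.IsHomLift (𝟙 T) ψ)
    (h : φ ≫ ψ = 𝟙 x.obj) : A.actFib g φ hφ ≫ A.actFib g ψ hψ = 𝟙 _ := by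
  have e : homMk (G := G) (X := X) (g := g) (g' := g) (x := x) (y := y) (𝟙 T) (by simp) φ hφ ≫
      homMk (g' := g) (y := x) (𝟙 T) (by simp) ψ hψ = 𝟙 _ :=
    GrpProdHom.ext (Category.id_comp _) h
  rw [← A.μ.map_id, ← e, A.μ.map_comp]

theorem TransHom.id_comp {x y : A.TransObj} (a : TransHom x y) : (TransHom.id A x).comp a = a := by
  have key : ∀ (k : G.obj (op (X.p.obj x.obj))) (hk : G.map (𝟙 (X.p.obj x.obj)).op a.grp = k),
      (A.assoc k 1 (Fib.of x.obj)).inv ≫ actMap A.μ (𝟙 _) hk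
        (A.unitor (Fib.of x.obj)).inv (A.unitor_inv_lift _) =
      eqToHom (by rw [← hk]; simp) := by
    intro k hk
    obtain rfl : a.grp = k := by rw [← hk]; simp
    rw [Iso.inv_comp_eq]
    have h := A.act_unit a.grp (Fib.of x.obj)
    have h' : A.actFib a.grp (A.unitor (Fib.of x.obj)).hom (A.unitor_lift _) ≫
        A.actFib (x := act A.μ 1 (Fib.of x.obj)) (y := Fib.of x.obj) a.grp
          (A.unitor (Fib.of x.obj)).inv (A.unitor_inv_lift _) = 𝟙 _ :=
      A.actFib_comp_eq_id _ _ _ _ _ (Iso.hom_inv_id _)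
    have h'' : A.actFib (x := act A.μ 1 (Fib.of x.obj)) (y := Fib.of x.obj) a.grp
          (A.unitor (Fib.of x.obj)).inv (A.unitor_inv_lift _) ≫
          A.actFib a.grp (A.unitor (Fib.of x.obj)).hom (A.unitor_lift _) = 𝟙 _ :=
      A.actFib_comp_eq_id _ _ _ _ _ (Iso.inv_hom_id _)
    have h₃ : (A.assoc a.grp 1 (Fib.of x.obj)).hom =
        A.actFib (x := act A.μ 1 (Fib.of x.obj)) (y := Fib.of x.obj) a.grp
          (A.unitor (Fib.of x.obj)).inv (A.unitor_inv_lift _) ≫ eqToHom (by rw [mul_one]) := by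
      rw [← h, ← Category.assoc, h'', Category.id_comp]
    rw [h₃, Category.assoc, eqToHom_trans, eqToHom_refl, Category.comp_id]
  refine TransHom.ext' (Category.id_comp _) ?_ ?_
  · simp [TransHom.comp, TransHom.id]
  · have h := key _ rfl
    simp only [TransHom.comp, TransHom.id]
    exact (Category.assoc _ _ _).symm.trans (congrArg (· ≫ a.arr) h)

theorem unit_key {x y : A.TransObj} (a : TransHom x y) (k : G.obj (op (X.p.obj x.obj)))
    (hk : G.map a.base.op 1 = k) :
    (A.assoc k a.grp (Fib.of x.obj)).inv ≫ actMap A.μ (y := Fib.of y.obj) a.base hk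
        a.arr a.lift ≫ (A.unitor (Fib.of y.obj)).inv =
      eqToHom (by rw [← hk]; simp) ≫ a.arr := by
  obtain rfl : 1 = k := by rw [← hk]; simp
  rw [A.unitor_inv_naturality (y := Fib.of y.obj) (x := act A.μ a.grp (Fib.of x.obj))
    a.base a.arr a.lift, Iso.inv_comp_eq,
    ← Category.assoc, Iso.inv_comp_eq, ← Category.assoc, ← Category.assoc]
  have h := A.unit_act a.grp (Fib.of x.obj)
  rw [h, eqToHom_trans, eqToHom_refl, Category.id_comp]

theorem TransHom.comp_id {x y : A.TransObj} (a : TransHom x y) : a.comp (TransHom.id A y) = a := by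
  refine TransHom.ext' (Category.comp_id _) ?_ (A.unit_key a _ rfl)
  simp [TransHom.comp, TransHom.id]

theorem assoc_assoc_inv {T : C} (g h k : G.obj (op T)) (x : Fib X T) :
    (A.assoc g (h * k) x).inv ≫
        A.actFib (x := act A.μ (h * k) x) (y := act A.μ h (act A.μ k x)) g (A.assoc h k x).inv
          (A.assoc_inv_lift h k x) =
      eqToHom (by rw [mul_assoc]) ≫ (A.assoc (g * h) k x).inv ≫
        (A.assoc g h (act A.μ k x)).inv := by
  have h₁ := A.assoc_assoc g h k x
  have h₂ : A.actFib g (A.assoc h k x).hom (A.assoc_lift h k x) ≫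
      A.actFib (x := act A.μ (h * k) x) (y := act A.μ h (act A.μ k x)) g (A.assoc h k x).inv
        (A.assoc_inv_lift h k x) = 𝟙 _ :=
    A.actFib_comp_eq_id _ _ _ _ _ (Iso.hom_inv_id _)
  have h₃ : A.actFib (x := act A.μ (h * k) x) (y := act A.μ h (act A.μ k x)) g (A.assoc h k x).inv
      (A.assoc_inv_lift h k x) ≫ A.actFib g (A.assoc h k x).hom (A.assoc_lift h k x) = 𝟙 _ :=
    A.actFib_comp_eq_id _ _ _ _ _ (Iso.inv_hom_id _)
  have : IsIso (A.actFib g (A.assoc h k x).hom (A.assoc_lift h k x)) := ⟨_, h₂, h₃⟩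
  rw [Iso.inv_comp_eq, ← cancel_epi (A.actFib g (A.assoc h k x).hom (A.assoc_lift h k x)), h₂,
    ← Category.assoc, ← Category.assoc, Category.assoc (A.actFib _ _ _), h₁]
  simp

theorem TransHom.assoc {w x y z : A.TransObj} (a : TransHom w x) (b : TransHom x y)
    (c : TransHom y z) : (a.comp b).comp c = a.comp (b.comp c) := by
  obtain ⟨f, g, δ, hδ⟩ := a
  obtain ⟨f', h, ε, hε⟩ := b
  obtain ⟨f'', k, ζ, hζ⟩ := c
  have hk : G.map f.op (G.map f'.op k) = G.map (f ≫ f').op k := by simp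
  refine TransHom.ext' (Category.assoc _ _ _) ?_ ?_
  · simp [TransHom.comp, mul_assoc]
  · have e₁ : G.map f.op (G.map f'.op k * h) = G.map (f ≫ f').op k * G.map f.op h := by
      rw [map_mul, hk]
    have l₁ := A.assoc_inv_lift (G.map f.op h) g (Fib.of w.obj)
    have l₂ := actMap_lift A.μ (x := act A.μ g (Fib.of w.obj)) (y := Fib.of x.obj) f
      (rfl : _ = G.map f.op h) δ hδ
    have s₁ : actMap A.μ (x := act A.μ (G.map f.op h * g) (Fib.of w.obj)) (y := Fib.of y.obj)
        (f ≫ f') (rfl : _ = G.map (f ≫ f').op k)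
        ((A.assoc (G.map f.op h) g (Fib.of w.obj)).inv ≫
          actMap A.μ (x := act A.μ g (Fib.of w.obj)) (y := Fib.of x.obj) f
            (rfl : _ = G.map f.op h) δ hδ ≫ ε)
        (TransHom.comp ⟨f, g, δ, hδ⟩ ⟨f', h, ε, hε⟩ : TransHom w y).lift =
      A.actFib (x := act A.μ (G.map f.op h * g) (Fib.of w.obj))
          (y := act A.μ (G.map f.op h) (act A.μ g (Fib.of w.obj))) (G.map (f ≫ f').op k)
          (A.assoc (G.map f.op h) g (Fib.of w.obj)).inv l₁ ≫
        actMap A.μ (x := act A.μ (G.map f.op h) (act A.μ g (Fib.of w.obj)))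
          (y := act A.μ h (Fib.of x.obj)) f hk
          (actMap A.μ (x := act A.μ g (Fib.of w.obj)) (y := Fib.of x.obj) f
            (rfl : _ = G.map f.op h) δ hδ) l₂ ≫
        actMap A.μ (x := act A.μ h (Fib.of x.obj)) (y := Fib.of y.obj) f' rfl ε hε := by
      rw [actMap_comp, ActionData.actFib, actMap_comp]
      refine congrArg A.μ.map (GrpProdHom.ext ?_ rfl)
      exact (Category.id_comp _).symm
    have s₂ := A.assoc_inv_naturality (x := act A.μ g (Fib.of w.obj)) (y := Fib.of x.obj) f hk
      (rfl : _ = G.map f.op h) δ hδ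
    have s₃ := A.assoc_assoc_inv (G.map (f ≫ f').op k) (G.map f.op h) g (Fib.of w.obj)
    have s₄ := A.assoc_inv_congr (Fib.of w.obj) e₁ (rfl : g = g)
    have s₅ := actMap_eqToHom (x := act A.μ g (Fib.of w.obj)) (y := Fib.of x.obj) A.μ e₁.symm f
      (rfl : _ = G.map f.op (G.map f'.op k * h)) δ hδ
    refine (congrArg (fun t => (A.assoc (G.map (f ≫ f').op k) (G.map f.op h * g)
      (Fib.of w.obj)).inv ≫ t ≫ ζ) s₁).trans ?_
    have s₆ : (A.assoc (G.map (f ≫ f').op k) (G.map f.op h * g) (Fib.of w.obj)).inv ≫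
        (A.actFib (x := act A.μ (G.map f.op h * g) (Fib.of w.obj))
          (y := act A.μ (G.map f.op h) (act A.μ g (Fib.of w.obj))) (G.map (f ≫ f').op k)
          (A.assoc (G.map f.op h) g (Fib.of w.obj)).inv l₁ ≫
        actMap A.μ (x := act A.μ (G.map f.op h) (act A.μ g (Fib.of w.obj)))
          (y := act A.μ h (Fib.of x.obj)) f hk
          (actMap A.μ (x := act A.μ g (Fib.of w.obj)) (y := Fib.of x.obj) f
            (rfl : _ = G.map f.op h) δ hδ) l₂ ≫
        actMap A.μ (x := act A.μ h (Fib.of x.obj)) (y := Fib.of y.obj) f' rfl ε hε) ≫ ζ =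
      eqToHom (by rw [e₁, mul_assoc]) ≫
        (A.assoc (G.map f.op (G.map f'.op k * h)) g (Fib.of w.obj)).inv ≫
        actMap A.μ (x := act A.μ g (Fib.of w.obj)) (y := Fib.of x.obj) f rfl δ hδ ≫
        (A.assoc (G.map f'.op k) h (Fib.of x.obj)).inv ≫
        actMap A.μ (x := act A.μ h (Fib.of x.obj)) (y := Fib.of y.obj) f' rfl ε hε ≫ ζ := by
      rw [s₄]
      simp only [Category.assoc]
      rw [reassoc_of% s₅, reassoc_of% s₂, reassoc_of% s₃]
      simp
    refine s₆.trans (congrArg (eqToHom _ ≫ ·) (congrArg ((A.assoc _ g _).inv ≫ ·) ?_))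
    exact congrArg (actMap A.μ (x := act A.μ g (Fib.of w.obj)) (y := Fib.of x.obj) f rfl δ hδ ≫ ·)
      rfl

instance : Category A.TransObj where
  Hom := TransHom
  id := TransHom.id A
  comp := TransHom.comp
  id_comp := TransHom.id_comp A
  comp_id := TransHom.comp_id A
  assoc := TransHom.assoc A

/-- The transformation prestack `⌊G\X⌋`. -/
abbrev transCat : BasedCategory.{max r v₁ v₂, u₂} C where
  obj := A.TransObj
  p :=
    { obj x := X.p.obj x.obj
      map f := TransHom.base f }

/-- The arrow `(1, 1 · x ⟶ x ⟶ y)` of the transformation prestack. -/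
abbrev TransHom.ofHom {x y : X.obj} (φ : x ⟶ y) : (⟨x⟩ : A.TransObj) ⟶ ⟨y⟩ :=
  (⟨X.p.map φ, 1, (A.unitor (Fib.of x)).inv ≫ φ,
    have := A.unitor_inv_lift (Fib.of x)
    inferInstance⟩ : TransHom (A := A) ⟨x⟩ ⟨y⟩)

theorem TransHom.comp_ofHom {w : A.TransObj} {x y : X.obj} (a : w ⟶ (⟨x⟩ : A.TransObj))
    (φ : x ⟶ y) : a ≫ TransHom.ofHom A φ =
      (⟨TransHom.base a ≫ X.p.map φ, TransHom.grp a, TransHom.arr a ≫ φ,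
        have := TransHom.lift a; inferInstance⟩ : TransHom w ⟨y⟩) := by
  refine TransHom.ext' rfl ?_ ?_
  · refine (congrArg (· * TransHom.grp a) (map_one _)).trans (one_mul _)
  · have h := A.unit_key a _ rfl
    have h' := congrArg (· ≫ φ) h
    simp only [Category.assoc] at h'
    exact h'

/-- The morphism `X ⟶ ⌊G\X⌋`, which is the identity on objects and sends `φ : x ⟶ y` to
`(1, 1 · x ⟶ x ⟶ y)`. -/
def toTransCat : X ⥤ᵇ A.transCat where
  toFunctor :=
    { obj x := ⟨x⟩
      map φ := TransHom.ofHom A φ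
      map_id x := TransHom.ext' (X.p.map_id x) rfl
        ((Category.comp_id _).trans (Category.id_comp _).symm)
      map_comp φ ψ := by
        rw [TransHom.comp_ofHom]
        exact TransHom.ext' (X.p.map_comp _ _) rfl
          ((Category.assoc _ _ _).symm.trans (Category.id_comp _).symm) }
  w := rfl

/-- If `X` is a fibered category, then so is `⌊G\X⌋`. -/
theorem isFibered_transCat (hX : X.p.IsFibered) : A.transCat.p.IsFibered := by
  refine Functor.IsFibered.of_exists_isStronglyCartesian ?_
  intro y R f
  have hc := Functor.IsPreFibered.pullbackMap.IsCartesian (p := X.p) (a := y.obj) rfl f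
  generalize Functor.IsPreFibered.pullbackMap (p := X.p) (a := y.obj) rfl f = c at hc
  generalize Functor.IsPreFibered.pullbackObj (p := X.p) (a := y.obj) rfl f = x at c hc
  obtain rfl : X.p.obj x = R := IsHomLift.domain_eq X.p f c
  obtain rfl : f = X.p.map c := IsHomLift.eq_of_isHomLift X.p f c
  refine ⟨⟨x⟩, TransHom.ofHom A c, ?_⟩
  have hs : A.transCat.p.IsHomLift (X.p.map c) (TransHom.ofHom A c) :=
    IsHomLift.map A.transCat.p (TransHom.ofHom A c)
  constructor
  intro w g φ hφ
  have hb : g ≫ X.p.map c = TransHom.base φ := IsHomLift.eq_of_isHomLift A.transCat.p _ φ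
  have hl : X.p.IsHomLift (g ≫ X.p.map c) (TransHom.arr φ) := hb ▸ TransHom.lift φ
  obtain ⟨δ, ⟨hδ, e⟩, hu⟩ := Functor.IsStronglyCartesian.universal_property X.p (X.p.map c) c g
    (g ≫ X.p.map c) rfl (TransHom.arr φ)
  let χ : w ⟶ (⟨x⟩ : A.TransObj) := (⟨g, TransHom.grp φ, δ, hδ⟩ : TransHom w ⟨x⟩)
  refine ⟨χ, ⟨IsHomLift.map A.transCat.p χ, ?_⟩, ?_⟩
  · rw [TransHom.comp_ofHom]
    exact TransHom.ext' hb rfl (e.trans (Category.id_comp _).symm)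
  · rintro ψ ⟨hψ, e'⟩
    have hb' : g = TransHom.base ψ := IsHomLift.eq_of_isHomLift A.transCat.p _ ψ
    rw [TransHom.comp_ofHom] at e'
    obtain ⟨b, k, ε, hε⟩ := ψ
    obtain rfl : g = b := hb'
    subst e'
    exact TransHom.ext' rfl rfl ((hu ε ⟨hε, rfl⟩).trans (Category.id_comp _).symm)

end GroupAction

end Actions

section Stackification

variable {C : Type u₁} [Category.{v₁} C] (J : GrothendieckTopology C)
  (Y : BasedCategory.{v₂, u₂} C)

/-- Objects of the stackification of `Y` over `T`: objects of `Y` with descent data relative to a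
covering sieve of `T`, that is, morphisms from a covering sieve of `T` to `Y`. -/
structure PlusObj where
  base : C
  sieve : Sieve base
  mem : sieve ∈ J base
  sec : sieveCat sieve ⥤ᵇ Y

variable {J Y}

namespace PlusObj

variable (a : PlusObj J Y)

/-- The value of the local section `a` at an arrow `i` of its sieve. -/
abbrev val {U : C} (i : U ⟶ a.base) (hi : a.sieve i) : Y.obj :=
  a.sec.obj ⟨Over.mk i, hi⟩

/-- The transition arrow of the local section `a` over `g`. -/
abbrev trans {V U : C} (g : V ⟶ U) (i : U ⟶ a.base) (hi : a.sieve i) (i' : V ⟶ a.base)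
    (hi' : a.sieve i') (w : g ≫ i = i') : a.val i' hi' ⟶ a.val i hi :=
  a.sec.map (ObjectProperty.homMk (Over.homMk g w))

theorem trans_lift {V U : C} (g : V ⟶ U) (i : U ⟶ a.base) (hi : a.sieve i) (i' : V ⟶ a.base)
    (hi' : a.sieve i') (w : g ≫ i = i') : Y.p.IsHomLift g (a.trans g i hi i' hi' w) :=
  have : (sieveCat a.sieve).p.IsHomLift g (ObjectProperty.homMk (Over.homMk g w) :
      (⟨Over.mk i', hi'⟩ : a.sieve.arrows.category) ⟶ ⟨Over.mk i, hi⟩) :=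
    IsHomLift.map (sieveCat a.sieve).p (a := ⟨Over.mk i', hi'⟩) (b := ⟨Over.mk i, hi⟩)
      (ObjectProperty.homMk (Over.homMk g w))
  a.sec.preserves_isHomLift g _

theorem trans_id {U : C} (i : U ⟶ a.base) (hi : a.sieve i) :
    a.trans (𝟙 U) i hi i hi (Category.id_comp i) = 𝟙 _ :=
  a.sec.map_id ⟨Over.mk i, hi⟩

theorem trans_comp {W V U : C} (g' : W ⟶ V) (g : V ⟶ U) (i : U ⟶ a.base) (hi : a.sieve i)
    (i' : V ⟶ a.base) (hi' : a.sieve i') (i'' : W ⟶ a.base) (hi'' : a.sieve i'')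
    (w : g ≫ i = i') (w' : g' ≫ i' = i'') :
    a.trans g' i' hi' i'' hi'' w' ≫ a.trans g i hi i' hi' w =
      a.trans (g' ≫ g) i hi i'' hi'' (by rw [Category.assoc, w, w']) :=
  (a.sec.map_comp _ _).symm

end PlusObj

/-- Arrows over `f` from `a` to `b`, defined on a covering sieve: compatible families of arrows
from the values of `a` to the corresponding values of `b`. -/
structure PlusPreHom (a b : PlusObj J Y) (f : a.base ⟶ b.base) where
  dom : Sieve a.base
  mem : dom ∈ J a.base
  le : dom ≤ a.sieve
  le' : dom ≤ b.sieve.pullback f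
  app : ∀ {U : C} (i : U ⟶ a.base) (hi : dom i) (j : U ⟶ b.base) (h : i ≫ f = j),
    a.val i (le _ hi) ⟶ b.val j (h ▸ le' _ hi)
  lift : ∀ {U : C} (i : U ⟶ a.base) (hi : dom i) (j : U ⟶ b.base) (h : i ≫ f = j),
    Y.p.IsHomLift (𝟙 U) (app i hi j h)
  naturality : ∀ {V U : C} (g : V ⟶ U) (i : U ⟶ a.base) (hi : dom i) (j : U ⟶ b.base)
    (h : i ≫ f = j) (i' : V ⟶ a.base) (hi' : dom i') (j' : V ⟶ b.base) (h' : i' ≫ f = j')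
    (w : g ≫ i = i') (w' : g ≫ j = j'),
    a.trans g i (le _ hi) i' (le _ hi') w ≫ app i hi j h =
      app i' hi' j' h' ≫ b.trans g j (h ▸ le' _ hi) j' (h' ▸ le' _ hi') w'

/-- Two locally defined arrows agree on some covering sieve. (The arrows `f` and `f'` of the base
will be equal.) -/
def PlusPreHom.Agree {a b : PlusObj J Y} {f f' : a.base ⟶ b.base} (s : PlusPreHom a b f)
    (t : PlusPreHom a b f') : Prop :=
  ∃ W ∈ J a.base, ∃ (h₁ : W ≤ s.dom) (h₂ : W ≤ t.dom), ∀ {U : C} (i : U ⟶ a.base) (hi : W i)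
    (j : U ⟶ b.base) (e : i ≫ f = j) (e' : i ≫ f' = j),
      s.app i (h₁ _ hi) j e = t.app i (h₂ _ hi) j e'

instance plusSetoid (a b : PlusObj J Y) (f : a.base ⟶ b.base) : Setoid (PlusPreHom a b f) where
  r s t := s.Agree t
  iseqv :=
    { refl s := ⟨s.dom, s.mem, le_rfl, le_rfl, fun _ _ _ _ _ => rfl⟩
      symm := fun ⟨W, hW, h₁, h₂, h⟩ =>
        ⟨W, hW, h₂, h₁, fun i hi j e e' => (h i hi j e' e).symm⟩
      trans := fun ⟨W, hW, h₁, _, h⟩ ⟨W', hW', _, h₂', h'⟩ =>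
        ⟨W ⊓ W', J.intersection_covering hW hW', inf_le_left.trans h₁, inf_le_right.trans h₂',
          fun i hi j e e' => (h i hi.1 j e e).trans (h' i hi.2 j e e')⟩ }

/-- Arrows of the stackification: arrows of the base together with a germ of a locally defined
arrow over it. -/
structure PlusHom (a b : PlusObj J Y) where
  base : a.base ⟶ b.base
  germ : Quotient (plusSetoid a b base)

/-- The arrow given by a locally defined arrow. -/
abbrev PlusHom.mk' {a b : PlusObj J Y} {f : a.base ⟶ b.base} (s : PlusPreHom a b f) :
    PlusHom a b :=
  ⟨f, Quotient.mk _ s⟩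

theorem PlusHom.mk'_eq {a b : PlusObj J Y} {f f' : a.base ⟶ b.base} {s : PlusPreHom a b f}
    {t : PlusPreHom a b f'} (e : f = f') (h : s.Agree t) : PlusHom.mk' s = PlusHom.mk' t := by
  subst e
  exact congrArg (PlusHom.mk f) (Quotient.sound h)

theorem PlusHom.exists_rep {a b : PlusObj J Y} (φ : PlusHom a b) :
    ∃ (f : a.base ⟶ b.base) (s : PlusPreHom a b f), φ = PlusHom.mk' s := by
  obtain ⟨f, s⟩ := φ
  obtain ⟨s, rfl⟩ := Quotient.exists_rep s
  exact ⟨f, s, rfl⟩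

/-- The identity arrow. -/
def PlusPreHom.id (a : PlusObj J Y) : PlusPreHom a a (𝟙 a.base) where
  dom := a.sieve
  mem := a.mem
  le := le_rfl
  le' := by rw [Sieve.pullback_id]
  app i hi j h := a.trans (𝟙 _) j (by rwa [← h, Category.comp_id]) i hi (by
    rw [← h, Category.id_comp, Category.comp_id])
  lift _ _ _ _ := a.trans_lift _ _ _ _ _ _
  naturality g i hi j h i' hi' j' h' w w' := by
    rw [a.trans_comp, a.trans_comp]
    congr 1
    simp

/-- The composition of locally defined arrows. -/
def PlusPreHom.comp {a b c : PlusObj J Y} {f : a.base ⟶ b.base} {g : b.base ⟶ c.base}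
    (s : PlusPreHom a b f) (t : PlusPreHom b c g) : PlusPreHom a c (f ≫ g) where
  dom := s.dom ⊓ t.dom.pullback f
  mem := J.intersection_covering s.mem (J.pullback_stable f t.mem)
  le := inf_le_left.trans s.le
  le' U i hi := by
    have := t.le' _ hi.2
    rwa [Sieve.pullback_apply, Category.assoc] at this
  app i hi j h := s.app i hi.1 (i ≫ f) rfl ≫ t.app (i ≫ f) hi.2 j (by rw [Category.assoc, h])
  lift i hi j h :=
    have := s.lift i hi.1 (i ≫ f) rfl
    have := t.lift (i ≫ f) hi.2 j (by rw [Category.assoc, h])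
    inferInstance
  naturality k i hi j h i' hi' j' h' w w' := by
    have hs := s.naturality k i hi.1 (i ≫ f) rfl i' hi'.1 (i' ≫ f) rfl w
      (by rw [← Category.assoc, w])
    have ht := t.naturality k (i ≫ f) hi.2 j
      (by rw [Category.assoc, h]) (i' ≫ f) hi'.2 j' (by rw [Category.assoc, h'])
      (by rw [← Category.assoc, w]) w'
    exact (Category.assoc _ _ _).symm.trans ((congrArg (· ≫ t.app _ _ _ _) hs).trans
      ((Category.assoc _ _ _).trans ((congrArg (s.app _ _ _ _ ≫ ·) ht).trans
        (Category.assoc _ _ _).symm)))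

theorem PlusPreHom.Agree.comp {a b c : PlusObj J Y} {f : a.base ⟶ b.base} {g : b.base ⟶ c.base}
    {s s' : PlusPreHom a b f} {t t' : PlusPreHom b c g} (h : s.Agree s') (h' : t.Agree t') :
    (s.comp t).Agree (s'.comp t') := by
  obtain ⟨W, hW, h₁, h₂, h⟩ := h
  obtain ⟨W', hW', h₁', h₂', h'⟩ := h'
  refine ⟨W ⊓ W'.pullback f, J.intersection_covering hW (J.pullback_stable f hW'),
    fun U i hi => ⟨h₁ _ hi.1, h₁' _ hi.2⟩, fun U i hi => ⟨h₂ _ hi.1, h₂' _ hi.2⟩, ?_⟩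
  intro U i hi j e e'
  have hj : (i ≫ f) ≫ g = j := by rw [Category.assoc, e]
  have e₁ := h i hi.1 (i ≫ f) rfl rfl
  have e₂ := h' (i ≫ f) hi.2 j hj hj
  exact (congrArg (· ≫ t.app _ (h₁' _ hi.2) _ hj) e₁).trans
    (congrArg (s'.app _ (h₂ _ hi.1) _ rfl ≫ ·) e₂)

/-- The composition of arrows of the stackification. -/
def PlusHom.comp {a b c : PlusObj J Y} (φ : PlusHom a b) (ψ : PlusHom b c) : PlusHom a c where
  base := φ.base ≫ ψ.base
  germ := Quotient.map₂ PlusPreHom.comp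
    (fun _ _ h _ _ h' => PlusPreHom.Agree.comp h h') φ.germ ψ.germ

theorem PlusHom.comp_mk' {a b c : PlusObj J Y} {f : a.base ⟶ b.base} {g : b.base ⟶ c.base}
    (s : PlusPreHom a b f) (t : PlusPreHom b c g) :
    (PlusHom.mk' s).comp (PlusHom.mk' t) = PlusHom.mk' (s.comp t) := rfl

theorem PlusPreHom.app_comp_congr {a b c : PlusObj J Y} {f : a.base ⟶ b.base}
    {g : b.base ⟶ c.base} (s : PlusPreHom a b f) (t : PlusPreHom b c g) {U : C} (i : U ⟶ a.base)
    (hi : s.dom i) (j j' : U ⟶ b.base) (e : j = j') (h : i ≫ f = j) (hj : t.dom j)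
    (k : U ⟶ c.base) (hk : j ≫ g = k) :
    s.app i hi j h ≫ t.app j hj k hk =
      s.app i hi j' (h.trans e) ≫ t.app j' (e ▸ hj) k (e ▸ hk) := by
  subst e; rfl

instance : Category (PlusObj J Y) where
  Hom := PlusHom
  id a := PlusHom.mk' (PlusPreHom.id a)
  comp := PlusHom.comp
  id_comp φ := by
    obtain ⟨f, s, rfl⟩ := φ.exists_rep
    rw [PlusHom.comp_mk']
    refine PlusHom.mk'_eq (Category.id_comp f) ⟨_, ((PlusPreHom.id _).comp s).mem, le_rfl,
      fun U i hi => by simpa using hi.2, ?_⟩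
    intro U i hi j e e'
    have h := s.naturality (𝟙 U) (i ≫ 𝟙 _) hi.2 j (by simpa using e') i (by simpa using hi.2) j e'
      (by simp) (by simp)
    exact h.trans ((congrArg (s.app _ _ _ _ ≫ ·) (PlusObj.trans_id _ _ _)).trans
      (Category.comp_id _))
  comp_id φ := by
    obtain ⟨f, s, rfl⟩ := φ.exists_rep
    rw [PlusHom.comp_mk']
    refine PlusHom.mk'_eq (Category.comp_id f) ⟨_, (s.comp (PlusPreHom.id _)).mem, le_rfl,
      fun U i hi => hi.1, ?_⟩
    intro U i hi j e e'
    subst e'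
    exact (congrArg (s.app i hi.1 (i ≫ f) rfl ≫ ·) (PlusObj.trans_id _ _ _)).trans
      (Category.comp_id _)
  assoc φ ψ χ := by
    obtain ⟨f, s, rfl⟩ := φ.exists_rep
    obtain ⟨g, t, rfl⟩ := ψ.exists_rep
    obtain ⟨h, r, rfl⟩ := χ.exists_rep
    rw [PlusHom.comp_mk', PlusHom.comp_mk', PlusHom.comp_mk', PlusHom.comp_mk']
    refine PlusHom.mk'_eq (Category.assoc f g h) ⟨_, ((s.comp t).comp r).mem, le_rfl,
      fun U i hi => ⟨hi.1.1, hi.1.2, by simpa using hi.2⟩, ?_⟩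
    intro U i hi j e e'
    refine (Category.assoc _ _ _).trans (congrArg (s.app i hi.1.1 (i ≫ f) rfl ≫ ·) ?_)
    exact t.app_comp_congr r (i ≫ f) hi.1.2 (i ≫ (f ≫ g)) ((i ≫ f) ≫ g) (by simp) _ hi.2 j _

variable (J Y)

/-- The stackification of a prestack `Y`: objects are glued and arrows are sheafified. -/
abbrev stackification : BasedCategory.{max u₁ v₁ v₂, max u₁ v₁ u₂ v₂} C where
  obj := PlusObj J Y
  p :=
    { obj a := a.base
      map φ := PlusHom.base φ }

variable {Y}

/-- A choice of the pullback of `y` along `i`. -/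
noncomputable abbrev pbObj (hY : Y.p.IsFibered) (y : Y.obj) {U : C} (i : U ⟶ Y.p.obj y) : Y.obj :=
  have := hY
  Functor.IsPreFibered.pullbackObj (p := Y.p) (a := y) rfl i

/-- The projection of the pullback of `y` along `i` to `y`. -/
noncomputable abbrev pbMap (hY : Y.p.IsFibered) (y : Y.obj) {U : C} (i : U ⟶ Y.p.obj y) :
    pbObj hY y i ⟶ y :=
  have := hY
  Functor.IsPreFibered.pullbackMap (p := Y.p) (a := y) rfl i

theorem pbMap_cartesian (hY : Y.p.IsFibered) (y : Y.obj) {U : C} (i : U ⟶ Y.p.obj y) :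
    Y.p.IsStronglyCartesian i (pbMap hY y i) :=
  inferInstance

theorem pbMap_lift (hY : Y.p.IsFibered) (y : Y.obj) {U : C} (i : U ⟶ Y.p.obj y) :
    Y.p.IsHomLift i (pbMap hY y i) :=
  inferInstance

/-- The arrow to the pullback induced by its universal property. -/
noncomputable def pbDesc (hY : Y.p.IsFibered) (y : Y.obj) {V U : C} (i : U ⟶ Y.p.obj y)
    (g : V ⟶ U) {x : Y.obj} (ψ : x ⟶ y) (h : Y.p.IsHomLift (g ≫ i) ψ) : x ⟶ pbObj hY y i :=
  have := pbMap_cartesian hY y i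
  Functor.IsStronglyCartesian.map Y.p i (pbMap hY y i) (g := g) rfl ψ

theorem pbDesc_lift (hY : Y.p.IsFibered) (y : Y.obj) {V U : C} (i : U ⟶ Y.p.obj y)
    (g : V ⟶ U) {x : Y.obj} (ψ : x ⟶ y) (h : Y.p.IsHomLift (g ≫ i) ψ) :
    Y.p.IsHomLift g (pbDesc hY y i g ψ h) :=
  Functor.IsStronglyCartesian.map_isHomLift Y.p i (pbMap hY y i) (rfl : g ≫ i = g ≫ i) ψ

theorem pbDesc_fac (hY : Y.p.IsFibered) (y : Y.obj) {V U : C} (i : U ⟶ Y.p.obj y)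
    (g : V ⟶ U) {x : Y.obj} (ψ : x ⟶ y) (h : Y.p.IsHomLift (g ≫ i) ψ) :
    pbDesc hY y i g ψ h ≫ pbMap hY y i = ψ :=
  Functor.IsStronglyCartesian.fac Y.p i (pbMap hY y i) (rfl : g ≫ i = g ≫ i) ψ

theorem pb_ext (hY : Y.p.IsFibered) (y : Y.obj) {V U : C} (i : U ⟶ Y.p.obj y)
    (g : V ⟶ U) {x : Y.obj} {ψ ψ' : x ⟶ pbObj hY y i} (h : Y.p.IsHomLift g ψ)
    (h' : Y.p.IsHomLift g ψ') (e : ψ ≫ pbMap hY y i = ψ' ≫ pbMap hY y i) : ψ = ψ' :=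
  have := pbMap_cartesian hY y i
  Functor.IsStronglyCartesian.ext Y.p i (pbMap hY y i) g e

theorem pbMap_lift_of_eq (hY : Y.p.IsFibered) (y : Y.obj) {V U : C} {i : U ⟶ Y.p.obj y}
    {i' : V ⟶ Y.p.obj y} {g : V ⟶ U} (w : g ≫ i = i') :
    Y.p.IsHomLift (g ≫ i) (pbMap hY y i') :=
  w ▸ pbMap_lift hY y i'

theorem id_lift_pbObj (hY : Y.p.IsFibered) (y : Y.obj) {U : C} (i : U ⟶ Y.p.obj y) :
    Y.p.IsHomLift (𝟙 U) (𝟙 (pbObj hY y i)) :=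
  have := hY
  IsHomLift.id (Functor.IsPreFibered.pullbackObj_proj rfl i)

/-- An object `y` of a fibered category over `T` as a morphism `T ⟶ Y`, restricted to the maximal
sieve: it sends `i : U ⟶ T` to (a choice of) the pullback of `y` along `i`. -/
noncomputable def yonedaSection (hY : Y.p.IsFibered) (y : Y.obj) :
    sieveCat (⊤ : Sieve (Y.p.obj y)) ⥤ᵇ Y where
  toFunctor :=
    { obj i := pbObj hY y i.obj.hom
      map {i' i} g := pbDesc hY y i.obj.hom g.hom.left (pbMap hY y i'.obj.hom)
        (pbMap_lift_of_eq hY y (Over.w g.hom))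
      map_id i := pb_ext hY y i.obj.hom (𝟙 i.obj.left) (pbDesc_lift _ _ _ _ _ _)
        (id_lift_pbObj _ _ _) ((pbDesc_fac _ _ _ _ _ _).trans (Category.id_comp _).symm)
      map_comp {i'' i' i} g' g :=
        have h₁ := pbDesc_lift hY y i.obj.hom g.hom.left _ (pbMap_lift_of_eq hY y (Over.w g.hom))
        have h₂ := pbDesc_lift hY y i'.obj.hom g'.hom.left _
          (pbMap_lift_of_eq hY y (Over.w g'.hom))
        pb_ext hY y i.obj.hom (g'.hom.left ≫ g.hom.left) (pbDesc_lift _ _ _ _ _ _)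
          inferInstance (by
            rw [pbDesc_fac, Category.assoc, pbDesc_fac, pbDesc_fac]) }
  w := CategoryTheory.Functor.ext
    (fun i => Functor.IsPreFibered.pullbackObj_proj (p := Y.p) (a := y) rfl i.obj.hom)
    (fun i' i g =>
      have := pbDesc_lift hY y i.obj.hom g.hom.left _ (pbMap_lift_of_eq hY y (Over.w g.hom))
      IsHomLift.fac' Y.p g.hom.left (pbDesc hY y i.obj.hom g.hom.left (pbMap hY y i'.obj.hom)
        (pbMap_lift_of_eq hY y (Over.w g.hom))))

/-- An object of `Y` as an object of the stackification. -/
noncomputable abbrev unitObj (hY : Y.p.IsFibered) (y : Y.obj) : PlusObj J Y :=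
  ⟨Y.p.obj y, ⊤, J.top_mem _, yonedaSection hY y⟩

theorem pbMap_comp_lift (hY : Y.p.IsFibered) {y y' : Y.obj} (φ : y ⟶ y') {V U : C}
    {i : V ⟶ Y.p.obj y} {g : V ⟶ U} {j : U ⟶ Y.p.obj y'} (h : i ≫ Y.p.map φ = g ≫ j) :
    Y.p.IsHomLift (g ≫ j) (pbMap hY y i ≫ φ) :=
  have := pbMap_lift hY y i
  h ▸ inferInstance

/-- An arrow of `Y` as a (globally defined) arrow between the associated sections. -/
noncomputable def unitMap (hY : Y.p.IsFibered) {y y' : Y.obj} (φ : y ⟶ y') :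
    PlusPreHom (unitObj J hY y) (unitObj J hY y') (Y.p.map φ) where
  dom := ⊤
  mem := J.top_mem _
  le := le_rfl
  le' := le_rfl
  app {U} i _ j h := pbDesc hY y' j (𝟙 U) (pbMap hY y i ≫ φ)
    (pbMap_comp_lift hY φ (h.trans (Category.id_comp _).symm))
  lift _ _ _ _ := pbDesc_lift _ _ _ _ _ _
  naturality {V U} g i _ j h i' _ j' h' w w' := by
    have h₁ := pbDesc_lift hY y i g _ (pbMap_lift_of_eq hY y w)
    have h₂ := pbDesc_lift hY y' j (𝟙 U) (pbMap hY y i ≫ φ)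
      (pbMap_comp_lift hY φ (h.trans (Category.id_comp _).symm))
    have h₃ := pbDesc_lift hY y' j g _ (pbMap_lift_of_eq hY y' w')
    have h₄ := pbDesc_lift hY y' j' (𝟙 V) (pbMap hY y i' ≫ φ)
      (pbMap_comp_lift hY φ (h'.trans (Category.id_comp _).symm))
    have key : pbDesc hY y i g _ (pbMap_lift_of_eq hY y w) ≫
        pbDesc hY y' j (𝟙 U) (pbMap hY y i ≫ φ)
          (pbMap_comp_lift hY φ (h.trans (Category.id_comp _).symm)) =
        pbDesc hY y' j' (𝟙 V) (pbMap hY y i' ≫ φ)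
          (pbMap_comp_lift hY φ (h'.trans (Category.id_comp _).symm)) ≫
        pbDesc hY y' j g _ (pbMap_lift_of_eq hY y' w') := by
      refine pb_ext hY y' j g inferInstance inferInstance ?_
      rw [Category.assoc, Category.assoc, pbDesc_fac, pbDesc_fac, pbDesc_fac, ← Category.assoc,
        pbDesc_fac]
    exact key

/-- The unit `Y ⟶ Y⁺` of the stackification of a fibered category. -/
noncomputable def toStackification (hY : Y.p.IsFibered) : Y ⥤ᵇ stackification J Y where
  toFunctor :=
    { obj y := unitObj J hY y
      map φ := PlusHom.mk' (unitMap J hY φ)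
      map_id y := by
        refine PlusHom.mk'_eq (Y.p.map_id y) ⟨⊤, J.top_mem _, le_rfl, le_rfl, ?_⟩
        intro U i _ j e e'
        have key : pbDesc hY y j (𝟙 U) (pbMap hY y i ≫ 𝟙 y)
            (pbMap_comp_lift hY (𝟙 y) (e.trans (Category.id_comp _).symm)) =
          pbDesc hY y j (𝟙 U) (pbMap hY y i) (pbMap_lift_of_eq hY y (by
            rw [← e', Category.id_comp, Category.comp_id])) := by
          congr 1
          exact Category.comp_id _
        exact key
      map_comp {y y' y''} φ ψ := by
        refine PlusHom.mk'_eq (Y.p.map_comp φ ψ) ⟨⊤, J.top_mem _, le_rfl,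
          fun _ _ _ => ⟨trivial, trivial⟩, ?_⟩
        intro U i _ j e e'
        have l₁ := pbDesc_lift hY y' (i ≫ Y.p.map φ) (𝟙 U) (pbMap hY y i ≫ φ)
          (pbMap_comp_lift hY φ (Category.id_comp _).symm)
        have e₁ : (i ≫ Y.p.map φ) ≫ Y.p.map ψ = 𝟙 U ≫ j := by
          rw [Category.assoc, e', Category.id_comp]
        have l₂ := pbDesc_lift hY y'' j (𝟙 U) (pbMap hY y' (i ≫ Y.p.map φ) ≫ ψ)
          (pbMap_comp_lift hY ψ e₁)
        have key : pbDesc hY y'' j (𝟙 U) (pbMap hY y i ≫ φ ≫ ψ)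
            (pbMap_comp_lift hY (φ ≫ ψ) (e.trans (Category.id_comp _).symm)) =
          pbDesc hY y' (i ≫ Y.p.map φ) (𝟙 U) (pbMap hY y i ≫ φ)
            (pbMap_comp_lift hY φ (Category.id_comp _).symm) ≫
          pbDesc hY y'' j (𝟙 U) (pbMap hY y' (i ≫ Y.p.map φ) ≫ ψ)
            (pbMap_comp_lift hY ψ e₁) := by
          refine pb_ext hY y'' j (𝟙 U) (pbDesc_lift _ _ _ _ _ _) inferInstance ?_
          rw [Category.assoc, pbDesc_fac, pbDesc_fac, ← Category.assoc (pbDesc _ _ _ _ _ _),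
            pbDesc_fac, Category.assoc]
        exact key }
  w := rfl

end Stackification

section Quotient

variable {C : Type u₁} [Category.{v₁} C] (J : GrothendieckTopology C) {G : Cᵒᵖ ⥤ GrpCat.{r}}
  {X : BasedCategory.{v₂, u₂} C} (A : GroupAction G X)

/-- The quotient stack `[G\X]` of an action on a stack: the stackification of the transformation
prestack `⌊G\X⌋`. -/
abbrev quotientStack : BasedCategory.{max r u₁ v₁ v₂, max r u₁ v₁ u₂ v₂} C :=
  stackification J A.transCat

/-- The canonical morphism `X ⟶ ⌊G\X⌋ ⟶ [G\X]`. -/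
noncomputable def quotientMap (hX : X.p.IsFibered) : X ⥤ᵇ quotientStack J A :=
  A.toTransCat.comp (toStackification J (A.isFibered_transCat hX))

end Quotient

section Spaces

universe u

/-- The property of a topological space of being compactly generated. -/
abbrev compactlyGenerated : ObjectProperty TopCat.{u} :=
  fun T => CompactlyGeneratedSpace T

variable {P : ObjectProperty TopCat.{u}}

/-- The open-cover topology on a full subcategory of topological spaces: it is generated by the
jointly surjective families of open embeddings. -/
abbrev openCovers (P : ObjectProperty TopCat.{u}) : GrothendieckTopology P.FullSubcategory :=
  (TopCat.precoverage.comap P.ι).toGrothendieck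

/-- A group structure on a space `G` of a category of spaces makes `G` a group object of that
category: inversion is continuous, and pointwise products of continuous maps `T → G` from the
spaces of the category are continuous. (In the category of all spaces, take `T = G × G` to see that
this says that `G` is a topological group; in the category of compactly generated spaces, it is
continuity of the multiplication on the product formed in that category.) -/
structure IsGroupSpace (G : P.FullSubcategory) [Group G.obj] : Prop where
  continuous_mul : ∀ (T : P.FullSubcategory) (f g : T.obj → G.obj), Continuous f → Continuous g →
    Continuous fun t => f t * g t
  continuous_inv : Continuous fun x : G.obj => x⁻¹

/-- The group `G(T)` of continuous maps `T → G`. -/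
def contMaps {G : P.FullSubcategory} [Group G.obj] (hG : IsGroupSpace G) (T : P.FullSubcategory) :
    Subgroup (T.obj → G.obj) where
  carrier := {f | Continuous f}
  mul_mem' hf hg := hG.continuous_mul T _ _ hf hg
  one_mem' := continuous_const
  inv_mem' hf := hG.continuous_inv.comp hf

/-- The sheaf of groups represented by `G`. -/
def groupSheaf {G : P.FullSubcategory} [Group G.obj] (hG : IsGroupSpace G) :
    P.FullSubcategoryᵒᵖ ⥤ GrpCat.{u} where
  obj T := GrpCat.of (contMaps hG T.unop)
  map {T T'} φ := GrpCat.ofHom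
    { toFun f := ⟨fun t => f.1 (φ.unop.hom t), Continuous.comp f.2 φ.unop.hom.hom.continuous⟩
      map_one' := rfl
      map_mul' _ _ := rfl }

end Spaces

end TopStack

universe u v w

/-!
The quotient stack `[G\X]` is the stackification of the transformation prestack `⌊G\X⌋`.

It is a stack, because `⌊G\X⌋` is a prestack: compatible local arrows `(g, g · x ⟶ y)` glue, first
the sections `g`, since `G` is a sheaf, and then the arrows of `X`, since `X` is a stack
(`GroupAction.isPrestack_transCat`); and the stackification of a prestack is a stack
(`isStack_stackification`), since the unit of the stackification is fully faithful for a prestack,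
so that descent data can be compared with local sections of the prestack itself.

It has an atlas, because both `X ⟶ ⌊G\X⌋` (the identity on objects) and `⌊G\X⌋ ⟶ [G\X]` are
epimorphisms, and epimorphisms compose (`IsEpimorphism.comp`).

Its diagonal is representable if and only if the arrows between any two objects `a` and `b` form
a representable sheaf over the base, `HasIsom` (`isRepresentable_diag_of_hasIsom`,
`hasIsom_of_isRepresentable_diag`). In `⌊G\X⌋` an arrow from `x` to `y` is a section `g` of `G` and
an arrow `g · x ⟶ y` of `X`; so the space of such arrows is a space of arrows of `X` over `T × G`
(`GroupAction.hasIsom_transCat`). In `[G\X]` objects come locally from `⌊G\X⌋`, so the sheaf of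
arrows is locally representable on `T`. It remains to glue representing spaces along an open cover
(`HasIsom.of_local`), and this is the one point where topology enters: a sheaf `F` over `T` that is
representable over the members of an open cover is represented by the set `F(pt)`, with the final
topology with respect to all sections of `F` over all spaces (`exists_universal_of_open`).
All that is used of the category of spaces are the two closure properties of `IsConvenient`, which
make open subspaces and final topologies available both for all spaces and for compactly generated
ones.
-/

namespace TopStack

universe r v₁ u₁ v₂ u₂ v₃ u₃ v₄ u₄

/-! ### Arrows of categories fibered in groupoids -/

section Lifting

variable {C : Type u₁} [Category.{v₁} C] {Z : BasedCategory.{v₂, u₂} C}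

theorem lift_comp {T U V : C} {f : T ⟶ U} {g : U ⟶ V} {k : T ⟶ V} {a b c : Z.obj} {φ : a ⟶ b}
    {ψ : b ⟶ c} (hφ : Z.p.IsHomLift f φ) (hψ : Z.p.IsHomLift g ψ) (w : f ≫ g = k := by simp) :
    Z.p.IsHomLift k (φ ≫ ψ) := by
  subst w; infer_instance

theorem lift_congr {T U : C} {f f' : T ⟶ U} {a b : Z.obj} {φ : a ⟶ b}
    (hφ : Z.p.IsHomLift f φ) (w : f = f' := by simp) : Z.p.IsHomLift f' φ := w ▸ hφ

theorem lift_map {a b : Z.obj} {f : Z.p.obj a ⟶ Z.p.obj b} {φ : a ⟶ b} (w : Z.p.map φ = f) :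
    Z.p.IsHomLift f φ := w ▸ .map φ

theorem map_eq_of_lift {a b : Z.obj} {f : Z.p.obj a ⟶ Z.p.obj b} {φ : a ⟶ b}
    (h : Z.p.IsHomLift f φ) : Z.p.map φ = f :=
  (IsHomLift.eq_of_isHomLift Z.p f φ).symm

theorem lift_unique {T U : C} {f f' : T ⟶ U} {a b : Z.obj} {φ : a ⟶ b}
    (h : Z.p.IsHomLift f φ) (h' : Z.p.IsHomLift f' φ) : f = f' := by
  rw [IsHomLift.fac Z.p f φ, IsHomLift.fac Z.p f' φ]

/-- An arrow of the base into the base of `a` lifts to an arrow into `a`. -/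
theorem IsFiberedInGroupoids.exists_lift (h : IsFiberedInGroupoids Z) {S T : C} {a : Z.obj}
    (ha : Z.p.obj a = T) (f : S ⟶ T) : ∃ (b : Z.obj) (φ : b ⟶ a), Z.p.IsHomLift f φ := by
  have := h.isFibered
  subst ha
  exact ⟨_, Functor.IsPreFibered.pullbackMap rfl f, inferInstance⟩

/-- In a category fibered in groupoids, every arrow is strongly cartesian. -/
theorem IsFiberedInGroupoids.isStronglyCartesian (h : IsFiberedInGroupoids Z) {S T : C}
    {f : S ⟶ T} {a b : Z.obj} {φ : a ⟶ b} (hφ : Z.p.IsHomLift f φ) :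
    Z.p.IsStronglyCartesian f φ := by
  have := h.isFibered
  have hb := IsHomLift.codomain_eq Z.p f φ
  let π := Functor.IsPreFibered.pullbackMap hb f
  let χ := Functor.IsCartesian.map Z.p f π φ
  have hχ : Z.p.IsHomLift (𝟙 S) χ := inferInstance
  have := h.isIso _ _ _ χ hχ
  have e : χ ≫ π = φ := Functor.IsCartesian.fac Z.p f π φ
  have : Z.p.IsStronglyCartesian (𝟙 S ≫ f) (χ ≫ π) := inferInstance
  rwa [Category.id_comp, e] at this

/-- A based category is fibered in groupoids if arrows of the base lift, and lift uniquely through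
every given arrow. -/
theorem IsFiberedInGroupoids.of_unique_lift
    (hl : ∀ (a : Z.obj) {S : C} (f : S ⟶ Z.p.obj a),
      ∃ (b : Z.obj) (φ : b ⟶ a), Z.p.IsHomLift f φ)
    (hf : ∀ {a a' b : Z.obj} (φ : a ⟶ b) (φ' : a' ⟶ b) (g : Z.p.obj a' ⟶ Z.p.obj a),
      g ≫ Z.p.map φ = Z.p.map φ' → ∃! χ : a' ⟶ a, Z.p.map χ = g ∧ χ ≫ φ = φ') :
    IsFiberedInGroupoids Z := by
  have hc : ∀ {a b : Z.obj} {S T : C} (f : S ⟶ T) (φ : a ⟶ b), Z.p.IsHomLift f φ →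
      Z.p.IsStronglyCartesian f φ := by
    intro a b S T f φ h
    obtain ⟨⟩ := h
    constructor
    intro a' g φ' h'
    obtain ⟨χ, ⟨h₁, h₂⟩, h₃⟩ := hf φ φ' g (map_eq_of_lift h').symm
    exact ⟨χ, ⟨lift_map h₁, h₂⟩, fun ψ hψ => h₃ ψ ⟨map_eq_of_lift hψ.1, hψ.2⟩⟩
  refine ⟨.of_exists_isStronglyCartesian fun a R f => ?_, fun T a b φ h => ?_⟩
  · obtain ⟨b, φ, h⟩ := hl a f
    exact ⟨b, φ, hc f φ h⟩
  · have := hc _ φ h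
    exact Functor.IsStronglyCartesian.isIso_of_base_isIso Z.p (𝟙 T) φ

/-- The unique arrow over `g` through which `φ'` factors as `fill ≫ φ`. -/
noncomputable def IsFiberedInGroupoids.fill (h : IsFiberedInGroupoids Z) {R S T : C} {f : S ⟶ T}
    {f' : R ⟶ T} {a a' b : Z.obj} {φ : a ⟶ b} (hφ : Z.p.IsHomLift f φ) {φ' : a' ⟶ b}
    (hφ' : Z.p.IsHomLift f' φ') (g : R ⟶ S) (w : g ≫ f = f') : a' ⟶ a :=
  have := h.isStronglyCartesian hφ
  Functor.IsStronglyCartesian.map Z.p f φ w.symm φ'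

section

variable (h : IsFiberedInGroupoids Z) {R S T : C} {f : S ⟶ T} {f' : R ⟶ T} {a a' b : Z.obj}
  {φ : a ⟶ b} (hφ : Z.p.IsHomLift f φ) {φ' : a' ⟶ b} (hφ' : Z.p.IsHomLift f' φ') (g : R ⟶ S)
  (w : g ≫ f = f')

theorem IsFiberedInGroupoids.fill_lift : Z.p.IsHomLift g (h.fill hφ hφ' g w) :=
  have := h.isStronglyCartesian hφ
  Functor.IsStronglyCartesian.map_isHomLift Z.p f φ w.symm φ'

@[simp]
theorem IsFiberedInGroupoids.fill_fac : h.fill hφ hφ' g w ≫ φ = φ' :=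
  have := h.isStronglyCartesian hφ
  Functor.IsStronglyCartesian.fac Z.p f φ w.symm φ'

/-- An arrow `φ'` factors through `φ` as soon as it does so in the base. -/
theorem IsFiberedInGroupoids.exists_fill (h : IsFiberedInGroupoids Z) {R S T : C} {f : S ⟶ T}
    {f' : R ⟶ T} {a a' b : Z.obj} {φ : a ⟶ b} (hφ : Z.p.IsHomLift f φ) {φ' : a' ⟶ b}
    (hφ' : Z.p.IsHomLift f' φ') (g : R ⟶ S) (w : g ≫ f = f') :
    ∃ χ : a' ⟶ a, Z.p.IsHomLift g χ ∧ χ ≫ φ = φ' :=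
  ⟨_, h.fill_lift hφ hφ' g w, h.fill_fac hφ hφ' g w⟩

end

/-- Two arrows over the same arrow of the base agree if they agree after composition with some
arrow. -/
theorem IsFiberedInGroupoids.ext (h : IsFiberedInGroupoids Z) {R S T : C} {f : S ⟶ T} {g : R ⟶ S}
    {a a' b : Z.obj} {φ : a ⟶ b} (hφ : Z.p.IsHomLift f φ) {χ χ' : a' ⟶ a}
    (hχ : Z.p.IsHomLift g χ) (hχ' : Z.p.IsHomLift g χ') (e : χ ≫ φ = χ' ≫ φ) : χ = χ' :=
  have := h.isStronglyCartesian hφ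
  Functor.IsStronglyCartesian.ext Z.p f φ g e

/-- A choice of the pullback of `a` along `i`. -/
noncomputable def IsFiberedInGroupoids.liftObj (h : IsFiberedInGroupoids Z) {U T : C} {a : Z.obj}
    (ha : Z.p.obj a = T) (i : U ⟶ T) : Z.obj :=
  (h.exists_lift ha i).choose

/-- The projection of the chosen pullback of `a` along `i`. -/
noncomputable def IsFiberedInGroupoids.liftMap (h : IsFiberedInGroupoids Z) {U T : C} {a : Z.obj}
    (ha : Z.p.obj a = T) (i : U ⟶ T) : h.liftObj ha i ⟶ a :=
  (h.exists_lift ha i).choose_spec.choose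

theorem IsFiberedInGroupoids.liftMap_lift (h : IsFiberedInGroupoids Z) {U T : C} {a : Z.obj}
    (ha : Z.p.obj a = T) (i : U ⟶ T) : Z.p.IsHomLift i (h.liftMap ha i) :=
  (h.exists_lift ha i).choose_spec.choose_spec

theorem IsFiberedInGroupoids.obj_liftObj (h : IsFiberedInGroupoids Z) {U T : C} {a : Z.obj}
    (ha : Z.p.obj a = T) (i : U ⟶ T) : Z.p.obj (h.liftObj ha i) = U :=
  have := h.liftMap_lift ha i
  IsHomLift.domain_eq Z.p i (h.liftMap ha i)

/-- A based functor, from its values on objects and on arrows. -/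
abbrev basedFunctorMk {W : BasedCategory.{v₃, u₃} C} (F : W.obj ⥤ Z.obj)
    (hF : ∀ {a b : W.obj} (φ : a ⟶ b), Z.p.IsHomLift (W.p.map φ) (F.map φ)) : W ⥤ᵇ Z where
  toFunctor := F
  w := CategoryTheory.Functor.ext
    (fun a => by
      have := hF (𝟙 a)
      exact IsHomLift.domain_eq Z.p (W.p.map (𝟙 a)) (F.map (𝟙 a)))
    (fun a b φ => by
      have := hF φ
      exact IsHomLift.fac' Z.p (W.p.map φ) (F.map φ))

/-- An object `a` over `T` as a morphism `T ⟶ Z`. -/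
noncomputable def IsFiberedInGroupoids.sectionOf (h : IsFiberedInGroupoids Z) {T : C} {a : Z.obj}
    (ha : Z.p.obj a = T) : rep T ⥤ᵇ Z :=
  basedFunctorMk
    { obj i := h.liftObj ha i.hom
      map {i' i} g := h.fill (h.liftMap_lift ha i.hom) (h.liftMap_lift ha i'.hom) g.left (Over.w g)
      map_id i := h.ext (h.liftMap_lift ha i.hom) (h.fill_lift _ _ _ _)
        (IsHomLift.id (h.obj_liftObj ha i.hom)) (by simp)
      map_comp g g' := h.ext (h.liftMap_lift ha _) (h.fill_lift _ _ _ _)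
        (lift_comp (h.fill_lift _ _ _ _) (h.fill_lift _ _ _ _)) (by simp) }
    (fun {i' i} g => h.fill_lift (h.liftMap_lift ha i.hom) (h.liftMap_lift ha i'.hom) g.left
      (Over.w g))

/-- The projections from the values of the section associated to `a` to `a`. -/
noncomputable def IsFiberedInGroupoids.sectionProj (h : IsFiberedInGroupoids Z) {T : C} {a : Z.obj}
    (ha : Z.p.obj a = T) (i : Over T) : (h.sectionOf ha).obj i ⟶ a :=
  h.liftMap ha i.hom

theorem IsFiberedInGroupoids.sectionProj_lift (h : IsFiberedInGroupoids Z) {T : C} {a : Z.obj}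
    (ha : Z.p.obj a = T) (i : Over T) : Z.p.IsHomLift i.hom (h.sectionProj ha i) :=
  h.liftMap_lift ha i.hom

theorem IsFiberedInGroupoids.sectionOf_map (h : IsFiberedInGroupoids Z) {T : C} {a : Z.obj}
    (ha : Z.p.obj a = T) {i' i : Over T} (g : i' ⟶ i) :
    (h.sectionOf ha).map g ≫ h.sectionProj ha i = h.sectionProj ha i' :=
  h.fill_fac (h.liftMap_lift ha i.hom) (h.liftMap_lift ha i'.hom) g.left (Over.w g)

theorem rep_map_lift {T : C} (s : rep T ⥤ᵇ Z) {i' i : Over T} (g : i' ⟶ i) :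
    Z.p.IsHomLift g.left (s.map g) :=
  have : (rep T).p.IsHomLift g.left g := .map (p := (rep T).p) g
  s.preserves_isHomLift g.left g

theorem sieveCat_map_lift {T : C} {R : Sieve T} (s : sieveCat R ⥤ᵇ Z) {i' i : (sieveCat R).obj}
    (g : i' ⟶ i) : Z.p.IsHomLift g.hom.left (s.map g) :=
  have : (sieveCat R).p.IsHomLift g.hom.left g := .map (p := (sieveCat R).p) g
  s.preserves_isHomLift g.hom.left g

end Lifting

/-! ### Prestacks -/

section Prestack

variable {C : Type u₁} [Category.{v₁} C] (J : GrothendieckTopology C)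

/-- A choice of pullbacks of `a` along the arrows of a sieve on its base. -/
structure LiftSystem {Z : BasedCategory.{v₂, u₂} C} {T : C} (R : Sieve T) (a : Z.obj) where
  obj : ∀ {U : C} (i : U ⟶ T), R i → Z.obj
  map : ∀ {U : C} (i : U ⟶ T) (hi : R i), obj i hi ⟶ a
  lift : ∀ {U : C} (i : U ⟶ T) (hi : R i), Z.p.IsHomLift i (map i hi)

namespace LiftSystem

variable {Z : BasedCategory.{v₂, u₂} C} {T T' : C} {R : Sieve T} {a : Z.obj}
  (L : LiftSystem R a) {b : Z.obj}

/-- A family of arrows from the pullbacks of `a` to `b` is compatible if it commutes with the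
arrows between the pullbacks. -/
def Compatible (φ : ∀ ⦃U : C⦄ (i : U ⟶ T) (hi : R i), L.obj i hi ⟶ b) : Prop :=
  ∀ {V U : C} (i : U ⟶ T) (hi : R i) (i' : V ⟶ T) (hi' : R i') (g : V ⟶ U) (_ : g ≫ i = i')
    (η : L.obj i' hi' ⟶ L.obj i hi), Z.p.IsHomLift g η → η ≫ L.map i hi = L.map i' hi' →
    η ≫ φ i hi = φ i' hi'

/-- Compatible families of arrows to `b` over the arrows `i ≫ f` glue uniquely. -/
def Glues (f : T ⟶ T') (b : Z.obj) : Prop :=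
  ∀ φ : (∀ ⦃U : C⦄ (i : U ⟶ T) (hi : R i), L.obj i hi ⟶ b),
    (∀ {U : C} (i : U ⟶ T) (hi : R i), Z.p.IsHomLift (i ≫ f) (φ i hi)) →
    L.Compatible φ → ∃! ψ : a ⟶ b, Z.p.IsHomLift f ψ ∧
      ∀ {U : C} (i : U ⟶ T) (hi : R i), L.map i hi ≫ ψ = φ i hi

end LiftSystem

/-- A prestack: arrows of `Z` satisfy descent. -/
def IsPrestack (Z : BasedCategory.{v₂, u₂} C) : Prop :=
  ∀ ⦃T T' : C⦄ (f : T ⟶ T') (a b : Z.obj), Z.p.obj a = T → Z.p.obj b = T' →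
    ∀ R ∈ J T, ∀ L : LiftSystem R a, L.Glues f b

variable {J} {Z : BasedCategory.{v₂, u₂} C}

/-- The pullbacks of `a` given by the values of the associated section. -/
noncomputable abbrev IsFiberedInGroupoids.liftSystem (h : IsFiberedInGroupoids Z) {T : C}
    {a : Z.obj} (ha : Z.p.obj a = T) (R : Sieve T) : LiftSystem R a where
  obj i _ := (h.sectionOf ha).obj (Over.mk i)
  map i _ := h.sectionProj ha (Over.mk i)
  lift i _ := h.sectionProj_lift ha (Over.mk i)

/-- Arrows of a prestack that agree locally are equal. -/
theorem IsPrestack.hom_ext (hZ : IsPrestack J Z) (hg : IsFiberedInGroupoids Z) {T T' : C}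
    {f : T ⟶ T'} {a b : Z.obj} {ψ ψ' : a ⟶ b} (hψ : Z.p.IsHomLift f ψ) (hψ' : Z.p.IsHomLift f ψ')
    (R : Sieve T) (hR : R ∈ J T)
    (e : ∀ {U : C} (i : U ⟶ T), R i → ∃ (c : Z.obj) (γ : c ⟶ a), Z.p.IsHomLift i γ ∧
      γ ≫ ψ = γ ≫ ψ') : ψ = ψ' := by
  have ha := IsHomLift.domain_eq Z.p f ψ
  have hb := IsHomLift.codomain_eq Z.p f ψ
  refine (hZ f a b ha hb R hR (hg.liftSystem ha R) (fun _ i _ => hg.sectionProj ha (Over.mk i) ≫ ψ')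
    (fun i hi => lift_comp (hg.sectionProj_lift ha (Over.mk i)) hψ') ?_).unique ⟨hψ, fun i hi => ?_⟩
    ⟨hψ', fun i hi => rfl⟩
  · intro V U i hi i' hi' g w η hη e
    exact (Category.assoc _ _ _).symm.trans (congrArg (· ≫ ψ') e)
  · obtain ⟨c, γ, hγ, e⟩ := e i hi
    obtain ⟨χ, -, hχ⟩ := hg.exists_fill hγ (hg.sectionProj_lift ha (Over.mk i)) (𝟙 _) (by simp)
    change hg.sectionProj ha (Over.mk i) ≫ ψ = hg.sectionProj ha (Over.mk i) ≫ ψ'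
    rw [← hχ, Category.assoc, Category.assoc, e]

/-- To prove that `Z` is a prestack, it suffices to glue along some choice of pullbacks on some
smaller covering sieve. -/
theorem IsPrestack.of_exists (hg : IsFiberedInGroupoids Z)
    (h : ∀ ⦃T T' : C⦄ (f : T ⟶ T') (a b : Z.obj), Z.p.obj a = T → Z.p.obj b = T' →
      ∀ R ∈ J T, ∃ R' ≤ R, R' ∈ J T ∧ ∃ L : LiftSystem R' a, L.Glues f b) :
    IsPrestack J Z := by
  intro T T' f a b ha hb R hR L φ hφ hc
  have ext : ∀ {S S' : C} {k : S ⟶ S'} {c d : Z.obj} {ψ ψ' : c ⟶ d}, Z.p.IsHomLift k ψ →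
      Z.p.IsHomLift k ψ' → ∀ Q ∈ J S, (∀ {U : C} (i : U ⟶ S), Q i → ∀ (e : Z.obj) (γ : e ⟶ c),
        Z.p.IsHomLift i γ → γ ≫ ψ = γ ≫ ψ') → ψ = ψ' := by
    intro S S' k c d ψ ψ' hψ hψ' Q hQ e
    obtain ⟨Q', hQ', -, L', hL'⟩ := h k c d (IsHomLift.domain_eq Z.p k ψ)
      (IsHomLift.codomain_eq Z.p k ψ) Q hQ
    refine (hL' (fun _ i hi => L'.map i hi ≫ ψ') (fun i hi => lift_comp (L'.lift i hi) hψ')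
      ?_).unique ⟨hψ, fun i hi => e i (hQ' _ hi) _ _ (L'.lift i hi)⟩ ⟨hψ', fun i hi => rfl⟩
    intro V U i hi i' hi' g w η hη e
    exact (Category.assoc _ _ _).symm.trans (congrArg (· ≫ ψ') e)
  obtain ⟨R', hR', hR'J, L', hL'⟩ := h f a b ha hb R hR
  let θ : ∀ {U : C} (i : U ⟶ T) (hi : R' i), L'.obj i hi ⟶ L.obj i (hR' _ hi) := fun {U} i hi =>
    hg.fill (L.lift i (hR' _ hi)) (L'.lift i hi) (𝟙 U) (Category.id_comp i)
  have hθ : ∀ {U : C} (i : U ⟶ T) (hi : R' i), Z.p.IsHomLift (𝟙 U) (θ i hi) :=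
    fun i hi => hg.fill_lift _ _ _ _
  have eθ : ∀ {U : C} (i : U ⟶ T) (hi : R' i), θ i hi ≫ L.map i (hR' _ hi) = L'.map i hi :=
    fun i hi => hg.fill_fac _ _ _ _
  obtain ⟨ψ, ⟨hψ, eψ⟩, uψ⟩ := hL' (fun _ i hi => θ i hi ≫ φ i (hR' _ hi))
    (fun i hi => lift_comp (hθ i hi) (hφ i _)) (by
      intro V U i hi i' hi' g w η hη e
      let η' := hg.fill (L.lift i (hR' _ hi)) (L.lift i' (hR' _ hi')) g w
      have hη' : Z.p.IsHomLift g η' := hg.fill_lift _ _ _ _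
      have eη' : η' ≫ L.map i _ = L.map i' _ := hg.fill_fac _ _ _ _
      have k : η ≫ θ i hi = θ i' hi' ≫ η' := by
        refine hg.ext (L.lift i (hR' _ hi)) (lift_comp hη (hθ i hi) (Category.comp_id g))
          (lift_comp (hθ i' hi') hη' (Category.id_comp g)) ?_
        rw [Category.assoc, Category.assoc, eθ, e, eη', eθ]
      rw [← Category.assoc, k, Category.assoc, hc i _ i' _ g w η' hη' eη'])
  refine ⟨ψ, ⟨hψ, fun {U} i hi => ?_⟩, fun ψ' hψ' => uψ ψ' ⟨hψ'.1, fun i hi => ?_⟩⟩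
  · refine ext (lift_comp (L.lift i hi) hψ rfl) (hφ i hi) (R'.pullback i)
      (J.pullback_stable i hR'J) ?_
    intro V k hk' c γ hγ
    have hk : R' (k ≫ i) := hk'
    let χ := hg.fill (L'.lift (k ≫ i) hk) (lift_comp hγ (L.lift i hi) rfl) (𝟙 V)
      (Category.id_comp _)
    have hχ : Z.p.IsHomLift (𝟙 V) χ := hg.fill_lift _ _ _ _
    have eχ : χ ≫ L'.map (k ≫ i) hk = γ ≫ L.map i hi := hg.fill_fac _ _ _ _
    let η := hg.fill (L.lift i hi) (L.lift (k ≫ i) (hR' _ hk)) k rfl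
    have hη : Z.p.IsHomLift k η := hg.fill_lift _ _ _ _
    have eη : η ≫ L.map i hi = L.map (k ≫ i) _ := hg.fill_fac _ _ _ _
    have eγ : χ ≫ θ _ hk ≫ η = γ := by
      refine hg.ext (L.lift i hi) (lift_comp hχ (lift_comp (hθ _ hk) hη rfl)) hγ ?_
      rw [Category.assoc, Category.assoc, eη, eθ, eχ]
    rw [← Category.assoc, ← eχ, Category.assoc, eψ, ← hc i hi (k ≫ i) (hR' _ hk) k rfl η hη eη,
      ← eγ]
    simp only [Category.assoc]
  · rw [← eθ, Category.assoc, hψ'.2]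

end Prestack

/-! ### Stacks and prestacks -/

section Stack

variable {C : Type u₁} [Category.{v₁} C] {J : GrothendieckTopology C}
  {Z : BasedCategory.{v₂, u₂} C}

/-- Composition with an arrow of the base, as a morphism of represented fibered categories. -/
abbrev repMap {T T' : C} (f : T ⟶ T') : rep T ⥤ᵇ rep T' where
  toFunctor := Over.map f
  w := rfl

/-- A compatible family of maps from the values of `F` to `b` lifts to a 2-morphism `F ⟶ G` along
such a family of maps from the values of `G`. -/
theorem IsFiberedInGroupoids.exists_natTrans (h : IsFiberedInGroupoids Z)
    {W : BasedCategory.{v₃, u₃} C} {F G : W ⥤ᵇ Z} {T : C} {b : Z.obj} (k : ∀ x, W.p.obj x ⟶ T)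
    (φ : ∀ x, F.obj x ⟶ b) (hφ : ∀ x, Z.p.IsHomLift (k x) (φ x))
    (nφ : ∀ {x y : W.obj} (g : x ⟶ y), F.map g ≫ φ y = φ x)
    (π : ∀ x, G.obj x ⟶ b) (hπ : ∀ x, Z.p.IsHomLift (k x) (π x))
    (nπ : ∀ {x y : W.obj} (g : x ⟶ y), G.map g ≫ π y = π x) :
    ∃ β : F ⟶ G, ∀ x, β.app x ≫ π x = φ x := by
  choose β hβ eβ using fun x => h.exists_fill (hπ x) (hφ x) (𝟙 _) (Category.id_comp _)
  refine ⟨{ app := β, naturality := fun x y g => ?_, isHomLift' := hβ }, eβ⟩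
  refine h.ext (hπ y) (g := W.p.map g) (lift_comp inferInstance (hβ y) (Category.comp_id _))
    (lift_comp (hβ x) inferInstance (Category.id_comp _)) ?_
  rw [Category.assoc, Category.assoc, eβ, nπ, eβ, nφ]

theorem comp_eq_comp {D : Type u₃} [Category.{v₃} D] {a b c d : D} {φ : a ⟶ b} {ψ : b ⟶ c}
    {ρ : c ⟶ d} {χ : a ⟶ c} {τ : b ⟶ d} (h : φ ≫ ψ = χ) (h' : ψ ≫ ρ = τ) : φ ≫ τ = χ ≫ ρ := by
  rw [← h, ← h', Category.assoc]

/-- Arrows of a stack satisfy descent. -/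
theorem IsStack.isPrestack (hZ : IsStack J Z) : IsPrestack J Z := by
  have hg := hZ.isFiberedInGroupoids
  refine IsPrestack.of_exists hg fun T T' f a b ha hb R hR =>
    ⟨R, le_rfl, hR, hg.liftSystem ha R, fun φ hφ hc => ?_⟩
  have heq := hZ.descent T R hR
  obtain ⟨e, he, e_fac⟩ := hg.exists_fill (hg.sectionProj_lift ha (Over.mk (𝟙 T)))
    (IsHomLift.id ha) (𝟙 T) (Category.id_comp _)
  have key : ∀ {U : C} (i : U ⟶ T), hg.sectionProj ha (Over.mk i) ≫ e =
      (hg.sectionOf ha).map (Over.homMk i : Over.mk i ⟶ Over.mk (𝟙 T)) := by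
    intro U i
    refine hg.ext (hg.sectionProj_lift ha (Over.mk (𝟙 T)))
      (lift_comp (hg.sectionProj_lift ha (Over.mk i)) he rfl)
      (lift_congr (rep_map_lift (hg.sectionOf ha) _) (Category.comp_id i).symm) ?_
    rw [Category.assoc, e_fac, Category.comp_id]
    exact (hg.sectionOf_map _ _).symm
  obtain ⟨α, hα⟩ := hg.exists_natTrans (F := (restrictToSieve R Z).obj (hg.sectionOf ha))
    (G := (restrictToSieve R Z).obj ((repMap f).comp (hg.sectionOf hb)))
    (fun i => i.obj.hom ≫ f) (fun i => φ i.obj.hom i.property)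
    (fun i => hφ i.obj.hom i.property)
    (fun {i' i} g => hc i.obj.hom i.property i'.obj.hom i'.property g.hom.left (Over.w g.hom) _
      (rep_map_lift (hg.sectionOf ha) g.hom) (hg.sectionOf_map _ _))
    (fun i => hg.sectionProj hb ((repMap f).obj i.obj))
    (fun i => hg.sectionProj_lift hb ((repMap f).obj i.obj))
    (fun g => hg.sectionOf_map hb ((repMap f).map g.hom))
  obtain ⟨β, hβ⟩ := (restrictToSieve R Z).map_surjective
    (X := hg.sectionOf ha) (Y := (repMap f).comp (hg.sectionOf hb)) α
  have hβ₁ : Z.p.IsHomLift (𝟙 T) (β.app (Over.mk (𝟙 T))) := β.isHomLift' (Over.mk (𝟙 T))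
  have hπ : Z.p.IsHomLift (𝟙 T ≫ f) (hg.sectionProj hb ((repMap f).obj (Over.mk (𝟙 T)))) :=
    hg.sectionProj_lift hb ((repMap f).obj (Over.mk (𝟙 T)))
  refine ⟨e ≫ β.app (Over.mk (𝟙 T)) ≫ hg.sectionProj hb ((repMap f).obj (Over.mk (𝟙 T))),
    ⟨lift_comp he (lift_comp hβ₁ hπ rfl), ?_⟩, ?_⟩
  · intro U i hi
    have e₁ : β.app (Over.mk i) = α.app ⟨Over.mk i, hi⟩ :=
      congrArg (fun γ => γ.app ⟨Over.mk i, hi⟩) (congrArg BasedNatTrans.toNatTrans hβ)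
    refine (comp_eq_comp (key i) rfl).trans ?_
    refine Eq.trans (comp_eq_comp (β.naturality
      (Over.homMk i : Over.mk i ⟶ Over.mk (𝟙 T))) rfl) ?_
    refine (Category.assoc _ _ _).trans (Eq.trans ?_ (hα ⟨Over.mk i, hi⟩))
    rw [← e₁]
    exact congrArg (β.app (Over.mk i) ≫ ·)
      (hg.sectionOf_map hb ((repMap f).map (Over.homMk i : Over.mk i ⟶ Over.mk (𝟙 T))))
  · rintro ψ ⟨hψ, eψ⟩
    obtain ⟨γ, hγ⟩ := hg.exists_natTrans (F := hg.sectionOf ha)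
      (G := (repMap f).comp (hg.sectionOf hb)) (fun i => i.hom ≫ f)
      (fun i => hg.sectionProj ha i ≫ ψ)
      (fun i => lift_comp (hg.sectionProj_lift ha i) hψ rfl)
      (fun {i' i} g => by rw [← Category.assoc, hg.sectionOf_map])
      (fun i => hg.sectionProj hb ((repMap f).obj i))
      (fun i => hg.sectionProj_lift hb ((repMap f).obj i))
      (fun g => hg.sectionOf_map hb ((repMap f).map g))
    obtain rfl : γ = β := by
      refine (restrictToSieve R Z).map_injective (Eq.trans ?_ hβ.symm)
      ext i
      exact hg.ext (hg.sectionProj_lift hb ((repMap f).obj i.obj)) (γ.isHomLift' i.obj)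
        (α.isHomLift' i) ((hγ i.obj).trans ((eψ i.obj.hom i.property).trans (hα i).symm))
    refine Eq.trans ?_ (congrArg (e ≫ ·) (hγ (Over.mk (𝟙 T))).symm)
    rw [← Category.assoc, e_fac, Category.id_comp]

theorem rep_map_comp {T : C} (s : rep T ⥤ᵇ Z) {x y z : Over T} {g : x ⟶ y} {g' : y ⟶ z}
    {k : x ⟶ z} (w : g.left ≫ g'.left = k.left) : s.map g ≫ s.map g' = s.map k := by
  rw [← s.map_comp]
  congr 1
  ext
  exact w

/-- The arrow `k`, as an arrow of `Over T` from `k ≫ x` to `x`. -/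
abbrev restrHom {T : C} (x : Over T) {U : C} (k : U ⟶ x.left) : Over.mk (k ≫ x.hom) ⟶ x :=
  Over.homMk k

theorem restrHom_lift {T : C} (s : rep T ⥤ᵇ Z) (x : Over T) {U : C} (k : U ⟶ x.left) :
    Z.p.IsHomLift k (s.map (restrHom x k)) :=
  rep_map_lift s (restrHom x k)

/-- The values of a section over the arrows that factor through `x`. -/
abbrev sectionLiftSystem {T : C} (s : rep T ⥤ᵇ Z) (x : Over T) (R : Sieve x.left) :
    LiftSystem R (s.obj x) where
  obj k _ := s.obj (Over.mk (k ≫ x.hom))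
  map k _ := s.map (restrHom x k)
  lift k _ := restrHom_lift s x k

theorem IsPrestack.section_hom_ext (hZ : IsPrestack J Z) (hg : IsFiberedInGroupoids Z) {T T' : C}
    (s : rep T ⥤ᵇ Z) (x : Over T) (R : Sieve x.left) (hR : R ∈ J x.left) {b : Z.obj}
    {f : x.left ⟶ T'} {ψ ψ' : s.obj x ⟶ b} (hψ : Z.p.IsHomLift f ψ) (hψ' : Z.p.IsHomLift f ψ')
    (e : ∀ {U : C} (k : U ⟶ x.left), R k →
      s.map (restrHom x k) ≫ ψ = s.map (restrHom x k) ≫ ψ') : ψ = ψ' :=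
  hZ.hom_ext hg hψ hψ' R hR fun k hk => ⟨_, _, restrHom_lift s x k, e k hk⟩

/-- Restriction to a covering sieve is faithful, because equality of arrows of a prestack is
local. -/
theorem IsPrestack.faithful (hZ : IsPrestack J Z) (hg : IsFiberedInGroupoids Z) {T : C}
    {R : Sieve T} (hR : R ∈ J T) : (restrictToSieve R Z).Faithful where
  map_injective {s s'} α β e := by
    ext x
    refine hZ.section_hom_ext hg s x (R.pullback x.hom) (J.pullback_stable _ hR) (α.isHomLift' x)
      (β.isHomLift' x) fun k hk => ?_
    rw [α.naturality, β.naturality]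
    exact congrArg (fun γ => γ.app ⟨Over.mk (k ≫ x.hom), hk⟩ ≫ s'.map (restrHom x k))
      (congrArg BasedNatTrans.toNatTrans e)

/-- A 2-morphism between sections that is given on a covering sieve extends to all values. -/
theorem IsPrestack.exists_extension (hZ : IsPrestack J Z) (hg : IsFiberedInGroupoids Z) {T : C}
    {R : Sieve T} (hR : R ∈ J T) {s s' : rep T ⥤ᵇ Z}
    (α : ∀ x : Over T, R x.hom → (s.obj x ⟶ s'.obj x))
    (hα : ∀ x hx, Z.p.IsHomLift (𝟙 x.left) (α x hx))
    (nα : ∀ {x y : Over T} (hx : R x.hom) (hy : R y.hom) (g : x ⟶ y),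
      s.map g ≫ α y hy = α x hx ≫ s'.map g) (x : Over T) :
    ∃ β : s.obj x ⟶ s'.obj x, Z.p.IsHomLift (𝟙 x.left) β ∧
      ∀ {y : Over T} (hy : R y.hom) (g : y ⟶ x), s.map g ≫ β = α y hy ≫ s'.map g := by
  obtain ⟨β, hβ, eβ⟩ := (hZ (𝟙 x.left) (s.obj x) (s'.obj x) (s.w_obj x) (s'.w_obj x) _
    (J.pullback_stable x.hom hR) (sectionLiftSystem s x _)
    (fun U k hk => α (Over.mk (k ≫ x.hom)) hk ≫ s'.map (restrHom x k))
    (fun k hk => lift_comp (hα (Over.mk (k ≫ x.hom)) hk) (restrHom_lift s' x k)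
      ((Category.id_comp k).trans (Category.comp_id k).symm)) (by
      intro V U k hk k' hk' g w η hη e
      let g' : Over.mk (k' ≫ x.hom) ⟶ Over.mk (k ≫ x.hom) := Over.homMk g (by
        rw [← w]
        exact (Category.assoc _ _ _).symm)
      obtain rfl : η = s.map g' :=
        hg.ext (restrHom_lift s x k) hη (rep_map_lift s g')
          (e.trans (rep_map_comp s w).symm)
      refine (comp_eq_comp (nα (x := Over.mk (k' ≫ x.hom)) (y := Over.mk (k ≫ x.hom)) hk' hk g')
        rfl).trans ((Category.assoc _ _ _).trans ?_)
      exact congrArg (α (Over.mk (k' ≫ x.hom)) hk' ≫ ·) (rep_map_comp s' w))).exists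
  refine ⟨β, hβ, fun {y} hy g => ?_⟩
  have hk : R (g.left ≫ x.hom) := by rwa [Over.w g]
  let g' : y ⟶ Over.mk (g.left ≫ x.hom) := Over.homMk (𝟙 y.left)
    ((Category.id_comp _).trans (Over.w g))
  have e₁ : s.map g' ≫ s.map (restrHom x g.left) = s.map g :=
    rep_map_comp s (Category.id_comp _)
  have e₂ : s'.map g' ≫ s'.map (restrHom x g.left) = s'.map g :=
    rep_map_comp s' (Category.id_comp _)
  have e₃ : s.map (restrHom x g.left) ≫ β =
    α (Over.mk (g.left ≫ x.hom)) hk ≫ s'.map (restrHom x g.left) := eβ g.left hk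
  rw [← e₁, Category.assoc, e₃, ← e₂, ← Category.assoc, nα hy hk g', Category.assoc]

/-- Restriction to a covering sieve is full, because arrows of a prestack glue. -/
theorem IsPrestack.full (hZ : IsPrestack J Z) (hg : IsFiberedInGroupoids Z) {T : C}
    {R : Sieve T} (hR : R ∈ J T) : (restrictToSieve R Z).Full where
  map_surjective {s s'} α := by
    choose β hβ eβ using hZ.exists_extension hg hR (s := s) (s' := s')
      (fun x hx => α.app ⟨x, hx⟩) (fun x hx => α.isHomLift' ⟨x, hx⟩)
      (fun hx hy g =>
        α.naturality (ObjectProperty.homMk g : (⟨_, hx⟩ : R.arrows.category) ⟶ ⟨_, hy⟩))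
    refine ⟨{ app := β, naturality := fun x y g => ?_, isHomLift' := hβ }, ?_⟩
    · refine hZ.section_hom_ext hg s x (R.pullback x.hom) (J.pullback_stable _ hR)
        (lift_comp (rep_map_lift s g) (hβ y) (Category.comp_id _))
        (lift_comp (hβ x) (rep_map_lift s' g) (Category.id_comp _)) fun {U} k hk => ?_
      have e₁ := eβ x (y := Over.mk (k ≫ x.hom)) hk (restrHom x k)
      have e₂ := eβ y (y := Over.mk (k ≫ x.hom)) hk (restrHom x k ≫ g)
      rw [s.map_comp, s'.map_comp, Category.assoc] at e₂
      exact e₂.trans ((comp_eq_comp e₁.symm rfl).trans (Category.assoc _ _ _))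
    · ext x
      have e := eβ x.obj x.property (𝟙 x.obj)
      rw [s.map_id, s'.map_id, Category.id_comp] at e
      exact e.trans (Category.comp_id _)

/-- A prestack is a stack if for every section over a covering sieve of `T` there is an object
over `T` to which the values of the section map compatibly. -/
theorem IsPrestack.isStack (hZ : IsPrestack J Z) (hg : IsFiberedInGroupoids Z)
    (h : ∀ (T : C), ∀ R ∈ J T, ∀ σ : sieveCat R ⥤ᵇ Z, ∃ (a : Z.obj) (_ : Z.p.obj a = T)
      (ψ : ∀ x : (sieveCat R).obj, σ.obj x ⟶ a), (∀ x, Z.p.IsHomLift x.obj.hom (ψ x)) ∧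
      ∀ {x y : (sieveCat R).obj} (g : x ⟶ y), σ.map g ≫ ψ y = ψ x) : IsStack J Z := by
  refine ⟨hg, fun T R hR => ?_⟩
  have := hZ.faithful hg hR
  have := hZ.full hg hR
  suffices (restrictToSieve R Z).EssSurj from {}
  refine ⟨fun σ => ?_⟩
  obtain ⟨a, ha, ψ, hψ, n⟩ := h T R hR σ
  obtain ⟨β, -⟩ := hg.exists_natTrans (F := σ) (G := (restrictToSieve R Z).obj (hg.sectionOf ha))
    (fun x => x.obj.hom) ψ hψ n (fun x => hg.sectionProj ha x.obj)
    (fun x => hg.sectionProj_lift ha x.obj) (fun g => hg.sectionOf_map ha g.hom)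
  have : ∀ x, IsIso (β.app x) := fun x => hg.isIso _ _ _ _ (β.isHomLift' x)
  exact ⟨hg.sectionOf ha, ⟨(BasedNatIso.mkNatIso (NatIso.ofComponents (fun x => asIso (β.app x))
    (fun g => β.naturality g)) β.isHomLift').symm⟩⟩

end Stack

/-! ### The stackification of a prestack -/

section Stackification

variable {C : Type u₁} [Category.{v₁} C] {J : GrothendieckTopology C}
  {Y : BasedCategory.{v₂, u₂} C}

/-- The functor from the pullback of a sieve along `i` to the sieve. -/
abbrev sievePullbackMap {T U : C} (R : Sieve T) (i : U ⟶ T) :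
    sieveCat (R.pullback i) ⥤ᵇ sieveCat R where
  toFunctor :=
    { obj k := ⟨(Over.map i).obj k.obj, k.property⟩
      map g := ObjectProperty.homMk ((Over.map i).map g.hom)
      map_id _ := by ext; rfl
      map_comp _ _ := by ext; rfl }
  w := rfl

/-- The pullback of an object of the stackification. -/
abbrev PlusObj.pullback (a : PlusObj J Y) {U : C} (i : U ⟶ a.base) : PlusObj J Y where
  base := U
  sieve := a.sieve.pullback i
  mem := J.pullback_stable i a.mem
  sec := (sievePullbackMap a.sieve i).comp a.sec

/-- The projection from the pullback of an object of the stackification. -/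
def PlusObj.pullbackProj (a : PlusObj J Y) {U : C} (i : U ⟶ a.base) :
    PlusPreHom (a.pullback i) a i where
  dom := a.sieve.pullback i
  mem := J.pullback_stable i a.mem
  le := le_rfl
  le' := le_rfl
  app k hk j h := a.trans (𝟙 _) j (h ▸ hk) (k ≫ i) hk (by rw [← h, Category.id_comp])
  lift _ _ _ _ := a.trans_lift _ _ _ _ _ _
  naturality {V U'} g k hk j h k' hk' j' h' w w' := by
    have e : (a.pullback i).trans g k hk k' hk' w =
      a.trans g (k ≫ i) hk (k' ≫ i) hk' (by rw [← w, Category.assoc]) := rfl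
    refine (congrArg (· ≫ _) e).trans ?_
    refine (a.trans_comp _ _ _ _ _ _ _ _ _ _).trans (Eq.trans ?_
      (a.trans_comp _ _ _ _ _ _ _ _ _ _).symm)
    congr 1
    simp

theorem PlusHom.agree_of_eq {a b : PlusObj J Y} {f : a.base ⟶ b.base} {s t : PlusPreHom a b f}
    (h : PlusHom.mk' s = PlusHom.mk' t) : s.Agree t := by
  rw [PlusHom.mk', PlusHom.mk', PlusHom.mk.injEq] at h
  exact Quotient.exact (eq_of_heq h.2)

/-- Naturality, up to composition with `m`, of arrows that are defined by factorization through
`m` and `m'`. -/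
theorem comp_eq_of_factor {D : Type u₃} [Category.{v₃} D] {a a' b b' c c' : D} {α : a' ⟶ a}
    {x : a ⟶ b} {x' : a' ⟶ b'} {β : b' ⟶ b} {m : b ⟶ c} {m' : b' ⟶ c'} {γ : c' ⟶ c} {n : a ⟶ c}
    {n' : a' ⟶ c'} (h : x ≫ m = n) (h' : x' ≫ m' = n') (e : α ≫ n = n' ≫ γ)
    (e' : β ≫ m = m' ≫ γ) : (α ≫ x) ≫ m = (x' ≫ β) ≫ m := by
  rw [Category.assoc, h, e, ← h', Category.assoc, ← e', Category.assoc]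

theorem PlusObj.obj_val (a : PlusObj J Y) {U : C} (i : U ⟶ a.base) (hi : a.sieve i) :
    Y.p.obj (a.val i hi) = U :=
  a.sec.w_obj ⟨Over.mk i, hi⟩

theorem PlusObj.sieve_of_comp_eq (a : PlusObj J Y) {U V W : C} {i : V ⟶ W} {g : W ⟶ U}
    {k : U ⟶ a.base} {j : V ⟶ a.base} (hk : a.sieve k) (h : i ≫ g ≫ k = j) : a.sieve j := by
  rw [← h, ← Category.assoc]
  exact a.sieve.downward_closed hk _

/-- The stackification of a category fibered in groupoids is fibered in groupoids. -/
theorem isFiberedInGroupoids_stackification (hY : IsFiberedInGroupoids Y) :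
    IsFiberedInGroupoids (stackification J Y) := by
  refine .of_unique_lift (fun a U i => ⟨a.pullback i, PlusHom.mk' (a.pullbackProj i),
    .map (p := (stackification J Y).p) (a := a.pullback i) (b := a)
      (PlusHom.mk' (a.pullbackProj i))⟩) ?_
  intro c c' b φ φ' g w
  obtain ⟨f, s, rfl⟩ := φ.exists_rep
  obtain ⟨f', s', rfl⟩ := φ'.exists_rep
  obtain rfl : g ≫ f = f' := w
  let t : PlusPreHom c' c g :=
    { dom := s'.dom ⊓ s.dom.pullback g
      mem := J.intersection_covering s'.mem (J.pullback_stable g s.mem)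
      le := inf_le_left.trans s'.le
      le' := fun U i hi => s.le _ hi.2
      app := fun {U} i hi j h => hY.fill (s.lift j (h ▸ hi.2) (j ≫ f) rfl)
        (s'.lift i hi.1 (j ≫ f) (by rw [← h, Category.assoc])) (𝟙 U) (Category.id_comp _)
      lift := fun i hi j h => hY.fill_lift _ _ _ _
      naturality := by
        intro V U k i hi j h i' hi' j' h' w w'
        have hj : s.dom j := h ▸ hi.2
        have hj' : s.dom j' := h' ▸ hi'.2
        have e : i ≫ g ≫ f = j ≫ f := by rw [← h, Category.assoc]
        have e' : i' ≫ g ≫ f = j' ≫ f := by rw [← h', Category.assoc]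
        refine hY.ext (s.lift j hj (j ≫ f) rfl) (g := k)
          (lift_comp (c'.trans_lift _ _ _ _ _ _) (hY.fill_lift _ _ _ _) (Category.comp_id k))
          (lift_comp (hY.fill_lift _ _ _ _) (c.trans_lift _ _ _ _ _ _) (Category.id_comp k)) ?_
        exact comp_eq_of_factor (hY.fill_fac _ _ _ _) (hY.fill_fac _ _ _ _)
          (s'.naturality k i hi.1 _ e i' hi'.1 _ e' w (by rw [← w', Category.assoc]))
          (s.naturality k j hj _ rfl j' hj' _ rfl w' (by rw [← w', Category.assoc])) }
  have ht : ∀ {U : C} (i : U ⟶ c'.base) (hi : t.dom i) (j : U ⟶ c.base) (h : i ≫ g = j)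
      (k : U ⟶ b.base) (h' : j ≫ f = k),
      t.app i hi j h ≫ s.app j (h ▸ hi.2) k h' = s'.app i hi.1 k (by
        rw [← h', ← h, Category.assoc]) := by
    intro U i hi j h k h'
    subst h'
    exact hY.fill_fac (s.lift j (h ▸ hi.2) (j ≫ f) rfl)
      (s'.lift i hi.1 (j ≫ f) (by rw [← h, Category.assoc])) (𝟙 U) (Category.id_comp _)
  refine ⟨PlusHom.mk' t, ⟨rfl, ?_⟩, ?_⟩
  · exact PlusHom.mk'_eq rfl ⟨t.dom, t.mem, fun U i hi => ⟨hi, hi.2⟩, fun U i hi => hi.1,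
      fun i hi j e e' => ht i hi _ rfl j (by rw [← e, Category.assoc])⟩
  · rintro ψ ⟨hb, e⟩
    obtain ⟨g', t', rfl⟩ := ψ.exists_rep
    obtain rfl : g' = g := hb
    obtain ⟨W, hW, h₁, h₂, h⟩ := PlusHom.agree_of_eq (s := t'.comp s) (t := s') e
    refine PlusHom.mk'_eq rfl ⟨W, hW, fun U i hi => (h₁ _ hi).1,
      fun U i hi => ⟨h₂ _ hi, (h₁ _ hi).2⟩, fun {U} i hi j e e' => ?_⟩
    subst e
    refine hY.ext (s.lift (i ≫ g') (h₁ _ hi).2 _ rfl) (t'.lift _ _ _ _)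
      (t.lift i ⟨h₂ _ hi, (h₁ _ hi).2⟩ _ _) ?_
    rw [ht i ⟨h₂ _ hi, (h₁ _ hi).2⟩ _ rfl _ rfl]
    exact h i hi _ (Category.assoc _ _ _).symm (Category.assoc _ _ _).symm

variable (J) in
/-- The unit of the stackification of a prestack is faithful: arrows of the stackification are
germs, and arrows of a prestack with the same germ are equal. -/
theorem toStackification_faithful (hY : IsFiberedInGroupoids Y) (hp : IsPrestack J Y)
    {y y' : Y.obj} {φ φ' : y ⟶ y'}
    (e : (toStackification J hY.isFibered).map φ = (toStackification J hY.isFibered).map φ') :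
    φ = φ' := by
  have hb : Y.p.map φ = Y.p.map φ' := congrArg PlusHom.base e
  have e' : PlusHom.mk' (unitMap J hY.isFibered φ) = PlusHom.mk' (unitMap J hY.isFibered φ') := e
  have agr : (unitMap J hY.isFibered φ).Agree (unitMap J hY.isFibered φ') := by
    revert e'
    generalize unitMap J hY.isFibered φ = s
    generalize unitMap J hY.isFibered φ' = t
    revert s t
    rw [hb]
    exact fun s t e => PlusHom.agree_of_eq e
  obtain ⟨W, hW, h₁, h₂, h⟩ := agr
  refine hp.hom_ext hY (.map φ) (hb ▸ .map φ') W hW fun {U} i hi =>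
    ⟨_, pbMap hY.isFibered y i, pbMap_lift _ _ _, ?_⟩
  have e₁ : i ≫ Y.p.map φ' = 𝟙 U ≫ i ≫ Y.p.map φ := by rw [hb, Category.id_comp]
  have e₂ := h i hi (i ≫ Y.p.map φ) rfl (by rw [hb])
  exact (pbDesc_fac hY.isFibered y' (i ≫ Y.p.map φ) (𝟙 U) (pbMap hY.isFibered y i ≫ φ)
    (pbMap_comp_lift _ _ (Category.id_comp _).symm)).symm.trans
    ((congrArg (· ≫ pbMap hY.isFibered y' (i ≫ Y.p.map φ)) e₂).trans
      (pbDesc_fac hY.isFibered y' (i ≫ Y.p.map φ) (𝟙 U) (pbMap hY.isFibered y i ≫ φ')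
        (pbMap_comp_lift _ _ e₁)))

variable (J) in
/-- The unit of the stackification of a prestack is full: a locally defined arrow between objects of
a prestack glues to an arrow. -/
theorem toStackification_full (hY : IsFiberedInGroupoids Y) (hp : IsPrestack J Y)
    {y y' : Y.obj} (ψ : (toStackification J hY.isFibered).obj y ⟶
      (toStackification J hY.isFibered).obj y') :
    ∃ φ : y ⟶ y', (toStackification J hY.isFibered).map φ = ψ := by
  obtain ⟨f, s, rfl⟩ := PlusHom.exists_rep ψ
  change Y.p.obj y ⟶ Y.p.obj y' at f
  have hF := hY.isFibered
  let A : ∀ {U : C} (i : U ⟶ Y.p.obj y) (_ : s.dom i) (j : U ⟶ Y.p.obj y') (_ : i ≫ f = j),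
    pbObj hF y i ⟶ pbObj hF y' j := fun i hi j h => s.app i hi j h
  have hA : ∀ {U : C} (i : U ⟶ Y.p.obj y) (hi : s.dom i) (j : U ⟶ Y.p.obj y') (h : i ≫ f = j),
    Y.p.IsHomLift (𝟙 U) (A i hi j h) := s.lift
  obtain ⟨φ, ⟨hφ, e⟩, -⟩ := hp f y y' rfl rfl s.dom s.mem
    { obj := fun i _ => pbObj hF y i, map := fun i _ => pbMap hF y i,
      lift := fun i _ => pbMap_lift hF y i }
    (fun U i hi => A i hi (i ≫ f) rfl ≫ pbMap hF y' (i ≫ f))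
    (fun i hi => lift_comp (hA i hi _ rfl) (pbMap_lift _ _ _) (Category.id_comp _)) (by
      intro V U i hi i' hi' g w η hη e
      have w' : g ≫ i ≫ f = i' ≫ f := by rw [← w, Category.assoc]
      have n := s.naturality g i hi (i ≫ f) rfl i' hi' (i' ≫ f) rfl w w'
      have h₁ : pbDesc hF y i g (pbMap hF y i') (pbMap_lift_of_eq hF y w) = η :=
        pb_ext hF y i g (pbDesc_lift _ _ _ _ _ _) hη ((pbDesc_fac _ _ _ _ _ _).trans e.symm)
      have n' : η ≫ A i hi _ rfl = A i' hi' _ rfl ≫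
        pbDesc hF y' (i ≫ f) g (pbMap hF y' (i' ≫ f)) (pbMap_lift_of_eq hF y' w') := by
        rw [← h₁]
        exact n
      rw [← Category.assoc, n', Category.assoc, pbDesc_fac])
  refine ⟨φ, PlusHom.mk'_eq (map_eq_of_lift hφ) ⟨s.dom, s.mem, fun _ _ _ => trivial, le_rfl,
    fun {U} i hi j h h' => ?_⟩⟩
  change i ≫ f = j at h'
  subst h'
  have h₁ : Y.p.IsHomLift (𝟙 U ≫ i ≫ f) (pbMap hF y i ≫ φ) :=
    pbMap_comp_lift _ _ (h.trans (Category.id_comp _).symm)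
  have h₂ : pbDesc hF y' (i ≫ f) (𝟙 U) (pbMap hF y i ≫ φ) h₁ = A i hi (i ≫ f) rfl :=
    pb_ext hF y' (i ≫ f) (𝟙 U) (pbDesc_lift _ _ _ _ _ _) (hA i hi _ rfl)
      ((pbDesc_fac _ _ _ _ _ _).trans (e i hi))
  exact h₂

theorem PlusObj.pbMap_val_lift (hY : Y.p.IsFibered) (a : PlusObj J Y) {U V : C} (k : U ⟶ a.base)
    (hk : a.sieve k) (i : V ⟶ Y.p.obj (a.val k hk)) :
    Y.p.IsHomLift (i ≫ eqToHom (a.obj_val k hk)) (pbMap hY (a.val k hk) i) :=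
  have := pbMap_lift hY (a.val k hk) i
  inferInstance

/-- The arrow from the value of a local section `a` at `k` to `a`. -/
noncomputable def PlusObj.valPreHom (hY : IsFiberedInGroupoids Y) (a : PlusObj J Y) {U : C}
    (k : U ⟶ a.base) (hk : a.sieve k) :
    PlusPreHom (unitObj J hY.isFibered (a.val k hk)) a (eqToHom (a.obj_val k hk) ≫ k) where
  dom := ⊤
  mem := J.top_mem _
  le := le_rfl
  le' _ _ _ := a.sieve_of_comp_eq hk rfl
  app {V} i _ j h := hY.fill (a.trans_lift (i ≫ eqToHom (a.obj_val k hk)) k hk j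
    (a.sieve_of_comp_eq hk h) ((Category.assoc _ _ _).trans h))
    (a.pbMap_val_lift hY.isFibered k hk i) (𝟙 V) (Category.id_comp _)
  lift _ _ _ _ := hY.fill_lift _ _ _ _
  naturality {V V'} g i _ j h i' _ j' h' w w' := by
    have hj := a.sieve_of_comp_eq hk h
    have hj' := a.sieve_of_comp_eq hk h'
    have hF := hY.isFibered
    refine hY.ext (a.trans_lift (i ≫ eqToHom (a.obj_val k hk)) k hk j hj
      ((Category.assoc _ _ _).trans h)) (g := g)
      (lift_comp (pbDesc_lift hF _ i g (pbMap hF _ i') (pbMap_lift_of_eq hF _ w))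
        (hY.fill_lift _ _ _ _) (Category.comp_id g))
      (lift_comp (hY.fill_lift _ _ _ _) (a.trans_lift _ _ _ _ _ _) (Category.id_comp g)) ?_
    refine comp_eq_of_factor (γ := 𝟙 _) (hY.fill_fac _ _ _ _) (hY.fill_fac (a.trans_lift
      (i' ≫ eqToHom (a.obj_val k hk)) k hk j' hj' ((Category.assoc _ _ _).trans h'))
      (a.pbMap_val_lift hF k hk i') (𝟙 V) (Category.id_comp _)) ?_ ?_
    · exact (pbDesc_fac hF (a.val k hk) i g (pbMap hF _ i') (pbMap_lift_of_eq hF _ w)).trans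
        (Category.comp_id _).symm
    · refine (a.trans_comp _ _ _ _ _ _ _ _ _ _).trans (Eq.trans ?_ (Category.comp_id _).symm)
      congr 1
      rw [← w, Category.assoc]

theorem PlusObj.valPreHom_app (hY : IsFiberedInGroupoids Y) (a : PlusObj J Y) {U : C}
    (k : U ⟶ a.base) (hk : a.sieve k) {V : C} (i : V ⟶ Y.p.obj (a.val k hk)) (j : V ⟶ a.base)
    (h : i ≫ eqToHom (a.obj_val k hk) ≫ k = j) :
    (a.valPreHom hY k hk).app i trivial j h ≫ a.trans (i ≫ eqToHom (a.obj_val k hk)) k hk j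
      (a.sieve_of_comp_eq hk h) ((Category.assoc _ _ _).trans h) =
    pbMap hY.isFibered (a.val k hk) i :=
  hY.fill_fac (a.trans_lift (i ≫ eqToHom (a.obj_val k hk)) k hk j
    (a.sieve_of_comp_eq hk h) ((Category.assoc _ _ _).trans h))
    (a.pbMap_val_lift hY.isFibered k hk i) (𝟙 V) (Category.id_comp _)

/-- The arrow from the value of a local section `a` at `k` to `a`, as an arrow of the
stackification. -/
noncomputable def PlusObj.valHom (hY : IsFiberedInGroupoids Y) (a : PlusObj J Y) {U : C}
    (k : U ⟶ a.base) (hk : a.sieve k) :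
    (toStackification J hY.isFibered).obj (a.val k hk) ⟶ a :=
  PlusHom.mk' (a.valPreHom hY k hk)

theorem PlusObj.valHom_lift (hY : IsFiberedInGroupoids Y) (a : PlusObj J Y) {U : C}
    (k : U ⟶ a.base) (hk : a.sieve k) :
    (stackification J Y).p.IsHomLift k (a.valHom hY k hk) := by
  refine IsHomLift.of_fac' _ _ _ (a.obj_val k hk) rfl ?_
  rw [eqToHom_refl, Category.comp_id]
  rfl

/-- The arrow from the value of `a` at `k` to the value of `b` at `j` that belongs to a locally
defined arrow from `a` to `b`. -/
def PlusPreHom.arr {a b : PlusObj J Y} {f : a.base ⟶ b.base} (s : PlusPreHom a b f) {U : C}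
    (k : U ⟶ a.base) (hk : s.dom k) (j : U ⟶ b.base) (h : k ≫ f = j) (ha : a.sieve k)
    (hb : b.sieve j) : a.val k ha ⟶ b.val j hb :=
  s.app k hk j h

theorem PlusPreHom.arr_lift {a b : PlusObj J Y} {f : a.base ⟶ b.base} (s : PlusPreHom a b f) {U : C}
    (k : U ⟶ a.base) (hk : s.dom k) (j : U ⟶ b.base) (h : k ≫ f = j) (ha : a.sieve k)
    (hb : b.sieve j) : Y.p.IsHomLift (𝟙 U) (s.arr k hk j h ha hb) :=
  s.lift k hk j h

theorem PlusPreHom.arr_naturality {a b : PlusObj J Y} {f : a.base ⟶ b.base} (s : PlusPreHom a b f)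
    {V U : C} (g : V ⟶ U) (i : U ⟶ a.base) (hi : s.dom i) (j : U ⟶ b.base) (h : i ≫ f = j)
    (i' : V ⟶ a.base) (hi' : s.dom i') (j' : V ⟶ b.base) (h' : i' ≫ f = j') (w : g ≫ i = i')
    (w' : g ≫ j = j') (ha : a.sieve i) (hb : b.sieve j) (ha' : a.sieve i') (hb' : b.sieve j') :
    a.trans g i ha i' ha' w ≫ s.arr i hi j h ha hb =
      s.arr i' hi' j' h' ha' hb' ≫ b.trans g j hb j' hb' w' :=
  s.naturality g i hi j h i' hi' j' h' w w'

/-- A locally defined arrow from `a` to `b` restricts, on the values of `a` and `b`, to its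
components. -/
theorem PlusObj.valHom_comp (hY : IsFiberedInGroupoids Y) {a b : PlusObj J Y}
    {f : a.base ⟶ b.base} (s : PlusPreHom a b f) {U : C} (k : U ⟶ a.base) (hk : s.dom k)
    (j : U ⟶ b.base) (h : k ≫ f = j) (ha : a.sieve k) (hb : b.sieve j) :
    (a.valHom hY k ha ≫ PlusHom.mk' s : _ ⟶ b) =
      (toStackification J hY.isFibered).map (s.arr k hk j h ha hb) ≫ b.valHom hY j hb := by
  have hl := s.arr_lift k hk j h ha hb
  have hF := hY.isFibered
  have ep : Y.p.map (s.arr k hk j h ha hb) ≫ eqToHom (b.obj_val j hb) =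
      eqToHom (a.obj_val k ha) := by
    have := IsHomLift.fac' Y.p (𝟙 U) (s.arr k hk j h ha hb)
    rw [this]
    simp
  have ebase : (eqToHom (a.obj_val k ha) ≫ k) ≫ f =
      Y.p.map (s.arr k hk j h ha hb) ≫ eqToHom (b.obj_val j hb) ≫ j := by
    rw [Category.assoc, h, ← Category.assoc, ep]
  refine PlusHom.mk'_eq ebase ⟨_, ((a.valPreHom hY k ha).comp s).mem, le_rfl,
    fun _ _ _ => ⟨trivial, trivial⟩, fun {V} i hi j' e e' => ?_⟩
  change V ⟶ Y.p.obj (a.val k ha) at i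
  change i ≫ (eqToHom (a.obj_val k ha) ≫ k) ≫ f = j' at e
  have hi' : s.dom (i ≫ eqToHom (a.obj_val k ha) ≫ k) := hi.2
  have e₁ : (i ≫ Y.p.map (s.arr k hk j h ha hb)) ≫ eqToHom (b.obj_val j hb) ≫ j = j' := by
    rw [Category.assoc, ← ebase, e]
  have e₂ : (i ≫ eqToHom (a.obj_val k ha) ≫ k) ≫ f = j' := by
    rw [← e, Category.assoc]
  have hj' : b.sieve j' := b.sieve_of_comp_eq hb e₁
  have em : (i ≫ Y.p.map (s.arr k hk j h ha hb)) ≫ eqToHom (b.obj_val j hb) =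
      i ≫ eqToHom (a.obj_val k ha) := by rw [Category.assoc, ep]
  have h₁ := a.valPreHom_app hY k ha i _ rfl
  have h₂ := b.valPreHom_app hY j hb (i ≫ Y.p.map (s.arr k hk j h ha hb)) j' e₁
  have e₃ : (i ≫ eqToHom (a.obj_val k ha)) ≫ j = j' := by
    rw [← e₂, ← h, Category.assoc, Category.assoc, Category.assoc]
  have h₃ := s.arr_naturality (i ≫ eqToHom (a.obj_val k ha)) k hk j h _ hi' j' e₂
    (Category.assoc _ _ _) e₃ ha hb (a.sieve_of_comp_eq ha rfl) hj'
  have h₄ : b.trans ((i ≫ Y.p.map (s.arr k hk j h ha hb)) ≫ eqToHom (b.obj_val j hb)) j hb j' hj'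
      ((Category.assoc _ _ _).trans e₁) = b.trans (i ≫ eqToHom (a.obj_val k ha)) j hb j'
      hj' e₃ := by congr 1
  have l₁ := lift_comp ((a.valPreHom hY k ha).lift i trivial _ rfl) (s.lift _ hi' j' e₂)
    (Category.id_comp _)
  have l₂ := lift_comp ((unitMap J hF (s.arr k hk j h ha hb)).lift i trivial _ rfl)
    ((b.valPreHom hY j hb).lift (i ≫ Y.p.map (s.arr k hk j h ha hb)) trivial j' e₁)
      (Category.id_comp _)
  refine hY.ext (b.trans_lift (i ≫ eqToHom (a.obj_val k ha)) j hb j' hj' e₃) l₁ l₂ ?_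
  have h₅ : (unitMap J hF (s.arr k hk j h ha hb)).app i trivial _ rfl ≫
      pbMap hF (b.val j hb) (i ≫ Y.p.map (s.arr k hk j h ha hb)) =
      pbMap hF (a.val k ha) i ≫ s.arr k hk j h ha hb :=
    pbDesc_fac hF (b.val j hb) (i ≫ Y.p.map (s.arr k hk j h ha hb)) (𝟙 V)
      (pbMap hF (a.val k ha) i ≫ s.arr k hk j h ha hb)
      (pbMap_comp_lift _ _ (Category.id_comp _).symm)
  rw [h₄] at h₂
  refine (Category.assoc _ _ _).trans ((congrArg (_ ≫ ·) h₃.symm).trans ?_)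
  refine Eq.trans ?_ (h₅.symm.trans ((congrArg (_ ≫ ·) h₂.symm).trans (Category.assoc _ _ _).symm))
  exact (Category.assoc _ _ _).symm.trans (congrArg (· ≫ _) h₁)

/-- The arrows from the values of `a` to `a` are compatible with the transition arrows between the
values. -/
theorem PlusObj.trans_valHom (hY : IsFiberedInGroupoids Y) (a : PlusObj J Y) {V U : C} (g : V ⟶ U)
    (k : U ⟶ a.base) (hk : a.sieve k) (k' : V ⟶ a.base) (hk' : a.sieve k') (w : g ≫ k = k') :
    ((toStackification J hY.isFibered).map (a.trans g k hk k' hk' w) ≫ a.valHom hY k hk : _ ⟶ a) =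
      a.valHom hY k' hk' := by
  have hF := hY.isFibered
  have hl := a.trans_lift g k hk k' hk' w
  set t := a.trans g k hk k' hk' w
  have ep : Y.p.map t ≫ eqToHom (a.obj_val k hk) = eqToHom (a.obj_val k' hk') ≫ g := by
    have := IsHomLift.fac' Y.p g t
    rw [this]
    simp
  have ebase : Y.p.map t ≫ eqToHom (a.obj_val k hk) ≫ k = eqToHom (a.obj_val k' hk') ≫ k' := by
    rw [← Category.assoc, ep, Category.assoc, w]
  refine PlusHom.mk'_eq ebase ⟨⊤, J.top_mem _, fun _ _ _ => ⟨trivial, trivial⟩, le_rfl,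
    fun {V'} i hi j e e' => ?_⟩
  change V' ⟶ Y.p.obj (a.val k' hk') at i
  change i ≫ eqToHom (a.obj_val k' hk') ≫ k' = j at e'
  have e₁ : (i ≫ Y.p.map t) ≫ eqToHom (a.obj_val k hk) ≫ k = j := by
    rw [Category.assoc, ebase, e']
  have hj : a.sieve j := a.sieve_of_comp_eq hk e₁
  have h₁ := a.valPreHom_app hY k hk (i ≫ Y.p.map t) j e₁
  have h₂ := a.valPreHom_app hY k' hk' i j e'
  have em : (i ≫ Y.p.map t) ≫ eqToHom (a.obj_val k hk) = (i ≫ eqToHom (a.obj_val k' hk')) ≫ g := by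
    rw [Category.assoc, ep, Category.assoc]
  have h₃ : a.trans (i ≫ eqToHom (a.obj_val k' hk')) k' hk' j hj ((Category.assoc _ _ _).trans e') ≫
      t = a.trans ((i ≫ Y.p.map t) ≫ eqToHom (a.obj_val k hk)) k hk j hj
        ((Category.assoc _ _ _).trans e₁) :=
    (a.trans_comp _ _ _ _ _ _ _ _ _ _).trans (by congr 1; exact em.symm)
  have h₅ : (unitMap J hF t).app i trivial _ rfl ≫ pbMap hF (a.val k hk) (i ≫ Y.p.map t) =
      pbMap hF (a.val k' hk') i ≫ t :=
    pbDesc_fac hF (a.val k hk) (i ≫ Y.p.map t) (𝟙 V') (pbMap hF (a.val k' hk') i ≫ t)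
      (pbMap_comp_lift _ _ (Category.id_comp _).symm)
  have l₁ := lift_comp ((unitMap J hF t).lift i trivial _ rfl)
    ((a.valPreHom hY k hk).lift (i ≫ Y.p.map t) trivial j e₁) (Category.id_comp _)
  refine hY.ext (a.trans_lift ((i ≫ Y.p.map t) ≫ eqToHom (a.obj_val k hk)) k hk j hj
    ((Category.assoc _ _ _).trans e₁)) l₁ ((a.valPreHom hY k' hk').lift i trivial j e') ?_
  refine (Category.assoc _ _ _).trans ((congrArg (_ ≫ ·) h₁).trans (h₅.trans ?_))
  refine (congrArg (· ≫ t) h₂.symm).trans ((Category.assoc _ _ _).trans (congrArg (_ ≫ ·) h₃))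

/-- Arrows of the stackification are determined by their restrictions to the values of their
source on a covering sieve. -/
theorem PlusHom.ext_of_valHom (hY : IsFiberedInGroupoids Y) (hp : IsPrestack J Y)
    {a b : PlusObj J Y} {φ φ' : a ⟶ b} (e : PlusHom.base φ = PlusHom.base φ') (D : Sieve a.base)
    (hD : D ∈ J a.base) (hDa : D ≤ a.sieve)
    (h : ∀ {U : C} (k : U ⟶ a.base) (hk : D k),
      a.valHom hY k (hDa _ hk) ≫ φ = a.valHom hY k (hDa _ hk) ≫ φ') : φ = φ' := by
  obtain ⟨f, s, rfl⟩ := PlusHom.exists_rep φ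
  obtain ⟨f', s', rfl⟩ := PlusHom.exists_rep φ'
  obtain rfl : f = f' := e
  refine PlusHom.mk'_eq rfl ⟨D ⊓ (s.dom ⊓ s'.dom), J.intersection_covering hD
    (J.intersection_covering s.mem s'.mem), fun _ _ h => h.2.1, fun _ _ h => h.2.2,
    fun {U} k hk j w w' => ?_⟩
  have ha : a.sieve k := hDa _ hk.1
  have hb : b.sieve j := w ▸ s.le' _ hk.2.1
  have h₁ := PlusObj.valHom_comp hY s k hk.2.1 j w ha hb
  have h₂ := PlusObj.valHom_comp hY s' k hk.2.2 j w ha hb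
  have l₁ := s.arr_lift k hk.2.1 j w ha hb
  have l₂ := s'.arr_lift k hk.2.2 j w ha hb
  refine toStackification_faithful J hY hp (φ := s.arr k hk.2.1 j w ha hb)
    (φ' := s'.arr k hk.2.2 j w ha hb) ?_
  exact (isFiberedInGroupoids_stackification hY).ext (b.valHom_lift hY j hb)
    ((toStackification J hY.isFibered).preserves_isHomLift (𝟙 U) _)
    ((toStackification J hY.isFibered).preserves_isHomLift (𝟙 U) _)
    (h₁.symm.trans ((h k hk.1).trans h₂))

/-- The stackification of a prestack is a prestack: since the unit is fully faithful, a compatible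
family of arrows from `a` to `b` consists of arrows of `Y` between the values of `a` and `b`, and so
it is a locally defined arrow from `a` to `b`. -/
theorem isPrestack_stackification (hY : IsFiberedInGroupoids Y) (hp : IsPrestack J Y) :
    IsPrestack J (stackification J Y) := by
  have hZ := isFiberedInGroupoids_stackification (J := J) hY
  refine .of_exists hZ ?_
  rintro _ _ f a b rfl rfl R hR
  change a.base ⟶ b.base at f
  refine ⟨R ⊓ (a.sieve ⊓ b.sieve.pullback f), inf_le_left, J.intersection_covering hR
    (J.intersection_covering a.mem (J.pullback_stable f b.mem)),
    { obj := fun k hk => (toStackification J hY.isFibered).obj (a.val k hk.2.1)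
      map := fun k hk => a.valHom hY k hk.2.1
      lift := fun k hk => a.valHom_lift hY k hk.2.1 }, ?_⟩
  intro φ hφ hc
  set D := R ⊓ (a.sieve ⊓ b.sieve.pullback f)
  have key : ∀ {U : C} (k : U ⟶ a.base) (hk : D k) (j : U ⟶ b.base) (_ : k ≫ f = j)
      (hj : b.sieve j), ∃ c : a.val k hk.2.1 ⟶ b.val j hj, Y.p.IsHomLift (𝟙 U) c ∧
        (toStackification J hY.isFibered).map c ≫ b.valHom hY j hj = φ k hk := by
    intro U k hk j w hj
    obtain ⟨χ, hχ, eχ⟩ := hZ.exists_fill (b.valHom_lift hY j hj) (hφ k hk) (𝟙 U)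
      ((Category.id_comp _).trans w.symm)
    obtain ⟨c, rfl⟩ := toStackification_full J hY hp χ
    exact ⟨c, (toStackification J hY.isFibered).isHomLift_map (𝟙 U) c, eχ⟩
  choose c hcl hce using @key
  let s : PlusPreHom a b f :=
    { dom := D
      mem := J.intersection_covering hR
        (J.intersection_covering a.mem (J.pullback_stable f b.mem))
      le := fun _ _ h => h.2.1
      le' := fun _ _ h => h.2.2
      app := fun k hk j w => c k hk j w (w ▸ hk.2.2)
      lift := fun k hk j w => hcl k hk j w (w ▸ hk.2.2)
      naturality := by
        intro V U g i hi j h i' hi' j' h' w w'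
        have hj : b.sieve j := h ▸ hi.2.2
        have hj' : b.sieve j' := h' ▸ hi'.2.2
        have l₁ := lift_comp (a.trans_lift g i hi.2.1 i' hi'.2.1 w) (hcl i hi j h hj)
          (Category.comp_id g)
        have l₂ := lift_comp (hcl i' hi' j' h' hj') (b.trans_lift g j hj j' hj' w')
          (Category.id_comp g)
        refine toStackification_faithful J hY hp
          (φ := a.trans g i hi.2.1 i' hi'.2.1 w ≫ c i hi j h hj)
          (φ' := c i' hi' j' h' hj' ≫ b.trans g j hj j' hj' w') ?_
        refine hZ.ext (b.valHom_lift hY j hj)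
          ((toStackification J hY.isFibered).preserves_isHomLift g _)
          ((toStackification J hY.isFibered).preserves_isHomLift g _) ?_
        rw [Functor.map_comp, Functor.map_comp]
        have lt := a.trans_lift g i hi.2.1 i' hi'.2.1 w
        have e₁ := hc i hi i' hi' g w ((toStackification J hY.isFibered).map
          (a.trans g i hi.2.1 i' hi'.2.1 w))
          ((toStackification J hY.isFibered).preserves_isHomLift g _)
          (a.trans_valHom hY g i hi.2.1 i' hi'.2.1 w)
        refine (Category.assoc _ _ _).trans ((congrArg (_ ≫ ·) (hce i hi j h hj)).trans
          (e₁.trans ((hce i' hi' j' h' hj').symm.trans ?_)))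
        exact (congrArg (_ ≫ ·) (b.trans_valHom hY g j hj j' hj' w').symm).trans
          (Category.assoc _ _ _).symm }
  have es : ∀ {U : C} (k : U ⟶ a.base) (hk : D k),
      (a.valHom hY k hk.2.1 ≫ PlusHom.mk' s : _ ⟶ b) = φ k hk := fun k hk =>
    (PlusObj.valHom_comp hY s k hk _ rfl hk.2.1 hk.2.2).trans (hce k hk _ rfl _)
  refine ⟨PlusHom.mk' s, ⟨IsHomLift.map (p := (stackification J Y).p) (a := a) (b := b)
    (PlusHom.mk' s), es⟩, ?_⟩
  rintro ψ ⟨hψ, eψ⟩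
  exact PlusHom.ext_of_valHom hY hp (map_eq_of_lift hψ) D s.mem (fun _ _ h => h.2.1)
    fun k hk => (eψ k hk).trans (es k hk).symm

/-- The sieve of those arrows along which `y` lifts to the source of `F`, up to isomorphism. -/
def liftSieve {X : BasedCategory.{v₃, u₃} C} (hX : IsFiberedInGroupoids X) (F : X ⥤ᵇ Y)
    (y : Y.obj) {T : C} (_hy : Y.p.obj y = T) : Sieve T where
  arrows _ m := ∃ (x : X.obj) (φ : F.obj x ⟶ y), Y.p.IsHomLift m φ
  downward_closed := by
    rintro U V m ⟨x, φ, hφ⟩ g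
    obtain ⟨x', χ, hχ⟩ := hX.exists_lift ((F.w_obj x).symm.trans (IsHomLift.domain_eq Y.p m φ)) g
    exact ⟨x', F.map χ ≫ φ, lift_comp (F.preserves_isHomLift g χ) hφ rfl⟩

theorem liftSieve_mem {X : BasedCategory.{v₃, u₃} C} (hX : IsFiberedInGroupoids X) {F : X ⥤ᵇ Y}
    (hF : IsEpimorphism J F) (y : Y.obj) {T : C} (hy : Y.p.obj y = T) :
    liftSieve hX F y hy ∈ J T := by
  subst hy
  obtain ⟨R, hR, h⟩ := hF y
  exact J.superset_covering (fun U m hm => h m hm) hR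

/-- The unit of the stackification is an epimorphism. -/
theorem isEpimorphism_toStackification (hY : IsFiberedInGroupoids Y) :
    IsEpimorphism J (toStackification J hY.isFibered) :=
  fun a => ⟨a.sieve, a.mem, fun _ k hk => ⟨a.val k hk, a.valHom hY k hk, a.valHom_lift hY k hk⟩⟩

/-- The sieve of those arrows at which the value of a section `σ` of the stackification comes from
an object of `Y`. -/
def unitSieve (hY : IsFiberedInGroupoids Y) {T : C} {R : Sieve T}
    (σ : sieveCat R ⥤ᵇ stackification J Y) : Sieve T where
  arrows U k := ∃ (hk : R k) (y : Y.obj)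
    (ε : (toStackification J hY.isFibered).obj y ⟶ σ.obj ⟨Over.mk k, hk⟩),
    (stackification J Y).p.IsHomLift (𝟙 U) ε
  downward_closed := by
    rintro U V k ⟨hk, y, ε, hε⟩ g
    have hk' : R (g ≫ k) := R.downward_closed hk g
    let g' : (⟨Over.mk (g ≫ k), hk'⟩ : (sieveCat R).obj) ⟶ ⟨Over.mk k, hk⟩ :=
      ObjectProperty.homMk (Over.homMk g)
    have hy : Y.p.obj y = U :=
      ((toStackification J hY.isFibered).w_obj y).symm.trans (IsHomLift.domain_eq _ (𝟙 U) ε)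
    obtain ⟨y', χ, hχ⟩ := hY.exists_lift hy g
    obtain ⟨ε', hε', -⟩ := (isFiberedInGroupoids_stackification hY).exists_fill
      (sieveCat_map_lift σ g')
      (lift_comp ((toStackification J hY.isFibered).preserves_isHomLift g χ) hε
        (Category.comp_id g)) (𝟙 V) (Category.id_comp g)
    exact ⟨hk', y', ε', hε'⟩

theorem unitSieve_mem (hY : IsFiberedInGroupoids Y) {T : C} {R : Sieve T} (hR : R ∈ J T)
    (σ : sieveCat R ⥤ᵇ stackification J Y) : unitSieve hY σ ∈ J T := by
  refine J.transitive hR _ fun U k hk => ?_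
  refine J.superset_covering ?_ (liftSieve_mem hY (isEpimorphism_toStackification (J := J) hY)
    (σ.obj ⟨Over.mk k, hk⟩) (σ.w_obj ⟨Over.mk k, hk⟩))
  rintro V m ⟨y, φ, hφ⟩
  have hk' : R (m ≫ k) := R.downward_closed hk m
  let g : (⟨Over.mk (m ≫ k), hk'⟩ : (sieveCat R).obj) ⟶ ⟨Over.mk k, hk⟩ :=
    ObjectProperty.homMk (Over.homMk m)
  obtain ⟨ε, hε, -⟩ := (isFiberedInGroupoids_stackification hY).exists_fill
    (sieveCat_map_lift σ g) hφ (𝟙 V) (Category.id_comp m)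
  exact ⟨hk', y, ε, hε⟩

/-- The stackification of a prestack is a stack: a section `σ` over a sieve is locally isomorphic to
a section `τ` of `Y` over a smaller covering sieve, and `τ` is itself an object of the
stackification, to which `σ` glues. -/
theorem isStack_stackification (hY : IsFiberedInGroupoids Y) (hp : IsPrestack J Y) :
    IsStack J (stackification J Y) := by
  have hZ := isFiberedInGroupoids_stackification (J := J) hY
  have hpZ := isPrestack_stackification hY hp
  refine hpZ.isStack hZ fun T R hR σ => ?_
  set q := toStackification J hY.isFibered with hq
  set R' := unitSieve hY σ
  have hle : R' ≤ R := fun _ _ h => h.1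
  have hR' : R' ∈ J T := unitSieve_mem hY hR σ
  choose y ε hε using fun (x : (sieveCat R').obj) => x.property.2
  -- `σ' g` is the action on arrows of the restriction of `σ` to the smaller sieve `R'`.
  let σ' : ∀ {w x : (sieveCat R').obj} (g : w ⟶ x), σ.obj ⟨Over.mk w.obj.hom, hle _ w.property⟩ ⟶
      σ.obj ⟨Over.mk x.obj.hom, hle _ x.property⟩ :=
    fun g => σ.map (ObjectProperty.homMk g.hom)
  have hσ' : ∀ {w x : (sieveCat R').obj} (g : w ⟶ x),
      (stackification J Y).p.IsHomLift g.hom.left (σ' g) := fun {w x} g =>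
    sieveCat_map_lift σ (ObjectProperty.homMk g.hom :
      (⟨Over.mk w.obj.hom, hle _ w.property⟩ : (sieveCat R).obj) ⟶
        ⟨Over.mk x.obj.hom, hle _ x.property⟩)
  have hy : ∀ x, Y.p.obj (y x) = x.obj.left := fun x =>
    (q.w_obj (y x)).symm.trans (IsHomLift.domain_eq (stackification J Y).p (𝟙 _) (ε x))
  have ex : ∀ {w x : (sieveCat R').obj} (g : w ⟶ x), ∃ c : y w ⟶ y x,
      Y.p.IsHomLift g.hom.left c ∧ q.map c ≫ ε x = ε w ≫ σ' g := by
    intro w x g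
    obtain ⟨χ, hχ, eχ⟩ := hZ.exists_fill (hε x)
      (lift_comp (hε w) (hσ' g) (Category.id_comp g.hom.left)) g.hom.left (Category.comp_id _)
    obtain ⟨c, rfl⟩ := toStackification_full J hY hp χ
    exact ⟨c, q.isHomLift_map _ c, eχ⟩
  have uniq : ∀ {w x : (sieveCat R').obj} (g : w ⟶ x) (c c' : y w ⟶ y x),
      Y.p.IsHomLift g.hom.left c → Y.p.IsHomLift g.hom.left c' →
      q.map c ≫ ε x = q.map c' ≫ ε x → c = c' := by
    intro w x g c c' hc hc' e
    exact toStackification_faithful J hY hp (hZ.ext (hε x) (q.preserves_isHomLift g.hom.left c)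
      (q.preserves_isHomLift g.hom.left c') e)
  choose c hc ec using @ex
  -- The objects `y x` form a section of `Y`, because `q` is fully faithful.
  let τ : sieveCat R' ⥤ᵇ Y := basedFunctorMk
    { obj := y
      map := c
      map_id := fun x => by
        refine uniq (𝟙 x) _ _ (hc (𝟙 x)) (IsHomLift.id (hy x)) ?_
        rw [ec, q.map_id, Category.id_comp]
        exact (congrArg (ε x ≫ ·) (σ.map_id _)).trans (Category.comp_id _)
      map_comp := fun {w x z} g g' => by
        refine uniq (g ≫ g') _ _ (hc (g ≫ g')) (lift_comp (hc g) (hc g') rfl) ?_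
        rw [ec, q.map_comp, Category.assoc, ec, ← Category.assoc, ec, Category.assoc]
        exact congrArg (ε w ≫ ·) (σ.map_comp
          (X := (⟨Over.mk w.obj.hom, hle _ w.property⟩ : (sieveCat R).obj))
          (Y := ⟨Over.mk x.obj.hom, hle _ x.property⟩) (Z := ⟨Over.mk z.obj.hom, hle _ z.property⟩)
          (ObjectProperty.homMk g.hom) (ObjectProperty.homMk g'.hom)) }
    (fun g => hc g)
  let a : PlusObj J Y := ⟨T, R', hR', τ⟩
  have hκ : ∀ w : (sieveCat R').obj, (stackification J Y).p.IsHomLift w.obj.hom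
    (a.valHom hY w.obj.hom w.property) := fun w => a.valHom_lift hY _ _
  let κ : ∀ w : (sieveCat R').obj, (q.obj (y w) ⟶ a) := fun w => a.valHom hY w.obj.hom w.property
  have nκ : ∀ {w x : (sieveCat R').obj} (g : w ⟶ x), q.map (c g) ≫ κ x = κ w := fun {w x} g =>
    a.trans_valHom hY g.hom.left x.obj.hom x.property w.obj.hom w.property (Over.w g.hom)
  -- Every `w` in the smaller sieve that factors through `x` gives an arrow from `q (y w)` to the
  -- value of `σ` at `x`; these exhibit `q (y w)` as pullbacks of that value.
  let ρ : ∀ (w : (sieveCat R').obj) (x : (sieveCat R).obj) (m : w.obj.left ⟶ x.obj.left)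
      (_ : m ≫ x.obj.hom = w.obj.hom), (q.obj (y w) ⟶ σ.obj x) := fun w x m e =>
    ε w ≫ σ.map (ObjectProperty.homMk (Over.homMk m e) :
      (⟨Over.mk w.obj.hom, hle _ w.property⟩ : (sieveCat R).obj) ⟶ x)
  have hρ : ∀ w x m e, (stackification J Y).p.IsHomLift m (ρ w x m e) := fun w x m e =>
    lift_comp (hε w) (sieveCat_map_lift σ (ObjectProperty.homMk (Over.homMk m e) :
      (⟨Over.mk w.obj.hom, hle _ w.property⟩ : (sieveCat R).obj) ⟶ x)) (Category.id_comp m)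
  have cρ : ∀ {w w' : (sieveCat R').obj} (g : w' ⟶ w) (x : (sieveCat R).obj) (m m') (e e')
      (_ : g.hom.left ≫ m = m'), q.map (c g) ≫ ρ w x m e = ρ w' x m' e' := by
    intro w w' g x m m' e e' h
    refine (Category.assoc _ _ _).symm.trans ((congrArg (· ≫ _) (ec g)).trans
      ((Category.assoc _ _ _).trans (congrArg (ε w' ≫ ·) ?_)))
    refine (σ.map_comp _ _).symm.trans (congrArg σ.map ?_)
    ext
    exact h
  have ρσ : ∀ (w : (sieveCat R').obj) {x z : (sieveCat R).obj} (g : x ⟶ z) (m) (e) (m') (e')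
      (_ : m ≫ g.hom.left = m'), ρ w x m e ≫ σ.map g = ρ w z m' e' := by
    intro w x z g m e m' e' h
    refine (Category.assoc _ _ _).trans (congrArg (ε w ≫ ·) ?_)
    refine (σ.map_comp _ _).symm.trans (congrArg σ.map ?_)
    ext
    exact h
  have exψ : ∀ x : (sieveCat R).obj, ∃ ψ : σ.obj x ⟶ a,
      (stackification J Y).p.IsHomLift x.obj.hom ψ ∧ ∀ w m e, ρ w x m e ≫ ψ = κ w := by
    intro x
    obtain ⟨ψ, ⟨hψ, eψ⟩, -⟩ := hpZ x.obj.hom (σ.obj x) a (σ.w_obj x) rfl (R'.pullback x.obj.hom)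
      (J.pullback_stable _ hR')
      { obj := fun m hm => q.obj (y ⟨Over.mk (m ≫ x.obj.hom), hm⟩)
        map := fun m hm => ρ ⟨Over.mk (m ≫ x.obj.hom), hm⟩ x m rfl
        lift := fun m hm => hρ ⟨Over.mk (m ≫ x.obj.hom), hm⟩ x m rfl }
      (fun U m hm => κ ⟨Over.mk (m ≫ x.obj.hom), hm⟩)
      (fun m hm => hκ ⟨Over.mk (m ≫ x.obj.hom), hm⟩) (by
        intro V U m hm m' hm' g e η hη eη
        let g' : (⟨Over.mk (m' ≫ x.obj.hom), hm'⟩ : (sieveCat R').obj) ⟶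
            ⟨Over.mk (m ≫ x.obj.hom), hm⟩ := ObjectProperty.homMk (Over.homMk g
              ((Category.assoc _ _ _).symm.trans (congrArg (· ≫ x.obj.hom) e)))
        obtain rfl : η = q.map (c g') :=
          hZ.ext (hρ ⟨Over.mk (m ≫ x.obj.hom), hm⟩ x m rfl) hη
            (have : Y.p.IsHomLift g (c g') := hc g'; q.preserves_isHomLift g (c g'))
            (eη.trans (cρ g' x m m' rfl rfl e).symm)
        exact nκ g')
    have eψ' : ∀ {U : C} (k : U ⟶ T) (hk : R' k) (m : U ⟶ x.obj.left) (e : m ≫ x.obj.hom = k),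
        ρ ⟨Over.mk k, hk⟩ x m e ≫ ψ = κ ⟨Over.mk k, hk⟩ := by
      intro U k hk m e
      subst e
      exact eψ m hk
    exact ⟨ψ, hψ, fun w m e => eψ' w.obj.hom w.property m e⟩
  choose ψ hψ eψ using exψ
  refine ⟨a, rfl, ψ, hψ, fun {x z} g => ?_⟩
  refine hpZ.hom_ext hZ (lift_comp (sieveCat_map_lift σ g) (hψ z) (Over.w g.hom)) (hψ x)
    (R'.pullback x.obj.hom) (J.pullback_stable _ hR') fun {U} m hm => ?_
  let w : (sieveCat R').obj := ⟨Over.mk (m ≫ x.obj.hom), hm⟩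
  refine ⟨_, ρ w x m rfl, hρ w x m rfl, ?_⟩
  have e : (m ≫ g.hom.left) ≫ z.obj.hom = m ≫ x.obj.hom := by
    rw [Category.assoc, Over.w g.hom]
  rw [eψ, ← Category.assoc, ρσ w g m rfl _ e rfl, eψ]

end Stackification

/-! ### The transformation prestack -/

section Transformation

variable {C : Type u₁} [Category.{v₁} C] {J : GrothendieckTopology C} {G : Cᵒᵖ ⥤ GrpCat.{r}}
  {X : BasedCategory.{v₂, u₂} C}

theorem actMap_id (μ : grpProd G X ⥤ᵇ X) {T : C} {g : G.obj (op T)} {x : Fib X T}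
    (e : G.map (𝟙 T).op g = g) (h : X.p.IsHomLift (𝟙 T) (𝟙 x.obj)) :
    actMap μ (x := x) (y := x) (𝟙 T) e (𝟙 x.obj) h = 𝟙 _ :=
  μ.map_id ⟨T, g, x⟩

theorem lift_eqToHom {T : C} {a b : X.obj} (h : a = b) (ha : X.p.obj a = T) :
    X.p.IsHomLift (𝟙 T) (eqToHom h) := by
  subst h
  exact IsHomLift.id ha

namespace GroupAction

variable (A : GroupAction G X)

/-- The arrow of the transformation prestack over `f : S ⟶ T` given by a section `g` of `G`
over `S` and an arrow `g · x ⟶ y` over `f`. -/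
def homOf : ∀ {S T : C} (x : Fib X S) (y : Fib X T) (f : S ⟶ T) (g : G.obj (op S))
    (δ : (act A.μ g x).obj ⟶ y.obj) (_ : X.p.IsHomLift f δ),
    (⟨x.obj⟩ : A.TransObj) ⟶ ⟨y.obj⟩
  | _, _, ⟨_, rfl⟩, ⟨_, rfl⟩, f, g, δ, hδ => (⟨f, g, δ, hδ⟩ : TransHom _ _)

section

variable {S T U : C} {x : Fib X S} {y : Fib X T} {z : Fib X U}

theorem homOf_lift (f : S ⟶ T) (g : G.obj (op S)) (δ : (act A.μ g x).obj ⟶ y.obj)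
    (hδ : X.p.IsHomLift f δ) : A.transCat.p.IsHomLift f (A.homOf x y f g δ hδ) := by
  obtain ⟨x, rfl⟩ := x
  obtain ⟨y, rfl⟩ := y
  exact .map (p := A.transCat.p) (A.homOf (Fib.of x) (Fib.of y) f g δ hδ)

theorem exists_homOf (x : Fib X S) (y : Fib X T) {f : S ⟶ T}
    {φ : (⟨x.obj⟩ : A.TransObj) ⟶ ⟨y.obj⟩} (hφ : A.transCat.p.IsHomLift f φ) :
    ∃ g δ hδ, φ = A.homOf x y f g δ hδ := by
  obtain ⟨x, rfl⟩ := x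
  obtain ⟨y, rfl⟩ := y
  obtain rfl := map_eq_of_lift hφ
  exact ⟨TransHom.grp φ, TransHom.arr φ, TransHom.lift φ, rfl⟩

theorem homOf_congr {f f' : S ⟶ T} {g g' : G.obj (op S)} {δ : (act A.μ g x).obj ⟶ y.obj}
    {hδ : X.p.IsHomLift f δ} {δ' : (act A.μ g' x).obj ⟶ y.obj} {hδ' : X.p.IsHomLift f' δ'}
    (h : f = f') (e : g = g') (w : δ = eqToHom (by rw [e]) ≫ δ') :
    A.homOf x y f g δ hδ = A.homOf x y f' g' δ' hδ' := by
  subst h e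
  obtain rfl : δ = δ' := w.trans (Category.id_comp _)
  rfl

theorem grp_eq_of_homOf_eq {f f' : S ⟶ T} {g g' : G.obj (op S)} {δ : (act A.μ g x).obj ⟶ y.obj}
    {hδ : X.p.IsHomLift f δ} {δ' : (act A.μ g' x).obj ⟶ y.obj} {hδ' : X.p.IsHomLift f' δ'}
    (h : A.homOf x y f g δ hδ = A.homOf x y f' g' δ' hδ') : g = g' := by
  obtain ⟨x, rfl⟩ := x
  obtain ⟨y, rfl⟩ := y
  exact congrArg TransHom.grp h

theorem arr_eq_of_homOf_eq {f f' : S ⟶ T} {g : G.obj (op S)} {δ δ' : (act A.μ g x).obj ⟶ y.obj}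
    {hδ : X.p.IsHomLift f δ} {hδ' : X.p.IsHomLift f' δ'}
    (h : A.homOf x y f g δ hδ = A.homOf x y f' g δ' hδ') : δ = δ' := by
  obtain ⟨x, rfl⟩ := x
  obtain ⟨y, rfl⟩ := y
  injection h with _ _ h

theorem arr_eq_of_homOf_eq' {f f' : S ⟶ T} {g g' : G.obj (op S)}
    {δ : (act A.μ g x).obj ⟶ y.obj} {hδ : X.p.IsHomLift f δ} {δ' : (act A.μ g' x).obj ⟶ y.obj}
    {hδ' : X.p.IsHomLift f' δ'} (h : A.homOf x y f g δ hδ = A.homOf x y f' g' δ' hδ')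
    (e : g = g') : δ = eqToHom (by rw [e]) ≫ δ' := by
  subst e
  rw [eqToHom_refl, Category.id_comp]
  exact A.arr_eq_of_homOf_eq h

theorem homOf_comp {f : S ⟶ T} {g : G.obj (op S)} {δ : (act A.μ g x).obj ⟶ y.obj}
    (hδ : X.p.IsHomLift f δ) {f' : T ⟶ U} {h : G.obj (op T)} {ε : (act A.μ h y).obj ⟶ z.obj}
    (hε : X.p.IsHomLift f' ε) {h' : G.obj (op S)} (e : G.map f.op h = h') :
    A.homOf x y f g δ hδ ≫ A.homOf y z f' h ε hε =
      A.homOf x z (f ≫ f') (h' * g)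
        ((A.assoc h' g x).inv ≫ actMap A.μ (x := act A.μ g x) f e δ hδ ≫ ε)
        (lift_comp (A.assoc_inv_lift _ _ _) (lift_comp (actMap_lift _ _ _ _ _) hε rfl)) := by
  subst e
  obtain ⟨x, rfl⟩ := x
  obtain ⟨y, rfl⟩ := y
  obtain ⟨z, rfl⟩ := z
  rfl

theorem id_eq_homOf (x : Fib X S) : 𝟙 (⟨x.obj⟩ : A.TransObj) =
    A.homOf x x (𝟙 S) 1 (A.unitor x).inv (A.unitor_inv_lift x) := by
  obtain ⟨x, rfl⟩ := x
  rfl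

theorem ofHom_eq_homOf {f : S ⟶ T} {φ : x.obj ⟶ y.obj} (hφ : X.p.IsHomLift f φ) :
    TransHom.ofHom A φ = A.homOf x y f 1 ((A.unitor x).inv ≫ φ)
      (lift_comp (A.unitor_inv_lift x) hφ) := by
  obtain ⟨x, rfl⟩ := x
  obtain ⟨y, rfl⟩ := y
  obtain rfl := map_eq_of_lift hφ
  rfl

theorem homOf_comp_ofHom {f : S ⟶ T} {g : G.obj (op S)} {δ : (act A.μ g x).obj ⟶ y.obj}
    (hδ : X.p.IsHomLift f δ) {f' : T ⟶ U} {φ : y.obj ⟶ z.obj} (hφ : X.p.IsHomLift f' φ) :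
    A.homOf x y f g δ hδ ≫ TransHom.ofHom A φ =
      A.homOf x z (f ≫ f') g (δ ≫ φ) (lift_comp hδ hφ rfl) := by
  obtain ⟨x, rfl⟩ := x
  obtain ⟨y, rfl⟩ := y
  obtain ⟨z, rfl⟩ := z
  obtain rfl := map_eq_of_lift hφ
  exact TransHom.comp_ofHom A (A.homOf (Fib.of x) (Fib.of y) f g δ hδ) φ

/-- The unit law for the action, in terms of the inverses of the structural 2-morphisms. -/
theorem assoc_inv_actFib_unitor_inv (g : G.obj (op S)) (x : Fib X S)
    (hg : G.map (𝟙 S).op g = g) :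
    (A.assoc g 1 x).inv ≫ actMap A.μ (x := act A.μ 1 x) (y := x) (𝟙 S) hg
      (A.unitor x).inv (A.unitor_inv_lift x) = eqToHom (by rw [mul_one]) := by
  have l : X.p.IsHomLift (𝟙 S) (𝟙 (act A.μ g x).obj) := IsHomLift.id (act A.μ g x).obj_eq
  have h := Category.id_comp (A.homOf x (act A.μ g x) (𝟙 S) g (𝟙 _) l)
  rw [A.id_eq_homOf x, A.homOf_comp _ _ hg] at h
  simpa using A.arr_eq_of_homOf_eq' h (mul_one g)

theorem ofHom_comp_homOf {f : S ⟶ T} {φ : x.obj ⟶ y.obj} (hφ : X.p.IsHomLift f φ) {f' : T ⟶ U}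
    {h : G.obj (op T)} {ε : (act A.μ h y).obj ⟶ z.obj} (hε : X.p.IsHomLift f' ε)
    {h' : G.obj (op S)} (e : G.map f.op h = h') :
    TransHom.ofHom A φ ≫ A.homOf y z f' h ε hε =
      A.homOf x z (f ≫ f') h' (actMap A.μ (x := x) (y := y) f e φ hφ ≫ ε)
        (lift_comp (actMap_lift _ _ _ _ _) hε rfl) := by
  rw [A.ofHom_eq_homOf hφ, A.homOf_comp _ _ e]
  refine A.homOf_congr rfl (mul_one _) ?_
  have hg : G.map (𝟙 S).op h' = h' := by simp
  have h₁ := A.assoc_inv_actFib_unitor_inv h' x hg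
  have h₂ : actMap A.μ (x := act A.μ 1 x) (y := y) f e ((A.unitor x).inv ≫ φ)
      (lift_comp (A.unitor_inv_lift x) hφ) =
      actMap A.μ (x := act A.μ 1 x) (y := x) (𝟙 S) hg (A.unitor x).inv (A.unitor_inv_lift x) ≫
        actMap A.μ (x := x) (y := y) f e φ hφ := by
    rw [actMap_comp]
    exact congrArg A.μ.map (GrpProdHom.ext (Category.id_comp f).symm rfl)
  rw [h₂, ← h₁]
  simp only [Category.assoc]

/-- The inverse of the arrow `(g, g · x ⟶ g · x)` from `x` to `g · x`. -/
theorem exists_homOf_comp_eq_id (g : G.obj (op S)) (x : Fib X S) :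
    ∃ ρ : (⟨(act A.μ g x).obj⟩ : A.TransObj) ⟶ ⟨x.obj⟩, A.transCat.p.IsHomLift (𝟙 S) ρ ∧
      A.homOf x (act A.μ g x) (𝟙 S) g (𝟙 _) (IsHomLift.id (act A.μ g x).obj_eq) ≫ ρ = 𝟙 _ := by
  have hg : G.map (𝟙 S).op g⁻¹ = g⁻¹ := by simp
  have h₁ : (act A.μ (g⁻¹ * g) x).obj = (act A.μ 1 x).obj := by rw [inv_mul_cancel]
  have l₁ : X.p.IsHomLift (𝟙 S) (eqToHom h₁) := lift_eqToHom h₁ (act A.μ (g⁻¹ * g) x).obj_eq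
  have l₂ : X.p.IsHomLift (𝟙 S) (eqToHom h₁ ≫ (A.unitor x).inv) :=
    lift_comp l₁ (A.unitor_inv_lift x) (Category.comp_id _)
  have l : X.p.IsHomLift (𝟙 S) ((A.assoc g⁻¹ g x).hom ≫ eqToHom h₁ ≫ (A.unitor x).inv) :=
    lift_comp (A.assoc_lift _ _ _) l₂ (Category.comp_id _)
  refine ⟨A.homOf (act A.μ g x) x (𝟙 S) g⁻¹ _ l, A.homOf_lift _ _ _ _, ?_⟩
  rw [A.homOf_comp _ _ hg, A.id_eq_homOf]
  refine A.homOf_congr (Category.comp_id _) (inv_mul_cancel g) ?_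
  rw [actMap_id]
  simp

end

/-- An arrow over an identity is the composition of an arrow `(g, g · x ⟶ g · x)` and an arrow
of `X`. -/
theorem homOf_id_comp_ofHom {S T : C} {x : Fib X S} {y : Fib X T} (g : G.obj (op S)) {f : S ⟶ T}
    {δ : (act A.μ g x).obj ⟶ y.obj} (hδ : X.p.IsHomLift f δ) :
    A.homOf x (act A.μ g x) (𝟙 S) g (𝟙 _) (IsHomLift.id (act A.μ g x).obj_eq) ≫
      TransHom.ofHom A δ = A.homOf x y f g δ hδ := by
  rw [A.homOf_comp_ofHom (y := act A.μ g x) (z := y) (IsHomLift.id (act A.μ g x).obj_eq) hδ]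
  exact A.homOf_congr (Category.id_comp _) rfl (by simp)

theorem ofHom_comp_ofHom {x y z : X.obj} (φ : x ⟶ y) (ψ : y ⟶ z) :
    TransHom.ofHom A φ ≫ TransHom.ofHom A ψ = TransHom.ofHom A (φ ≫ ψ) :=
  (A.toTransCat.map_comp φ ψ).symm

theorem ofHom_lift {S T : C} {x y : X.obj} {f : S ⟶ T} {φ : x ⟶ y} (hφ : X.p.IsHomLift f φ) :
    A.transCat.p.IsHomLift f (TransHom.ofHom A φ) :=
  A.toTransCat.preserves_isHomLift f φ

/-- The transformation prestack of a category fibered in groupoids is fibered in groupoids. -/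
theorem isFiberedInGroupoids_transCat (hX : IsFiberedInGroupoids X) :
    IsFiberedInGroupoids A.transCat := by
  have hr : ∀ (T : C) (a b : A.TransObj) (φ : a ⟶ b), A.transCat.p.IsHomLift (𝟙 T) φ →
      ∃ ψ : b ⟶ a, A.transCat.p.IsHomLift (𝟙 T) ψ ∧ φ ≫ ψ = 𝟙 a := by
    intro T a b φ hφ
    let x : Fib X T := ⟨a.obj, IsHomLift.domain_eq A.transCat.p (𝟙 T) φ⟩
    let y : Fib X T := ⟨b.obj, IsHomLift.codomain_eq A.transCat.p (𝟙 T) φ⟩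
    obtain ⟨g, δ, hδ, eφ⟩ := A.exists_homOf x y hφ
    have := hX.isIso T _ _ δ hδ
    obtain ⟨ρ, hρ, e⟩ := A.exists_homOf_comp_eq_id g x
    have hi : X.p.IsHomLift (𝟙 T) (inv δ) := IsHomLift.lift_id_inv_isIso X.p T δ
    refine ⟨TransHom.ofHom A (inv δ) ≫ ρ, lift_comp (A.ofHom_lift hi) hρ, ?_⟩
    rw [eφ, ← A.homOf_id_comp_ofHom g hδ, Category.assoc, ← Category.assoc (TransHom.ofHom A δ),
      ofHom_comp_ofHom, IsIso.hom_inv_id]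
    refine Eq.trans ?_ e
    congr 1
    exact (congrArg (· ≫ ρ) (A.toTransCat.map_id _)).trans (Category.id_comp ρ)
  refine ⟨A.isFibered_transCat hX.isFibered, fun T a b φ hφ => ?_⟩
  obtain ⟨ψ, hψ, e⟩ := hr T a b φ hφ
  obtain ⟨χ, -, e'⟩ := hr T b a ψ hψ
  refine ⟨ψ, e, ?_⟩
  have : φ = χ := by
    rw [← Category.comp_id φ, ← e', ← Category.assoc, e, Category.id_comp]
  rw [this, e']

/-- The transformation prestack is a prestack: an arrow `(g, δ)` glues because `g` is a section of
the sheaf `G`, and then `δ` is an arrow `g · x ⟶ y` of the prestack `X`. -/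
theorem isPrestack_transCat (hX : IsFiberedInGroupoids X) (hp : IsPrestack J X)
    (hG : Presieve.IsSheaf J (G ⋙ forget GrpCat)) : IsPrestack J A.transCat := by
  refine .of_exists (A.isFiberedInGroupoids_transCat hX) ?_
  rintro T T' f ⟨x⟩ ⟨y⟩ hx hy R hR
  change X.p.obj x = T at hx
  change X.p.obj y = T' at hy
  let x' : Fib X T := ⟨x, hx⟩
  let y' : Fib X T' := ⟨y, hy⟩
  let c : ∀ {U : C} (i : U ⟶ T), Fib X U := fun i => ⟨hX.liftObj hx i, hX.obj_liftObj hx i⟩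
  let π : ∀ {U : C} (i : U ⟶ T), (c i).obj ⟶ x := fun i => hX.liftMap hx i
  have hπ : ∀ {U : C} (i : U ⟶ T), X.p.IsHomLift i (π i) := fun i => hX.liftMap_lift hx i
  refine ⟨R, le_rfl, hR,
    { obj := fun i _ => ⟨(c i).obj⟩
      map := fun i _ => TransHom.ofHom A (π i)
      lift := fun i _ => A.ofHom_lift (hπ i) }, fun φ hφ hc => ?_⟩
  choose g δ hδ eφ using fun {U : C} (i : U ⟶ T) (hi : R i) => A.exists_homOf (c i) y' (hφ i hi)
  -- If the arrows `(g i, δ i)` are compatible, then so are the `g i`, and the `δ i`.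
  have comp : ∀ {V U : C} (i : U ⟶ T) (hi : R i) (i' : V ⟶ T) (hi' : R i') (m : V ⟶ U)
      (_ : m ≫ i = i') (η : (c i').obj ⟶ (c i).obj) (hη : X.p.IsHomLift m η) (_ : η ≫ π i = π i'),
      ∃ e : G.map m.op (g i hi) = g i' hi',
        actMap A.μ (x := c i') (y := c i) m e η hη ≫ δ i hi = δ i' hi' := by
    intro V U i hi i' hi' m w η hη e
    have h := hc i hi i' hi' m w (TransHom.ofHom A η) (A.ofHom_lift hη)
      ((A.ofHom_comp_ofHom η (π i)).trans (congrArg _ e))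
    rw [eφ, eφ] at h
    have h' := (A.ofHom_comp_homOf (x := c i') (y := c i) hη (hδ i hi) rfl).symm.trans h
    have eg := A.grp_eq_of_homOf_eq h'
    refine ⟨eg, ?_⟩
    have h'' := (A.ofHom_comp_homOf (x := c i') (y := c i) hη (hδ i hi) eg).symm.trans h
    exact A.arr_eq_of_homOf_eq h''
  have ex : ∀ {V U : C} (i : U ⟶ T) (i' : V ⟶ T) (m : V ⟶ U) (_ : m ≫ i = i'),
      ∃ η : (c i').obj ⟶ (c i).obj, X.p.IsHomLift m η ∧ η ≫ π i = π i' :=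
    fun i i' m w => hX.exists_fill (hπ i) (hπ i') m w
  have sh := hG R hR (fun U i hi => g i hi) (by
    refine (Presieve.compatible_iff_sieveCompatible (P := G ⋙ forget GrpCat) _).2 ?_
    intro V U i m hi
    obtain ⟨η, hη, e⟩ := ex i (m ≫ i) m rfl
    exact (comp i hi (m ≫ i) _ m rfl η hη e).1.symm)
  obtain ⟨k, hk, uk⟩ := sh
  have hk' : ∀ {U : C} (i : U ⟶ T) (hi : R i), G.map i.op k = g i hi := fun i hi => hk i hi
  have key := hp f (act A.μ k x').obj y (act A.μ k x').obj_eq hy R hR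
    { obj := fun i hi => (act A.μ (g i hi) (c i)).obj
      map := fun i hi => actMap A.μ (x := c i) (y := x') i (hk' i hi) (π i) (hπ i)
      lift := fun i hi => actMap_lift _ _ _ _ _ } (fun U i hi => δ i hi) (fun i hi => hδ i hi) (by
      intro V U i hi i' hi' m w η hη e
      obtain ⟨η₀, hη₀, e₀⟩ := ex i i' m w
      obtain ⟨eg, h⟩ := comp i hi i' hi' m w η₀ hη₀ e₀
      refine Eq.trans (congrArg (· ≫ δ i hi) ?_) h
      refine hX.ext (actMap_lift A.μ (x := c i) (y := x') i (hk' i hi) (π i) (hπ i)) hη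
        (actMap_lift A.μ (x := c i') (y := c i) m eg η₀ hη₀) (e.trans ?_)
      rw [actMap_comp]
      exact congrArg A.μ.map (GrpProdHom.ext w.symm e₀.symm))
  obtain ⟨ε, ⟨hε, eε⟩, uε⟩ := key
  refine ⟨A.homOf x' y' f k ε hε, ⟨A.homOf_lift _ _ _ _, fun {U} i hi => ?_⟩, ?_⟩
  · rw [eφ i hi]
    refine (A.ofHom_comp_homOf (x := c i) (y := x') (hπ i) hε (hk' i hi)).trans ?_
    exact A.homOf_congr rfl rfl ((eε i hi).trans (Category.id_comp _).symm)
  · rintro ψ ⟨hψ, eψ⟩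
    obtain ⟨k', ε', hε', rfl⟩ := A.exists_homOf x' y' hψ
    have h : ∀ {U : C} (i : U ⟶ T) (hi : R i), TransHom.ofHom A (π i) ≫ A.homOf x' y' f k' ε' hε' =
        A.homOf (c i) y' (i ≫ f) (g i hi) (δ i hi) (hδ i hi) :=
      fun i hi => (eψ i hi).trans (eφ i hi)
    obtain rfl : k' = k := uk k' fun U i hi => A.grp_eq_of_homOf_eq
      ((A.ofHom_comp_homOf (x := c i) (y := x') (hπ i) hε' rfl).symm.trans (h i hi))
    obtain rfl : ε' = ε := uε ε' ⟨hε', fun i hi => A.arr_eq_of_homOf_eq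
      ((A.ofHom_comp_homOf (x := c i) (y := x') (hπ i) hε' (hk' i hi)).symm.trans (h i hi))⟩
    rfl

theorem isEpimorphism_toTransCat (hX : IsFiberedInGroupoids X) :
    IsEpimorphism J A.toTransCat := by
  refine fun a => ⟨⊤, J.top_mem _, fun U i _ => ?_⟩
  obtain ⟨x, φ, hφ⟩ := hX.exists_lift (a := a.obj) rfl i
  exact ⟨x, TransHom.ofHom A φ, A.ofHom_lift hφ⟩

end GroupAction

end Transformation

/-! ### Spaces of arrows and the diagonal -/

section Diagonal

variable {C : Type u₁} [Category.{v₁} C]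

theorem isFiberedInGroupoids_rep (T : C) : IsFiberedInGroupoids (rep T) := by
  refine .of_unique_lift (fun a S f => ⟨Over.mk (f ≫ a.hom), restrHom a f,
    .map (p := (rep T).p) (restrHom a f)⟩) ?_
  intro a a' b φ φ' g w
  refine ⟨Over.homMk g ?_, ⟨rfl, Over.OverMorphism.ext w⟩, fun χ h => Over.OverMorphism.ext h.1⟩
  exact (congrArg (g ≫ ·) (Over.w φ).symm).trans ((Category.assoc _ _ _).symm.trans
    ((congrArg (· ≫ b.hom) w).trans (Over.w φ')))

theorem isFiberedInGroupoids_prodCat {X : BasedCategory.{v₂, u₂} C} {Y : BasedCategory.{v₃, u₃} C}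
    (hX : IsFiberedInGroupoids X) (hY : IsFiberedInGroupoids Y) :
    IsFiberedInGroupoids (prodCat X Y) := by
  refine .of_unique_lift (fun a S f => ?_) ?_
  · obtain ⟨x, φ, hφ⟩ := hX.exists_lift a.fst.obj_eq f
    obtain ⟨y, ψ, hψ⟩ := hY.exists_lift a.snd.obj_eq f
    let b : ProdObj X Y := ⟨S, ⟨x, IsHomLift.domain_eq X.p f φ⟩, ⟨y, IsHomLift.domain_eq Y.p f ψ⟩⟩
    let χ : b ⟶ a := (⟨f, φ, ψ, hφ, hψ⟩ : ProdHom b a)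
    exact ⟨b, χ, .map (p := (prodCat X Y).p) χ⟩
  · intro a a' b φ φ' g w
    obtain ⟨χ, hχ, eχ⟩ := hX.exists_fill φ.fst_lift φ'.fst_lift g w
    obtain ⟨ψ, hψ, eψ⟩ := hY.exists_fill φ.snd_lift φ'.snd_lift g w
    refine ⟨(⟨g, χ, ψ, hχ, hψ⟩ : ProdHom a' a), ⟨rfl, ProdHom.ext w eχ eψ⟩, ?_⟩
    rintro ρ ⟨rfl, e⟩
    exact ProdHom.ext rfl
      (hX.ext φ.fst_lift ρ.fst_lift hχ ((congrArg ProdHom.fst e).trans eχ.symm))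
      (hY.ext φ.snd_lift ρ.snd_lift hψ ((congrArg ProdHom.snd e).trans eψ.symm))

theorem isFiberedInGroupoids_fiberProd {X : BasedCategory.{v₂, u₂} C}
    {Y : BasedCategory.{v₃, u₃} C} {Z : BasedCategory.{v₄, u₄} C} (hX : IsFiberedInGroupoids X)
    (hY : IsFiberedInGroupoids Y) (hZ : IsFiberedInGroupoids Z) (F : Y ⥤ᵇ X) (H : Z ⥤ᵇ X) :
    IsFiberedInGroupoids (fiberProd F H) := by
  refine .of_unique_lift (fun a S f => ?_) ?_
  · obtain ⟨y, φ, hφ⟩ := hY.exists_lift a.fst.obj_eq f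
    obtain ⟨z, ψ, hψ⟩ := hZ.exists_lift a.snd.obj_eq f
    obtain ⟨α, hα, eα⟩ := hX.exists_fill (F.preserves_isHomLift f φ)
      (lift_comp (H.preserves_isHomLift f ψ) a.arr_lift (Category.comp_id f)) (𝟙 S)
      (Category.id_comp f)
    let b : FiberProdObj F H := ⟨S, ⟨y, IsHomLift.domain_eq Y.p f φ⟩,
      ⟨z, IsHomLift.domain_eq Z.p f ψ⟩, α, hα⟩
    let χ : b ⟶ a := (⟨f, φ, ψ, hφ, hψ, eα⟩ : FiberProdHom b a)
    exact ⟨b, χ, .map (p := (fiberProd F H).p) χ⟩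
  · intro a a' b φ φ' g w
    obtain ⟨χ, hχ, eχ⟩ := hY.exists_fill φ.fst_lift φ'.fst_lift g w
    obtain ⟨ψ, hψ, eψ⟩ := hZ.exists_fill φ.snd_lift φ'.snd_lift g w
    have comm : a'.arr ≫ F.map χ = H.map ψ ≫ a.arr := by
      have hφ := φ.fst_lift
      refine hX.ext (F.preserves_isHomLift φ.base φ.fst)
        (lift_comp a'.arr_lift (F.preserves_isHomLift g χ) (Category.id_comp g))
        (lift_comp (H.preserves_isHomLift g ψ) a.arr_lift (Category.comp_id g)) ?_
      rw [Category.assoc, Category.assoc, φ.comm, ← F.map_comp, eχ, ← Category.assoc, ← H.map_comp,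
        eψ, φ'.comm]
    refine ⟨(⟨g, χ, ψ, hχ, hψ, comm⟩ : FiberProdHom a' a), ⟨rfl, FiberProdHom.ext w eχ eψ⟩, ?_⟩
    rintro ρ ⟨rfl, e⟩
    exact FiberProdHom.ext rfl
      (hY.ext φ.fst_lift ρ.fst_lift hχ ((congrArg FiberProdHom.fst e).trans eχ.symm))
      (hZ.ext φ.snd_lift ρ.snd_lift hψ ((congrArg FiberProdHom.snd e).trans eψ.symm))

theorem IsFiberedInGroupoids.nonempty_iso {Z : BasedCategory.{v₂, u₂} C}
    (h : IsFiberedInGroupoids Z) {W : BasedCategory.{v₃, u₃} C} {F G : W ⥤ᵇ Z} (β : F ⟶ G) :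
    Nonempty (F ≅ G) := by
  have : ∀ x, IsIso (β.app x) := fun x => h.isIso _ _ _ _ (β.isHomLift' x)
  exact ⟨BasedNatIso.mkNatIso (NatIso.ofComponents (fun x => asIso (β.app x))
    (fun g => β.naturality g)) β.isHomLift'⟩

/-- A category fibered in groupoids with a terminal object is equivalent to a represented one. -/
theorem IsFiberedInGroupoids.areEquivalent_rep {Z : BasedCategory.{v₂, u₂} C}
    (h : IsFiberedInGroupoids Z) {z : Z.obj} (hz : Limits.IsTerminal z) :
    AreEquivalent Z (rep (Z.p.obj z)) := by
  let F : Z ⥤ᵇ rep (Z.p.obj z) :=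
    { toFunctor :=
        { obj := fun w => Over.mk (Z.p.map (hz.from w))
          map := fun φ => Over.homMk (Z.p.map φ) (by
            exact (Z.p.map_comp _ _).symm.trans (congrArg Z.p.map (hz.hom_ext _ _)))
          map_id := fun w => Over.OverMorphism.ext (Z.p.map_id w)
          map_comp := fun φ ψ => Over.OverMorphism.ext (Z.p.map_comp φ ψ) }
      w := rfl }
  let H : rep (Z.p.obj z) ⥤ᵇ Z := h.sectionOf (a := z) rfl
  refine ⟨F, H, ?_, ?_⟩
  · obtain ⟨β, -⟩ := h.exists_natTrans (F := F.comp H) (G := BasedFunctor.id Z) (b := z)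
      (fun x => Z.p.map (hz.from x)) (fun x => h.sectionProj (a := z) rfl (F.obj x))
      (fun x => h.sectionProj_lift (a := z) rfl (F.obj x))
      (fun g => h.sectionOf_map (a := z) rfl (F.map g)) (fun x => hz.from x) (fun x => .map _)
      (fun g => hz.hom_ext _ _)
    exact h.nonempty_iso β
  · have hr := isFiberedInGroupoids_rep (Z.p.obj z)
    let φ : ∀ x : Over (Z.p.obj z), F.obj (H.obj x) ⟶ Over.mk (𝟙 (Z.p.obj z)) :=
      fun x => Over.homMk (Z.p.map (hz.from (H.obj x))) (Category.comp_id _)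
    have e : ∀ x : Over (Z.p.obj z), hz.from (H.obj x) = h.sectionProj (a := z) rfl x :=
      fun x => hz.hom_ext _ _
    have hφ : ∀ x : Over (Z.p.obj z), (rep (Z.p.obj z)).p.IsHomLift x.hom (φ x) := by
      intro x
      refine IsHomLift.of_fac' (rep (Z.p.obj z)).p x.hom (φ x) (H.w_obj x) rfl ?_
      have := h.sectionProj_lift (a := z) rfl x
      have h' := IsHomLift.fac' Z.p x.hom (h.sectionProj (a := z) rfl x)
      exact (congrArg Z.p.map (e x)).trans h'
    obtain ⟨β, -⟩ := hr.exists_natTrans (F := H.comp F) (G := BasedFunctor.id _)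
      (b := Over.mk (𝟙 (Z.p.obj z))) (fun x => x.hom) φ hφ
      (fun g => Over.mkIdTerminal.hom_ext _ _)
      (fun x => Over.homMk x.hom (Category.comp_id _))
      (fun x => .map (p := (rep (Z.p.obj z)).p)
        (Over.homMk x.hom (Category.comp_id _) : x ⟶ Over.mk (𝟙 (Z.p.obj z))))
      (fun g => Over.mkIdTerminal.hom_ext _ _)
    exact hr.nonempty_iso β

/-- A based category that is equivalent to a represented one has a terminal object. -/
theorem AreEquivalent.exists_isTerminal {Z : BasedCategory.{v₂, u₂} C} {S : C}
    (h : AreEquivalent Z (rep S)) : ∃ z : Z.obj, Nonempty (Limits.IsTerminal z) := by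
  obtain ⟨F, H, ⟨α⟩, ⟨β⟩⟩ := h
  let e : Z.obj ≌ Over S := CategoryTheory.Equivalence.mk F.toFunctor H.toFunctor
    ((BasedNatTrans.forgetful _ _).mapIso α).symm ((BasedNatTrans.forgetful _ _).mapIso β)
  exact ⟨e.inverse.obj (Over.mk (𝟙 S)), ⟨Over.mkIdTerminal.isTerminalObj e.inverse _⟩⟩

/-- The arrows from `a` to `b` over `f : T ⟶ T'` are represented by a space over `T`: there is a
universal object `c` with arrows `α : c ⟶ a` and `β : c ⟶ b` over arrows of the base that commute
with `f`. (In a category fibered in groupoids, `c` is the pullback of `a` along some `i`, and `β`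
is an arrow over `i ≫ f` from it to `b`.) -/
def HasIsom (Z : BasedCategory.{v₂, u₂} C) {T T' : C} (f : T ⟶ T') (a b : Z.obj) : Prop :=
  ∃ (U : C) (i : U ⟶ T) (c : Z.obj) (α : c ⟶ a) (β : c ⟶ b), Z.p.IsHomLift i α ∧
    Z.p.IsHomLift (i ≫ f) β ∧ ∀ {V : C} (j : V ⟶ T) {c' : Z.obj} (α' : c' ⟶ a) (β' : c' ⟶ b),
      Z.p.IsHomLift j α' → Z.p.IsHomLift (j ≫ f) β' → ∃! η : c' ⟶ c, η ≫ α = α' ∧ η ≫ β = β'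

variable {Z : BasedCategory.{v₂, u₂} C}

theorem prodCat_fst_lift {X : BasedCategory.{v₂, u₂} C} {Y : BasedCategory.{v₃, u₃} C}
    {a b : ProdObj X Y} {S T : C} {f : S ⟶ T} {φ : a ⟶ b} (h : (prodCat X Y).p.IsHomLift f φ) :
    X.p.IsHomLift f φ.fst := by
  obtain ⟨⟩ := h
  exact φ.fst_lift

theorem prodCat_snd_lift {X : BasedCategory.{v₂, u₂} C} {Y : BasedCategory.{v₃, u₃} C}
    {a b : ProdObj X Y} {S T : C} {f : S ⟶ T} {φ : a ⟶ b} (h : (prodCat X Y).p.IsHomLift f φ) :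
    Y.p.IsHomLift f φ.snd := by
  obtain ⟨⟩ := h
  exact φ.snd_lift

theorem prodHom_ext {X : BasedCategory.{v₂, u₂} C} {Y : BasedCategory.{v₃, u₃} C}
    {a b : ProdObj X Y} {φ ψ : a ⟶ b} (h₁ : φ.fst = ψ.fst) (h₂ : φ.snd = ψ.snd) : φ = ψ :=
  ProdHom.ext (lift_unique φ.fst_lift (h₁ ▸ ψ.fst_lift)) h₁ h₂

/-- The morphism to a product with given components. -/
abbrev prodLift {W : BasedCategory.{v₄, u₄} C} {X : BasedCategory.{v₂, u₂} C}
    {Y : BasedCategory.{v₃, u₃} C} (F : W ⥤ᵇ X) (H : W ⥤ᵇ Y) : W ⥤ᵇ prodCat X Y where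
  toFunctor :=
    { obj w := ⟨W.p.obj w, ⟨F.obj w, F.w_obj w⟩, ⟨H.obj w, H.w_obj w⟩⟩
      map φ := ⟨W.p.map φ, F.map φ, H.map φ, inferInstance, inferInstance⟩
      map_id w := ProdHom.ext (W.p.map_id w) (F.map_id w) (H.map_id w)
      map_comp φ ψ := ProdHom.ext (W.p.map_comp φ ψ) (F.map_comp φ ψ) (H.map_comp φ ψ) }
  w := rfl

theorem exists_isHomLift {S T : C} {a b : Z.obj} (ha : Z.p.obj a = S) (hb : Z.p.obj b = T)
    (φ : a ⟶ b) : ∃ m : S ⟶ T, Z.p.IsHomLift m φ := by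
  subst ha hb
  exact ⟨_, .map φ⟩

theorem lift_base_congr {S T T' : C} {a b : Z.obj} {f : S ⟶ T} {φ : a ⟶ b}
    (hφ : Z.p.IsHomLift f φ) (h : T = T') : Z.p.IsHomLift (f ≫ eqToHom h) φ := by
  subst h
  exact lift_congr hφ (Category.comp_id f).symm

/-- If the diagonal of `Z` is representable, then so are the arrows between objects of `Z`. -/
theorem hasIsom_of_isRepresentable_diag (hZ : IsFiberedInGroupoids Z)
    (h : IsRepresentable (diag Z)) {T T' : C} (f : T ⟶ T') {a b : Z.obj} (ha : Z.p.obj a = T)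
    (hb : Z.p.obj b = T') : HasIsom Z f a b := by
  let s := hZ.sectionOf ha
  let s' := (repMap f).comp (hZ.sectionOf hb)
  let πa : ∀ x : Over T, s.obj x ⟶ a := fun x => hZ.sectionProj ha x
  let πb : ∀ x : Over T, s'.obj x ⟶ b := fun x => hZ.sectionProj hb ((repMap f).obj x)
  have hπa : ∀ x : Over T, Z.p.IsHomLift x.hom (πa x) := fun x => hZ.sectionProj_lift ha x
  have hπb : ∀ x : Over T, Z.p.IsHomLift (x.hom ≫ f) (πb x) :=
    fun x => hZ.sectionProj_lift hb ((repMap f).obj x)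
  have nπa : ∀ {x y : Over T} (g : x ⟶ y), s.map g ≫ πa y = πa x := fun g => hZ.sectionOf_map ha g
  have nπb : ∀ {x y : Over T} (g : x ⟶ y), s'.map g ≫ πb y = πb x :=
    fun g => hZ.sectionOf_map hb ((repMap f).map g)
  let t : rep T ⥤ᵇ prodCat Z Z := prodLift s s'
  obtain ⟨S, hS⟩ := h T t
  obtain ⟨⟨U, ⟨i, hi⟩, ⟨c, hc⟩, arr, arr_lift⟩, ⟨ht⟩⟩ := hS.exists_isTerminal
  change i.left = U at hi
  subst hi
  change Z.p.obj c = i.left at hc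
  let arr₁ : c ⟶ s.obj i := arr.fst
  let arr₂ : c ⟶ s'.obj i := arr.snd
  have l₁ : Z.p.IsHomLift (𝟙 i.left) arr₁ := prodCat_fst_lift arr_lift
  have l₂ : Z.p.IsHomLift (𝟙 i.left) arr₂ := prodCat_snd_lift arr_lift
  refine ⟨i.left, i.hom, c, arr₁ ≫ πa i, arr₂ ≫ πb i, lift_comp l₁ (hπa i),
    lift_comp l₂ (hπb i), ?_⟩
  intro V j c' α' β' hα' hβ'
  obtain rfl : Z.p.obj c' = V := IsHomLift.domain_eq Z.p j α'
  obtain ⟨a₁, ha₁, ea₁⟩ := hZ.exists_fill (hπa (Over.mk j)) hα' (𝟙 _) (Category.id_comp _)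
  obtain ⟨b₁, hb₁, eb₁⟩ := hZ.exists_fill (hπb (Over.mk j)) hβ' (𝟙 _) (Category.id_comp _)
  let arr' : (diag Z).obj c' ⟶ t.obj (Over.mk j) :=
    (⟨𝟙 _, a₁, b₁, ha₁, hb₁⟩ : ProdHom ((diag Z).obj c') (t.obj (Over.mk j)))
  let w : FiberProdObj t (diag Z) := ⟨Z.p.obj c', ⟨Over.mk j, rfl⟩, ⟨c', rfl⟩, arr',
    .map (p := (prodCat Z Z).p) arr'⟩
  let χ := ht.from w
  let χ₁ : Over.mk j ⟶ i := χ.fst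
  have comm₁ : a₁ ≫ s.map χ₁ = χ.snd ≫ arr₁ := congrArg ProdHom.fst χ.comm
  have comm₂ : b₁ ≫ s'.map χ₁ = χ.snd ≫ arr₂ := congrArg ProdHom.snd χ.comm
  refine ⟨χ.snd, ⟨?_, ?_⟩, ?_⟩
  · rw [← Category.assoc]
    exact (congrArg (· ≫ πa i) comm₁.symm).trans ((Category.assoc _ _ _).trans
      ((congrArg (a₁ ≫ ·) (nπa χ₁)).trans ea₁))
  · rw [← Category.assoc]
    exact (congrArg (· ≫ πb i) comm₂.symm).trans ((Category.assoc _ _ _).trans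
      ((congrArg (b₁ ≫ ·) (nπb χ₁)).trans eb₁))
  · rintro η ⟨e₁, e₂⟩
    obtain ⟨m, hm⟩ := exists_isHomLift rfl hc η
    have hmi : m ≫ i.hom = j := lift_unique (lift_comp hm (lift_comp l₁ (hπa i)
      (Category.id_comp _)) rfl) (e₁ ▸ hα')
    let m' : Over.mk j ⟶ i := Over.homMk m hmi
    have hm' : (rep T).p.IsHomLift m m' := .map (p := (rep T).p) m'
    have k₁ : a₁ ≫ s.map m' = η ≫ arr₁ := by
      refine hZ.ext (hπa i) (lift_comp ha₁ (rep_map_lift s m') (Category.id_comp m))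
        (lift_comp hm l₁ (Category.comp_id m)) ?_
      rw [Category.assoc, nπa, ea₁, Category.assoc, e₁]
    have k₂ : b₁ ≫ s'.map m' = η ≫ arr₂ := by
      refine hZ.ext (hπb i) (lift_comp hb₁ (rep_map_lift s' m') (Category.id_comp m))
        (lift_comp hm l₂ (Category.comp_id m)) ?_
      rw [Category.assoc, nπb, eb₁, Category.assoc, e₂]
    let ξ : w ⟶ ⟨i.left, ⟨i, rfl⟩, ⟨c, hc⟩, arr, arr_lift⟩ :=
      (⟨m, m', η, hm', hm, prodHom_ext k₁ k₂⟩ : FiberProdHom _ _)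
    exact congrArg FiberProdHom.snd (ht.hom_ext ξ χ)

/-- If the arrows between objects of `Z` are representable, then so is the diagonal of `Z`. -/
theorem isRepresentable_diag_of_hasIsom (hZ : IsFiberedInGroupoids Z)
    (h : ∀ (T : C) (a b : Z.obj), Z.p.obj a = T → Z.p.obj b = T → HasIsom Z (𝟙 T) a b) :
    IsRepresentable (diag Z) := by
  intro T t
  have hZZ := isFiberedInGroupoids_prodCat hZ hZ
  have hE := isFiberedInGroupoids_fiberProd hZZ (isFiberedInGroupoids_rep T) hZ t (diag Z)
  let t₀ := t.obj (Over.mk (𝟙 T))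
  have ht₀ : t₀.base = T := t.w_obj _
  obtain ⟨U, i, c, α, β, hα, hβ, hu⟩ := h T t₀.fst.obj t₀.snd.obj (t₀.fst.obj_eq.trans ht₀)
    (t₀.snd.obj_eq.trans ht₀)
  obtain rfl : Z.p.obj c = U := IsHomLift.domain_eq Z.p i α
  let π : ∀ x : Over T, t.obj x ⟶ t₀ := fun x => t.map (Over.homMk x.hom : x ⟶ Over.mk (𝟙 T))
  have hπ : ∀ x : Over T, (prodCat Z Z).p.IsHomLift x.hom (π x) := fun x =>
    rep_map_lift t (Over.homMk x.hom : x ⟶ Over.mk (𝟙 T))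
  have nπ : ∀ {x y : Over T} (g : x ⟶ y), t.map g ≫ π y = π x := fun g =>
    rep_map_comp t (Over.w g)
  let ζ : (diag Z).obj c ⟶ t₀ := (⟨i ≫ eqToHom ht₀.symm, α, β, lift_base_congr hα _,
    lift_base_congr (lift_congr hβ (Category.comp_id i)) _⟩ : ProdHom ((diag Z).obj c) t₀)
  have hζ : (prodCat Z Z).p.IsHomLift i ζ := by
    have := lift_base_congr (IsHomLift.map (p := (prodCat Z Z).p) ζ) ht₀
    refine lift_congr this ?_
    exact (Category.assoc _ _ _).trans (by
      rw [eqToHom_trans, eqToHom_refl]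
      exact Category.comp_id i)
  obtain ⟨arr, hr, er⟩ := hZZ.exists_fill (hπ (Over.mk i)) hζ (𝟙 _) (Category.id_comp _)
  let z : FiberProdObj t (diag Z) := ⟨Z.p.obj c, ⟨Over.mk i, rfl⟩, ⟨c, rfl⟩, arr, hr⟩
  have key : ∀ w : FiberProdObj t (diag Z), ∃ χ : w ⟶ z, ∀ χ' : w ⟶ z, χ' = χ := by
    rintro ⟨V, ⟨x, hx⟩, ⟨c', hc'⟩, arr', hr'⟩
    change x.left = V at hx
    subst hx
    change (diag Z).obj c' ⟶ t.obj x at arr'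
    have lx := lift_comp hr' (hπ x) (Category.id_comp _)
    obtain ⟨η, ⟨e₁, e₂⟩, uη⟩ := hu x.hom (c' := c') (arr' ≫ π x).fst (arr' ≫ π x).snd
      (prodCat_fst_lift lx) (lift_congr (prodCat_snd_lift lx) (Category.comp_id _).symm)
    obtain ⟨m, hm⟩ := exists_isHomLift hc' rfl η
    have hmi : m ≫ i = x.hom := lift_unique (lift_comp hm hα rfl) (e₁ ▸ prodCat_fst_lift lx)
    let m' : x ⟶ Over.mk i := Over.homMk m hmi
    have hm' : (rep T).p.IsHomLift m m' := .map (p := (rep T).p) m'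
    have comm : arr' ≫ t.map m' = (diag Z).map η ≫ arr := by
      refine hZZ.ext (hπ (Over.mk i)) (lift_comp hr' (rep_map_lift t m') (Category.id_comp m))
        (lift_comp ((diag Z).preserves_isHomLift m η) hr (Category.comp_id m)) ?_
      rw [Category.assoc, nπ, Category.assoc, er]
      exact prodHom_ext e₁.symm e₂.symm
    refine ⟨(⟨m, m', η, hm', hm, comm⟩ : FiberProdHom _ _), ?_⟩
    rintro ⟨f, g, ψ, hg, hψ, e⟩
    change x ⟶ Over.mk i at g
    have e' : (diag Z).map ψ ≫ ζ = arr' ≫ π x := by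
      rw [← er, ← Category.assoc]
      refine (congrArg (· ≫ π (Over.mk i)) e.symm).trans ((Category.assoc _ _ _).trans ?_)
      exact congrArg (arr' ≫ ·) (nπ g)
    obtain rfl : ψ = η := uη ψ ⟨congrArg ProdHom.fst e', congrArg ProdHom.snd e'⟩
    obtain rfl : f = m := lift_unique hψ hm
    obtain rfl : g = m' := Over.OverMorphism.ext (map_eq_of_lift (Z := rep T) hg)
    rfl
  choose χ hχ using key
  exact ⟨_, hE.areEquivalent_rep (z := z) (Limits.IsTerminal.ofUniqueHom χ fun w => hχ w)⟩

end Diagonal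

/-! ### Spaces of arrows of the transformation prestack -/

section TransformationArrows

variable {C : Type u₁} [Category.{v₁} C] {G : Cᵒᵖ ⥤ GrpCat.{r}} {X : BasedCategory.{v₂, u₂} C}

/-- The presheaf that sends `V` to the pairs of a section of `G` over `V` and an arrow `V ⟶ T` is
representable for every `T`. -/
def HasGrpProducts (G : Cᵒᵖ ⥤ GrpCat.{r}) : Prop :=
  ∀ T : C, ∃ (Q : C) (π : Q ⟶ T) (g : G.obj (op Q)), ∀ {V : C} (j : V ⟶ T) (k : G.obj (op V)),
    ∃! m : V ⟶ Q, m ≫ π = j ∧ G.map m.op g = k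

namespace GroupAction

variable (A : GroupAction G X)

/-- An arrow of the transformation prestack that becomes an arrow of `X` after composition with an
arrow of `X` comes from `X`, since its section of `G` is trivial. -/
theorem exists_ofHom_of_comp_eq {S T U : C} {w : Fib X S} {c : Fib X T} {x : Fib X U} {n : S ⟶ T}
    {η : (⟨w.obj⟩ : A.TransObj) ⟶ ⟨c.obj⟩} (hη : A.transCat.p.IsHomLift n η) {f : T ⟶ U} {j : S ⟶ U}
    {ρ : c.obj ⟶ x.obj} (hρ : X.p.IsHomLift f ρ) {δ : w.obj ⟶ x.obj} (hδ : X.p.IsHomLift j δ)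
    (e : η ≫ TransHom.ofHom A ρ = TransHom.ofHom A δ) :
    ∃ δ' : w.obj ⟶ c.obj, X.p.IsHomLift n δ' ∧ η = TransHom.ofHom A δ' ∧ δ' ≫ ρ = δ := by
  obtain ⟨k, ε, hε, rfl⟩ := A.exists_homOf w c hη
  rw [A.homOf_comp_ofHom hε hρ, A.ofHom_eq_homOf hδ] at e
  obtain rfl : k = 1 := A.grp_eq_of_homOf_eq e
  have e' := A.arr_eq_of_homOf_eq e
  have l : X.p.IsHomLift n ((A.unitor w).hom ≫ ε) :=
    lift_comp (A.unitor_lift w) hε (Category.id_comp n)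
  refine ⟨(A.unitor w).hom ≫ ε, l, ?_, ?_⟩
  · rw [A.ofHom_eq_homOf l]
    exact A.homOf_congr rfl rfl (by simp)
  · rw [Category.assoc, e', Iso.hom_inv_id_assoc]

/-- The arrows between objects of the transformation prestack are represented: to give arrows
from `w` to `x` and to `y` is, up to replacing `w` by an isomorphic object `k · w`, to give an arrow
`w ⟶ x`, a section `g` of `G` and an arrow `g · w ⟶ y`. -/
theorem hasIsom_transCat (hX : IsFiberedInGroupoids X) (hG : HasGrpProducts G)
    (h : ∀ {T T' : C} (f : T ⟶ T') (a b : X.obj), X.p.obj a = T → X.p.obj b = T' →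
      HasIsom X f a b) {T T' : C} (f : T ⟶ T') (x : Fib X T) (y : Fib X T') :
    HasIsom A.transCat f ⟨x.obj⟩ ⟨y.obj⟩ := by
  have hA := A.isFiberedInGroupoids_transCat hX
  obtain ⟨Q, r, g, hQ⟩ := hG T
  obtain ⟨xQ, π, hπ⟩ := hX.exists_lift x.obj_eq r
  let xQ' : Fib X Q := ⟨xQ, IsHomLift.domain_eq X.p r π⟩
  obtain ⟨U, i, c, α, β, hα, hβ, hu⟩ := h (r ≫ f) (act A.μ g xQ').obj y.obj
    (act A.μ g xQ').obj_eq y.obj_eq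
  obtain ⟨xc, ρ, hρ⟩ := hX.exists_lift xQ'.obj_eq i
  let xc' : Fib X U := ⟨xc, IsHomLift.domain_eq X.p i ρ⟩
  have hθ := actMap_lift A.μ (x := xc') (y := xQ') i (rfl : G.map i.op g = G.map i.op g) ρ hρ
  obtain ⟨ι, hι, eι⟩ := hX.exists_fill hα hθ (𝟙 U) (Category.id_comp i)
  have hB : X.p.IsHomLift (i ≫ r ≫ f) (ι ≫ β) := lift_comp hι hβ (Category.id_comp _)
  have hρπ : X.p.IsHomLift (i ≫ r) (ρ ≫ π) := lift_comp hρ hπ rfl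
  -- The universal property for those pairs of arrows whose first member comes from `X`.
  have key : ∀ {V : C} {j : V ⟶ T} (w : Fib X V) (δ : w.obj ⟶ x.obj) (_ : X.p.IsHomLift j δ)
      (B : (⟨w.obj⟩ : A.TransObj) ⟶ ⟨y.obj⟩) (_ : A.transCat.p.IsHomLift (j ≫ f) B),
      ∃! η : (⟨w.obj⟩ : A.TransObj) ⟶ ⟨xc⟩, η ≫ TransHom.ofHom A (ρ ≫ π) = TransHom.ofHom A δ ∧
        η ≫ A.homOf xc' y (i ≫ r ≫ f) (G.map i.op g) (ι ≫ β) hB = B := by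
    intro V j w δ hδ B hB'
    obtain ⟨k, ε, hε, rfl⟩ := A.exists_homOf w y hB'
    obtain ⟨m, ⟨hm, hmk⟩, um⟩ := hQ j k
    obtain ⟨δ₁, hδ₁, eδ₁⟩ := hX.exists_fill hπ hδ m hm
    obtain ⟨ξ, ⟨e₁, e₂⟩, uξ⟩ := hu m (actMap A.μ (x := w) (y := xQ') m hmk δ₁ hδ₁) ε
      (actMap_lift _ _ _ _ _) (lift_congr hε (by rw [← hm, Category.assoc]))
    obtain ⟨n, hn⟩ := exists_isHomLift (act A.μ k w).obj_eq (IsHomLift.domain_eq X.p i α) ξ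
    have hni : n ≫ i = m := lift_unique (lift_comp hn hα rfl)
      (e₁ ▸ actMap_lift A.μ (x := w) (y := xQ') m hmk δ₁ hδ₁)
    obtain ⟨δ₂, hδ₂, eδ₂⟩ := hX.exists_fill hρ hδ₁ n hni
    have grp : ∀ {n' : V ⟶ U}, n' ≫ i = m → G.map n'.op (G.map i.op g) = k := by
      intro n' h'
      rw [← hmk, ← h']
      simp
    -- An arrow `ψ : w ⟶ xc` over `δ₁` induces an arrow `k · w ⟶ c`, by the action.
    have comp : ∀ {n' : V ⟶ U} (h' : n' ≫ i = m) (ψ : w.obj ⟶ xc) (hψ : X.p.IsHomLift n' ψ)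
        (_ : ψ ≫ ρ = δ₁), (actMap A.μ (x := w) (y := xc') n' (grp h') ψ hψ ≫ ι) ≫ α =
          actMap A.μ (x := w) (y := xQ') m hmk δ₁ hδ₁ := by
      intro n' h' ψ hψ e
      rw [Category.assoc, eι, actMap_comp]
      exact congrArg A.μ.map (GrpProdHom.ext h' e)
    have hξ : actMap A.μ (x := w) (y := xc') n (grp hni) δ₂ hδ₂ ≫ ι = ξ :=
      hX.ext hα (lift_comp (actMap_lift _ _ _ _ _) hι (Category.comp_id n)) hn
        ((comp hni δ₂ hδ₂ eδ₂).trans e₁.symm)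
    refine ⟨TransHom.ofHom A δ₂, ⟨?_, ?_⟩, ?_⟩
    · rw [ofHom_comp_ofHom, ← Category.assoc, eδ₂, eδ₁]
    · rw [A.ofHom_comp_homOf (x := w) (y := xc') hδ₂ hB (grp hni)]
      refine A.homOf_congr (by rw [← hm, ← hni]; simp only [Category.assoc]) rfl ?_
      rw [← Category.assoc, hξ, e₂, eqToHom_refl, Category.id_comp]
    · rintro η ⟨e₃, e₄⟩
      obtain ⟨n', hn'⟩ := exists_isHomLift (Z := A.transCat) w.obj_eq xc'.obj_eq η
      obtain ⟨ψ, hψ, rfl, eψ⟩ :=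
        A.exists_ofHom_of_comp_eq (w := w) (c := xc') (x := x) hn' hρπ hδ e₃
      have e₅ := (A.ofHom_comp_homOf (x := w) (y := xc') hψ hB rfl).symm.trans e₄
      have hk := A.grp_eq_of_homOf_eq e₅
      have hn'i : n' ≫ i = m := um _ ⟨by
        rw [Category.assoc]
        exact lift_unique (lift_comp hψ hρπ rfl) (eψ ▸ hδ), by rw [← hk]; simp⟩
      have eψ' : ψ ≫ ρ = δ₁ := hX.ext hπ (lift_comp hψ hρ hn'i) hδ₁
        ((Category.assoc _ _ _).trans (eψ.trans eδ₁.symm))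
      have e₆ := A.arr_eq_of_homOf_eq
        ((A.ofHom_comp_homOf (x := w) (y := xc') hψ hB (grp hn'i)).symm.trans e₄)
      have hξ' := uξ _ ⟨comp hn'i ψ hψ eψ', (Category.assoc _ _ _).trans e₆⟩
      have hn'' : n' = n := lift_unique (lift_comp (actMap_lift A.μ (x := w) (y := xc') n'
        (grp hn'i) ψ hψ) hι (Category.comp_id n')) (hξ' ▸ hn)
      subst hn''
      obtain rfl : ψ = δ₂ := hX.ext hρ hψ hδ₂ (eψ'.trans eδ₂.symm)
      rfl
  refine ⟨U, i ≫ r, ⟨xc⟩, TransHom.ofHom A (ρ ≫ π), A.homOf xc' y (i ≫ r ≫ f) (G.map i.op g)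
    (ι ≫ β) hB, A.ofHom_lift hρπ, lift_congr (A.homOf_lift _ _ _ _) (Category.assoc _ _ _).symm, ?_⟩
  -- A general pair of arrows is of this form after replacing `w` by `k · w`.
  rintro V j ⟨w⟩ a b ha hb
  let w' : Fib X V := ⟨w, IsHomLift.domain_eq A.transCat.p j a⟩
  obtain ⟨k, δ, hδ, ea⟩ := A.exists_homOf w' x ha
  have he := A.homOf_lift (x := w') (y := act A.μ k w') (𝟙 V) k (𝟙 _)
    (IsHomLift.id (act A.μ k w').obj_eq)
  have hi := hA.isIso _ _ _ _ he
  have ea' := ea.trans (A.homOf_id_comp_ofHom (x := w') (y := x) k hδ).symm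
  set e := A.homOf w' (act A.μ k w') (𝟙 V) k (𝟙 _) (IsHomLift.id (act A.μ k w').obj_eq)
  have hinv : A.transCat.p.IsHomLift (𝟙 V) (inv e) := IsHomLift.lift_id_inv_isIso A.transCat.p V e
  obtain ⟨η, ⟨h₁, h₂⟩, u⟩ := key (act A.μ k w') δ hδ (inv e ≫ b)
    (lift_comp hinv hb (Category.id_comp _))
  refine ⟨e ≫ η, ⟨?_, ?_⟩, ?_⟩
  · rw [Category.assoc, h₁, ea']
  · rw [Category.assoc, h₂, IsIso.hom_inv_id_assoc]
  · rintro η' ⟨h₃, h₄⟩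
    rw [← u (inv e ≫ η') ⟨?_, ?_⟩, IsIso.hom_inv_id_assoc]
    · rw [Category.assoc, h₃, ea', IsIso.inv_hom_id_assoc]
    · rw [Category.assoc, h₄]

end GroupAction

end TransformationArrows

/-! ### Sheaves of arrows -/

section IsomSheaf

variable {C : Type u₁} [Category.{v₁} C] {J : GrothendieckTopology C}
  {Z : BasedCategory.{v₂, u₂} C}

/-- An arrow `s(i) ⟶ b` over `i ≫ f`, for some `i : W ⟶ T`, where `s` is an object over `T` and `b`
is an object over `T'`: a section over `W` of the sheaf of arrows from `s` to `b`. -/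
structure IsomSec {T T' : C} (s : rep T ⥤ᵇ Z) (f : T ⟶ T') (b : Z.obj) (W : C) where
  base : W ⟶ T
  arr : s.obj (Over.mk base) ⟶ b
  lift : Z.p.IsHomLift (base ≫ f) arr

namespace IsomSec

variable {T T' : C} {s : rep T ⥤ᵇ Z} {f : T ⟶ T'} {b : Z.obj}

/-- The restriction of a section along `g`, as an arrow. -/
def restr {W : C} (ξ : IsomSec s f b W) {V : C} (g : V ⟶ W) (i : V ⟶ T) (w : g ≫ ξ.base = i) :
    s.obj (Over.mk i) ⟶ b :=
  s.map (Over.homMk g w : Over.mk i ⟶ Over.mk ξ.base) ≫ ξ.arr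

theorem restr_lift {W : C} (ξ : IsomSec s f b W) {V : C} (g : V ⟶ W) (i : V ⟶ T)
    (w : g ≫ ξ.base = i) : Z.p.IsHomLift (i ≫ f) (ξ.restr g i w) :=
  have h : g ≫ ξ.base ≫ f = i ≫ f := by rw [← w, Category.assoc]
  lift_comp (rep_map_lift s (Over.homMk g w : Over.mk i ⟶ Over.mk ξ.base)) ξ.lift h

theorem restr_id {W : C} (ξ : IsomSec s f b W) :
    ξ.restr (𝟙 W) ξ.base (Category.id_comp _) = ξ.arr := by
  have : (Over.homMk (𝟙 W) (Category.id_comp _) : Over.mk ξ.base ⟶ Over.mk ξ.base) = 𝟙 _ := rfl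
  rw [restr, this, s.map_id, Category.id_comp]

theorem map_restr {W : C} (ξ : IsomSec s f b W) {V V' : C} (g : V ⟶ W) (i : V ⟶ T)
    (w : g ≫ ξ.base = i) (g' : V' ⟶ V) (i' : V' ⟶ T) (w' : g' ≫ i = i') :
    s.map (Over.homMk g' w' : Over.mk i' ⟶ Over.mk i) ≫ ξ.restr g i w =
      ξ.restr (g' ≫ g) i' (by rw [Category.assoc, w, w']) :=
  (Category.assoc _ _ _).symm.trans (congrArg (· ≫ ξ.arr) (rep_map_comp s rfl))

theorem ext_restr {W : C} {ξ ζ : IsomSec s f b W} (h : ξ.base = ζ.base)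
    (e : ξ.restr (𝟙 W) ζ.base ((Category.id_comp _).trans h) =
      ζ.restr (𝟙 W) ζ.base (Category.id_comp _)) : ξ = ζ := by
  obtain ⟨i, α, hα⟩ := ξ
  obtain ⟨i', α', hα'⟩ := ζ
  obtain rfl : i = i' := h
  obtain rfl : α = α' := by
    have h₁ := restr_id ⟨i, α, hα⟩
    have h₂ := restr_id ⟨i, α', hα'⟩
    exact h₁.symm.trans (e.trans h₂)
  rfl

/-- The restriction of a section along `g`. -/
abbrev res {W : C} (ξ : IsomSec s f b W) {V : C} (g : V ⟶ W) : IsomSec s f b V :=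
  ⟨g ≫ ξ.base, ξ.restr g _ rfl, ξ.restr_lift _ _ _⟩

theorem restr_res {W : C} (ξ : IsomSec s f b W) {V V' : C} (g : V ⟶ W) (g' : V' ⟶ V) (i : V' ⟶ T)
    (w : g' ≫ g ≫ ξ.base = i) :
    (ξ.res g).restr g' i w = ξ.restr (g' ≫ g) i ((Category.assoc _ _ _).trans w) :=
  ξ.map_restr g _ rfl g' i w

theorem restr_congr {W : C} (ξ : IsomSec s f b W) {V : C} {g g' : V ⟶ W} (h : g = g') (i : V ⟶ T)
    (w : g ≫ ξ.base = i) : ξ.restr g i w = ξ.restr g' i (h ▸ w) := by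
  subst h; rfl

theorem restr_eq_of_eq {W : C} {ξ ζ : IsomSec s f b W} (h : ξ = ζ) {V : C} (g : V ⟶ W) (i : V ⟶ T)
    (w : g ≫ ξ.base = i) (w' : g ≫ ζ.base = i) : ξ.restr g i w = ζ.restr g i w' := by
  subst h; rfl

variable (s f b)

/-- The presheaf of arrows from `s` to `b`. -/
def presheaf : Cᵒᵖ ⥤ Type max v₁ v₂ where
  obj W := IsomSec s f b W.unop
  map g := TypeCat.ofHom fun ξ => ξ.res g.unop
  map_id W := by
    ext ξ
    change ξ.res (𝟙 _) = ξ
    refine ext_restr (Category.id_comp _) ?_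
    rw [restr_res]
    exact ξ.restr_congr (Category.id_comp _) _ _
  map_comp g g' := by
    ext ξ
    change ξ.res (g'.unop ≫ g.unop) = (ξ.res g.unop).res g'.unop
    refine ext_restr (Category.assoc _ _ _) ?_
    rw [restr_res, restr_res, restr_res]
    exact ξ.restr_congr (Category.assoc _ _ _).symm _ _

variable {s f b}

/-- The presheaf of arrows of a prestack is a sheaf: the base arrows glue because `T` represents
a sheaf, and the arrows over them because `Z` is a prestack. -/
theorem isSheaf_presheaf (hg : IsFiberedInGroupoids Z) (hp : IsPrestack J Z)
    (hT : Presieve.IsSheaf J (yoneda.obj T)) (hb : Z.p.obj b = T') :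
    Presieve.IsSheaf J (presheaf s f b) := by
  intro W R hR x' hx'
  let x : ∀ ⦃U : C⦄ (k : U ⟶ W), R k → IsomSec s f b U := fun U k hk => x' k hk
  have hx : ∀ {U V : C} (k : U ⟶ W) (g : V ⟶ U) (hk : R k) (k' : V ⟶ W) (hk' : R k')
      (_ : g ≫ k = k'), x k' hk' = (x k hk).res g := by
    intro U V k g hk k' hk' e
    subst e
    exact (Presieve.compatible_iff_sieveCompatible (P := presheaf s f b) x').1 hx' k g hk
  obtain ⟨i, hi, ui⟩ := hT R hR (fun U k hk => (x k hk).base)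
    ((Presieve.compatible_iff_sieveCompatible (P := yoneda.obj T) _).2
      fun U V k g hk => congrArg IsomSec.base (hx k g hk _ _ rfl))
  have hi' : ∀ {U : C} (k : U ⟶ W) (hk : R k), k ≫ i = (x k hk).base := fun k hk => hi k hk
  obtain ⟨ψ, ⟨hψ, eψ⟩, uψ⟩ := hp (i ≫ f) (s.obj (Over.mk i)) b (s.w_obj _) hb R hR
    (sectionLiftSystem s (Over.mk i) R)
    (fun U k hk => (x k hk).restr (𝟙 U) (k ≫ i) ((Category.id_comp _).trans (hi' k hk).symm))
    (fun k hk => lift_congr ((x k hk).restr_lift _ _ _) (Category.assoc _ _ _)) (by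
      intro V U k hk k' hk' g w η hη e
      let g' : Over.mk (k' ≫ i) ⟶ Over.mk (k ≫ i) := Over.homMk g (by
        rw [← w]
        exact (Category.assoc _ _ _).symm)
      obtain rfl : η = s.map g' :=
        hg.ext (restrHom_lift s (Over.mk i) k) hη (rep_map_lift s g')
          (e.trans (rep_map_comp s w).symm)
      refine ((x k hk).map_restr _ _ _ _ _ _).trans ?_
      refine Eq.trans ?_ (restr_eq_of_eq (hx k g hk k' hk' w) (𝟙 V) (k' ≫ i)
        ((Category.id_comp _).trans (hi' k' hk').symm)
        ((Category.id_comp _).trans ((congrArg IsomSec.base (hx k g hk k' hk' w)).symm.trans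
          (hi' k' hk').symm))).symm
      rw [restr_res]
      exact (x k hk).restr_congr (by rw [Category.comp_id, Category.id_comp]) _ _)
  refine ⟨(⟨i, ψ, hψ⟩ : IsomSec s f b W), fun U k hk => ?_, ?_⟩
  · change (⟨i, ψ, hψ⟩ : IsomSec s f b W).res k = x k hk
    refine (ext_restr (ζ := (⟨i, ψ, hψ⟩ : IsomSec s f b W).res k) (hi' k hk).symm ?_).symm
    rw [restr_res]
    exact (eψ k hk).symm.trans
      ((⟨i, ψ, hψ⟩ : IsomSec s f b W).restr_congr (Category.id_comp k).symm (k ≫ i) rfl)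
  · intro ζ' hζ'
    let ζ : IsomSec s f b W := ζ'
    have hζ : ∀ {U : C} (k : U ⟶ W) (hk : R k), ζ.res k = x k hk := fun k hk => hζ' k hk
    have e : ζ.base = i := ui ζ.base fun U k hk => congrArg IsomSec.base (hζ k hk)
    change ζ = ⟨i, ψ, hψ⟩
    subst e
    refine ext_restr (ζ := ⟨ζ.base, ψ, hψ⟩) rfl
      (ζ.restr_id.trans (Eq.trans ?_ (restr_id ⟨ζ.base, ψ, hψ⟩).symm))
    refine uψ ζ.arr ⟨ζ.lift, fun {U} k hk => ?_⟩
    refine Eq.trans ?_ (restr_eq_of_eq (hζ k hk) (𝟙 U) (k ≫ ζ.base) (Category.id_comp _) _)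
    rw [restr_res]
    exact (ζ.restr_congr (Category.id_comp k) _ _).symm

/-- A universal arrow from pullbacks of `a` to `b` represents the arrows from `a` to `b`. -/
theorem hasIsom_of_universal (hg : IsFiberedInGroupoids Z) {a : Z.obj} (ha : Z.p.obj a = T)
    {S : C} (ξ : IsomSec (hg.sectionOf ha) f b S)
    (hξ : ∀ {V : C} (ζ : IsomSec (hg.sectionOf ha) f b V), ∃! m : V ⟶ S, ξ.res m = ζ) :
    HasIsom Z f a b := by
  let s := hg.sectionOf ha
  let π : ∀ x : Over T, s.obj x ⟶ a := fun x => hg.sectionProj ha x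
  have hπ : ∀ x : Over T, Z.p.IsHomLift x.hom (π x) := fun x => hg.sectionProj_lift ha x
  have nπ : ∀ {x y : Over T} (g : x ⟶ y), s.map g ≫ π y = π x := fun g => hg.sectionOf_map ha g
  refine ⟨S, ξ.base, s.obj (Over.mk ξ.base), π _, ξ.arr, hπ (Over.mk ξ.base), ξ.lift, ?_⟩
  intro V j c' α' β' hα' hβ'
  obtain ⟨e, he, ee⟩ := hg.exists_fill hα' (hπ (Over.mk j)) (𝟙 V) (Category.id_comp _)
  have := hg.isIso _ _ _ _ he
  have hc' : Z.p.obj c' = V := IsHomLift.domain_eq Z.p j α'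
  let ζ : IsomSec s f b V := ⟨j, e ≫ β', lift_comp he hβ' (Category.id_comp _)⟩
  -- An arrow `c' ⟶ s(ξ)` over `m` corresponds to the restriction of `ξ` along `m`.
  have key : ∀ (m : V ⟶ S) (hm : m ≫ ξ.base = j) (η : c' ⟶ s.obj (Over.mk ξ.base)),
      Z.p.IsHomLift m η → η ≫ π (Over.mk ξ.base) = α' → (e ≫ η ≫ ξ.arr = ξ.restr m j hm) := by
    intro m hm η hη eη
    have h : e ≫ η = s.map (Over.homMk m hm : Over.mk j ⟶ Over.mk ξ.base) := by
      refine hg.ext (hπ (Over.mk ξ.base)) (lift_comp he hη (Category.id_comp m))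
        (rep_map_lift s (Over.homMk m hm : Over.mk j ⟶ Over.mk ξ.base)) ?_
      rw [Category.assoc, eη, ee, nπ]
    rw [← Category.assoc, h]
    rfl
  obtain ⟨m, hm, um⟩ := hξ ζ
  have hmj : m ≫ ξ.base = j := congrArg base hm
  obtain ⟨η, hη, eη⟩ := hg.exists_fill (hπ (Over.mk ξ.base)) hα' m hmj
  have hmr : ξ.restr m j hmj = e ≫ β' := by
    have h := restr_eq_of_eq hm (𝟙 V) j ((Category.id_comp _).trans hmj) (Category.id_comp _)
    rw [restr_res] at h
    exact (ξ.restr_congr (Category.id_comp m).symm _ _).trans (h.trans ζ.restr_id)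
  refine ⟨η, ⟨eη, ?_⟩, ?_⟩
  · rw [← cancel_epi e, key m hmj η hη eη, hmr]
  · rintro η' ⟨e₁, e₂⟩
    obtain ⟨m', hm'⟩ := exists_isHomLift hc' (s.w_obj (Over.mk ξ.base)) η'
    change V ⟶ S at m'
    have hm'j : m' ≫ ξ.base = j := lift_unique (lift_comp hm' (hπ (Over.mk ξ.base)) rfl) (e₁ ▸ hα')
    obtain rfl : m' = m := by
      refine um m' (ext_restr (ζ := ζ) hm'j ?_)
      rw [restr_res]
      refine (ξ.restr_congr (Category.id_comp m') _ _).trans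
        ((key m' hm'j η' hm' e₁).symm.trans (Eq.trans ?_ ζ.restr_id.symm))
      rw [e₂]
    exact hg.ext (hπ (Over.mk ξ.base)) hm' hη (e₁.trans eη.symm)

/-- If the arrows from a pullback `a'` of `a` along `k` to `b` are represented, then there is a
universal arrow to `b` from pullbacks of `a` along arrows that factor through `k`. -/
theorem exists_universal_of_hasIsom (hg : IsFiberedInGroupoids Z) {a a' : Z.obj}
    (ha : Z.p.obj a = T) {U : C} {k : U ⟶ T} {κ : a' ⟶ a} (hκ : Z.p.IsHomLift k κ)
    (h : HasIsom Z (k ≫ f) a' b) :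
    ∃ (S : C) (i : S ⟶ U) (ξ : IsomSec (hg.sectionOf ha) f b S), ξ.base = i ≫ k ∧
      ∀ {V : C} (j : V ⟶ U) (ζ : IsomSec (hg.sectionOf ha) f b V), ζ.base = j ≫ k →
        ∃! m : V ⟶ S, m ≫ i = j ∧ ξ.res m = ζ := by
  obtain ⟨S, i, c, α, β, hα, hβ, hu⟩ := h
  let s := hg.sectionOf ha
  let π : ∀ x : Over T, s.obj x ⟶ a := fun x => hg.sectionProj ha x
  have hπ : ∀ x : Over T, Z.p.IsHomLift x.hom (π x) := fun x => hg.sectionProj_lift ha x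
  have nπ : ∀ {x y : Over T} (g : x ⟶ y), s.map g ≫ π y = π x := fun g => hg.sectionOf_map ha g
  have hακ : Z.p.IsHomLift (i ≫ k) (α ≫ κ) := lift_comp hα hκ rfl
  obtain ⟨e, he, ee⟩ := hg.exists_fill hακ (hπ (Over.mk (i ≫ k))) (𝟙 S) (Category.id_comp _)
  let ξ : IsomSec s f b S := ⟨i ≫ k, e ≫ β, lift_comp he hβ (by
    rw [Category.id_comp, Category.assoc])⟩
  refine ⟨S, i, ξ, rfl, ?_⟩
  intro V j ζ hζ
  obtain ⟨α', hα', eα'⟩ := hg.exists_fill hκ (hπ (Over.mk ζ.base)) j hζ.symm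
  obtain ⟨η, ⟨e₁, e₂⟩, uη⟩ := hu j α' ζ.arr hα' (lift_congr ζ.lift (by
    rw [hζ, Category.assoc]))
  have key : ∀ (m : V ⟶ S) (hm : m ≫ i = j) (hm' : m ≫ i ≫ k = ζ.base),
      (s.map (Over.homMk m hm' : Over.mk ζ.base ⟶ Over.mk (i ≫ k)) ≫ e) ≫ α = α' := by
    intro m hm hm'
    have l := rep_map_lift s (Over.homMk m hm' : Over.mk ζ.base ⟶ Over.mk (i ≫ k))
    refine hg.ext hκ (lift_comp (lift_comp l he (Category.comp_id m)) hα hm) hα' ?_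
    rw [eα', Category.assoc, Category.assoc, ee, nπ]
  obtain ⟨m, hm⟩ := exists_isHomLift (s.w_obj (Over.mk ζ.base)) (IsHomLift.domain_eq Z.p i α) η
  change V ⟶ S at m
  have hmi : m ≫ i = j := lift_unique (lift_comp hm hα rfl) (e₁ ▸ hα')
  have hmz : ∀ {m : V ⟶ S}, m ≫ i = j → m ≫ i ≫ k = ζ.base := fun h => by
    rw [hζ, ← h, Category.assoc]
  refine ⟨m, ⟨hmi, ?_⟩, ?_⟩
  · refine ext_restr (hmz hmi) ?_
    rw [restr_res]
    refine (ξ.restr_congr (Category.id_comp m) _ _).trans (Eq.trans ?_ ζ.restr_id.symm)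
    have l := rep_map_lift s (Over.homMk m (hmz hmi) : Over.mk ζ.base ⟶ Over.mk (i ≫ k))
    have h : s.map (Over.homMk m (hmz hmi) : Over.mk ζ.base ⟶ Over.mk (i ≫ k)) ≫ e = η :=
      hg.ext hα (lift_comp l he (Category.comp_id m)) hm ((key m hmi (hmz hmi)).trans e₁.symm)
    exact (Category.assoc _ _ _).symm.trans ((congrArg (· ≫ β) h).trans e₂)
  · rintro m' ⟨h₁, h₂⟩
    have l := rep_map_lift s (Over.homMk m' (hmz h₁) : Over.mk ζ.base ⟶ Over.mk (i ≫ k))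
    have h := restr_eq_of_eq h₂ (𝟙 V) ζ.base ((Category.id_comp _).trans (hmz h₁))
      (Category.id_comp _)
    rw [restr_res, restr_id] at h
    have h₃ := uη _ ⟨key m' h₁ (hmz h₁), (Category.assoc _ _ _).trans
      ((ξ.restr_congr (Category.id_comp m').symm _ _).trans h)⟩
    exact lift_unique (lift_comp l he (Category.comp_id m')) (h₃ ▸ hm)

end IsomSec

end IsomSheaf

section Functoriality

variable {C : Type u₁} [Category.{v₁} C] {Z : BasedCategory.{v₂, u₂} C}

/-- The space of arrows from `a` to `b` over `f` also represents the arrows from `a` over `f ≫ g`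
to every `b'` that receives an arrow from `b` over `g`. -/
theorem HasIsom.comp (hg : IsFiberedInGroupoids Z) {T T' T'' : C} {f : T ⟶ T'} {a b b' : Z.obj}
    (h : HasIsom Z f a b) {g : T' ⟶ T''} {κ : b ⟶ b'} (hκ : Z.p.IsHomLift g κ) :
    HasIsom Z (f ≫ g) a b' := by
  obtain ⟨U, i, c, α, β, hα, hβ, hu⟩ := h
  refine ⟨U, i, c, α, β ≫ κ, hα, lift_comp hβ hκ (Category.assoc _ _ _), ?_⟩
  intro V j c' α' β' hα' hβ'
  obtain ⟨γ, hγ, eγ⟩ := hg.exists_fill hκ hβ' (j ≫ f) (Category.assoc _ _ _)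
  obtain ⟨η, ⟨e₁, e₂⟩, uη⟩ := hu j α' γ hα' hγ
  refine ⟨η, ⟨e₁, by rw [← Category.assoc, e₂, eγ]⟩, ?_⟩
  rintro η' ⟨e₃, e₄⟩
  have hc' : Z.p.obj c' = V := IsHomLift.domain_eq Z.p j α'
  obtain ⟨m, hm⟩ := exists_isHomLift hc' (IsHomLift.domain_eq Z.p i α) η'
  have hmj : m ≫ i = j := lift_unique (lift_comp hm hα rfl) (e₃ ▸ hα')
  refine uη η' ⟨e₃, hg.ext hκ (lift_comp hm hβ (by rw [← hmj, Category.assoc])) hγ ?_⟩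
  rw [Category.assoc, e₄, eγ]

/-- A fully faithful morphism preserves the spaces of arrows. -/
theorem HasIsom.map {Y : BasedCategory.{v₃, u₃} C} (hY : IsFiberedInGroupoids Y)
    (hZ : IsFiberedInGroupoids Z) (q : Y ⥤ᵇ Z) (hf : q.Full) (hf' : q.Faithful) {T T' : C}
    {f : T ⟶ T'} {y y' : Y.obj} (h : HasIsom Y f y y') : HasIsom Z f (q.obj y) (q.obj y') := by
  obtain ⟨U, i, c, α, β, hα, hβ, hu⟩ := h
  refine ⟨U, i, q.obj c, q.map α, q.map β, q.preserves_isHomLift _ _, q.preserves_isHomLift _ _, ?_⟩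
  intro V j c' α' β' hα' hβ'
  obtain ⟨d, γ, hγ⟩ := hY.exists_lift (IsHomLift.codomain_eq Y.p i α) j
  obtain ⟨e, he, ee⟩ := hZ.exists_fill hα' (q.preserves_isHomLift j γ) (𝟙 V) (Category.id_comp _)
  have := hZ.isIso _ _ _ _ he
  obtain ⟨δ, hδ⟩ := q.map_surjective (e ≫ β')
  have lδ : Y.p.IsHomLift (j ≫ f) δ := by
    have : Z.p.IsHomLift (j ≫ f) (q.map δ) := hδ ▸ lift_comp he hβ' (Category.id_comp _)
    exact q.isHomLift_map _ δ
  obtain ⟨η, ⟨e₁, e₂⟩, uη⟩ := hu j γ δ hγ lδ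
  refine ⟨inv e ≫ q.map η, ⟨?_, ?_⟩, ?_⟩
  · rw [Category.assoc, ← q.map_comp, e₁, IsIso.inv_comp_eq, ee]
  · rw [Category.assoc, ← q.map_comp, e₂, IsIso.inv_comp_eq, hδ]
  · rintro η' ⟨e₃, e₄⟩
    obtain ⟨ψ, hψ⟩ := q.map_surjective (e ≫ η')
    rw [IsIso.eq_inv_comp, ← hψ, uη ψ ⟨q.map_injective ?_, q.map_injective ?_⟩]
    · rw [q.map_comp, hψ, Category.assoc, e₃, ee]
    · rw [q.map_comp, hψ, Category.assoc, e₄, hδ]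

end Functoriality

/-! ### Convenient categories of topological spaces -/

section Convenient

variable {P : ObjectProperty TopCat.{u}}

/-- The two closure properties that the category of all spaces and the category of compactly
generated spaces have in common: an open subspace of a space of the category belongs to the
category, and so does a space whose topology is final with respect to all continuous maps from
spaces of the category. -/
structure IsConvenient (P : ObjectProperty TopCat.{u}) : Prop where
  of_isOpen : ∀ (T : P.FullSubcategory) (O : Set T.obj), IsOpen O → P (TopCat.of O)
  of_final : ∀ X : TopCat.{u}, (∀ s : Set X, (∀ (A : P.FullSubcategory) (f : A.obj → X),
    Continuous f → IsOpen (f ⁻¹' s)) → IsOpen s) → P X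

theorem isConvenient_top : IsConvenient (⊤ : ObjectProperty TopCat.{u}) :=
  ⟨fun _ _ _ => trivial, fun _ _ => trivial⟩

/-- For open subspaces, compact Hausdorff test spaces have to be cut down to compact neighborhoods
of their points. -/
theorem isConvenient_compactlyGenerated : IsConvenient compactlyGenerated.{u} where
  of_isOpen T O hO := by
    have hT : CompactlyGeneratedSpace T.obj := T.property
    refine compactlyGeneratedSpace_of_isOpen fun s hs => ?_
    refine hO.isOpenEmbedding_subtypeVal.isOpen_iff_image_isOpen.2 ?_
    refine CompactlyGeneratedSpace.isOpen' fun K _ _ _ f hf => isOpen_iff_mem_nhds.2 fun k hk => ?_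
    have hkO : k ∈ f ⁻¹' O := by
      obtain ⟨x, _, e⟩ := hk
      exact (Set.mem_preimage).2 (e.symm ▸ x.2 : f k ∈ O)
    -- Points of `K` near `k` lie in a compact neighborhood that `f` maps to `O`.
    obtain ⟨N, hN, hkN, hNO⟩ := exists_compact_subset (hO.preimage hf) hkO
    have : CompactSpace N := isCompact_iff_compactSpace.1 hN
    obtain ⟨W, hW, e⟩ := hs N (fun n => ⟨f n, hNO n.2⟩)
      ((hf.comp continuous_subtype_val).subtype_mk _)
    have hmem : ∀ n (hn : n ∈ N), n ∈ W ↔ f n ∈ Subtype.val '' s := fun n hn => by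
      have h₁ : n ∈ W ↔ (⟨f n, hNO hn⟩ : O) ∈ s :=
        iff_of_eq (congrArg (fun Q : Set N => (⟨n, hn⟩ : N) ∈ Q) e)
      refine h₁.trans ⟨fun h => ⟨_, h, rfl⟩, fun ⟨x, hx, hx'⟩ => ?_⟩
      obtain rfl : x = ⟨f n, hNO hn⟩ := Subtype.ext hx'
      exact hx
    filter_upwards [hW.mem_nhds ((hmem k (interior_subset hkN)).2 hk),
      isOpen_interior.mem_nhds hkN] with n hn hn'
    exact (hmem n (interior_subset hn')).1 hn
  of_final X hX := by
    refine compactlyGeneratedSpace_of_isOpen fun s hs => hX s fun A f hf => ?_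
    have hA : CompactlyGeneratedSpace A.obj := A.property
    exact CompactlyGeneratedSpace.isOpen' fun K _ _ _ g hg => hs K (f ∘ g) (hf.comp hg)

/-- The morphism of a full subcategory of topological spaces given by a continuous map. -/
abbrev homOfCont {A B : P.FullSubcategory} (f : A.obj → B.obj) (hf : Continuous f) : A ⟶ B :=
  ObjectProperty.homMk (TopCat.ofHom ⟨f, hf⟩)

theorem cont_hom {A B : P.FullSubcategory} (f : A ⟶ B) : Continuous f.hom :=
  f.hom.hom.continuous

theorem hom_ext_apply {A B : P.FullSubcategory} {f g : A ⟶ B} (h : ∀ a, f.hom a = g.hom a) :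
    f = g := by
  apply ObjectProperty.hom_ext
  exact TopCat.ext h

/-- An open subspace, as an object of the category of spaces. -/
abbrev openSub (hP : IsConvenient P) {T : P.FullSubcategory} {O : Set T.obj} (hO : IsOpen O) :
    P.FullSubcategory :=
  ⟨TopCat.of O, hP.of_isOpen T O hO⟩

/-- The inclusion of an open subspace. -/
abbrev openIncl (hP : IsConvenient P) {T : P.FullSubcategory} {O : Set T.obj} (hO : IsOpen O) :
    openSub hP hO ⟶ T :=
  homOfCont Subtype.val continuous_subtype_val

/-- A sieve covers if and only if every point has an open neighborhood whose inclusion belongs to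
the sieve. -/
theorem mem_openCovers_iff (hP : IsConvenient P) {T : P.FullSubcategory} {R : Sieve T} :
    R ∈ openCovers P T ↔ ∀ t : T.obj, ∃ O : Set T.obj, IsOpen O ∧ t ∈ O ∧
      ∀ ⦃A : P.FullSubcategory⦄ (f : A ⟶ T), (∀ a, f.hom a ∈ O) → R f := by
  constructor
  · intro hR
    change Precoverage.Saturate _ _ _ at hR
    induction hR with
    | of T S hS =>
      obtain ⟨ι, Y, φ, rfl⟩ := S.exists_eq_ofArrows
      rw [Precoverage.mem_comap_iff, Presieve.map_ofArrows] at hS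
      obtain ⟨hS, hS'⟩ := hS
      rw [Precoverage.mem_comap_iff, Presieve.map_ofArrows,
        Types.ofArrows_mem_jointlySurjectivePrecoverage_iff] at hS
      rw [MorphismProperty.ofArrows_mem_precoverage] at hS'
      intro t
      obtain ⟨i, x, hx⟩ := hS t
      have hi : Topology.IsOpenEmbedding (φ i).hom := hS' i
      refine ⟨Set.range (φ i).hom, hi.isOpen_range, ⟨x, hx⟩, fun A f hf => ?_⟩
      choose g hg using hf
      have hgc : Continuous g :=
        hi.isInducing.continuous_iff.2 ((funext hg : (φ i).hom ∘ g = f.hom) ▸ cont_hom f)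
      exact ⟨_, homOfCont g hgc, φ i, ⟨i⟩, hom_ext_apply hg⟩
    | top T => exact fun t => ⟨Set.univ, isOpen_univ, trivial, fun _ _ _ => trivial⟩
    | pullback T S _ Y g ih =>
      intro y
      obtain ⟨O, hO, ht, h⟩ := ih (g.hom y)
      exact ⟨g.hom ⁻¹' O, hO.preimage (cont_hom g), ht, fun A f hf => h (f ≫ g) hf⟩
    | transitive T S R _ _ ih₁ ih₂ =>
      intro t
      obtain ⟨O, hO, ht, h⟩ := ih₁ t
      obtain ⟨O', hO', ht', h'⟩ := ih₂ (h (openIncl hP hO) fun a => a.2) ⟨t, ht⟩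
      refine ⟨Subtype.val '' O', hO.isOpenMap_subtype_val _ hO', ⟨_, ht', rfl⟩, fun A f hf => ?_⟩
      have hfO : ∀ a, f.hom a ∈ O := fun a => by
        obtain ⟨x, _, e⟩ := hf a
        exact e ▸ x.2
      refine h' (homOfCont (fun a => ⟨f.hom a, hfO a⟩) ((cont_hom f).subtype_mk hfO)) fun a => ?_
      obtain ⟨x, hx, e⟩ := hf a
      obtain rfl : x = ⟨f.hom a, hfO a⟩ := Subtype.ext e
      exact hx
  · intro h
    choose O hO ht h using h
    have key : Sieve.generate (Presieve.ofArrows _ fun t => openIncl hP (hO t)) ∈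
        openCovers P T := by
      refine Precoverage.generate_mem_toGrothendieck ?_
      rw [Precoverage.mem_comap_iff, Presieve.map_ofArrows]
      refine ⟨?_, ?_⟩
      · rw [Precoverage.mem_comap_iff, Presieve.map_ofArrows,
          Types.ofArrows_mem_jointlySurjectivePrecoverage_iff]
        exact fun t => ⟨t, ⟨t, ht t⟩, rfl⟩
      · rw [MorphismProperty.ofArrows_mem_precoverage]
        exact fun t => (hO t).isOpenEmbedding_subtypeVal
    refine GrothendieckTopology.superset_covering _ ?_ key
    rw [Sieve.generate_le_iff]
    rintro _ _ ⟨t⟩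
    exact h t _ fun a => a.2

end Convenient

/-! ### Sheaves on convenient categories of topological spaces -/

section TopologicalSheaves

variable {P : ObjectProperty TopCat.{u}}

/-- The set `X` with the topology that is final with respect to a class of maps `A → X` from
spaces `A` of the category. -/
def FinalSpace {X : Type u} (_𝓕 : ∀ A : P.FullSubcategory, (A.obj → X) → Prop) : Type u := X

instance {X : Type u} (𝓕 : ∀ A : P.FullSubcategory, (A.obj → X) → Prop) :
    TopologicalSpace (FinalSpace 𝓕) where
  IsOpen s := ∀ A f, 𝓕 A f → IsOpen (f ⁻¹' s)
  isOpen_univ _ _ _ := isOpen_univ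
  isOpen_inter _ _ h h' A f hf := (h A f hf).inter (h' A f hf)
  isOpen_sUnion S h A f hf := by
    have key : ∀ f' : A.obj → FinalSpace 𝓕, 𝓕 A f' → IsOpen (f' ⁻¹' ⋃₀ S) := fun f' hf' => by
      rw [Set.preimage_sUnion]
      exact isOpen_biUnion fun s hs => h s hs A f' hf'
    exact key f hf

theorem continuous_toFinal {X : Type u} {𝓕 : ∀ A : P.FullSubcategory, (A.obj → X) → Prop}
    {A : P.FullSubcategory} {f : A.obj → FinalSpace 𝓕} (hf : 𝓕 A f) : Continuous f :=
  continuous_def.2 fun _ ho => ho A f hf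

theorem continuous_fromFinal {X : Type u} {𝓕 : ∀ A : P.FullSubcategory, (A.obj → X) → Prop}
    {Y : Type*} [TopologicalSpace Y] {g : FinalSpace 𝓕 → Y}
    (h : ∀ A (f : A.obj → X), 𝓕 A f → Continuous fun a => g (f a)) : Continuous g :=
  continuous_def.2 fun _ ho A f hf => ho.preimage (h A f hf)

/-- A space with a final topology, as an object of the category of spaces. -/
abbrev finalObj (hP : IsConvenient P) {X : Type u}
    (𝓕 : ∀ A : P.FullSubcategory, (A.obj → X) → Prop) : P.FullSubcategory :=
  ⟨TopCat.of (FinalSpace 𝓕), hP.of_final _ fun _ hs A f hf => hs A f (continuous_toFinal hf)⟩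

theorem isSheaf_yoneda (hP : IsConvenient P) (T : P.FullSubcategory) :
    Presieve.IsSheaf (openCovers P) (yoneda.obj T) := by
  intro B R hR x hx
  have hloc := (mem_openCovers_iff hP).1 hR
  choose O hO hb hOR using hloc
  let ξ : ∀ b : B.obj, openSub hP (hO b) ⟶ T := fun b => x (openIncl hP (hO b))
    (hOR b _ fun a => a.2)
  -- The value of a section at a point does not depend on the member of the covering.
  have hval : ∀ {A : P.FullSubcategory} (f : A ⟶ B) (hf : R f) (a : A.obj) (b : B.obj)
      (ha : f.hom a ∈ O b), (x f hf).hom a = (ξ b).hom ⟨f.hom a, ha⟩ := by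
    intro A f hf a b ha
    have hV : IsOpen (f.hom ⁻¹' O b) := (hO b).preimage (cont_hom f)
    let g : openSub hP hV ⟶ openSub hP (hO b) := homOfCont (fun v => ⟨f.hom v.1, v.2⟩)
      (((cont_hom f).comp continuous_subtype_val).subtype_mk _)
    have e := hx (openIncl hP hV) g hf (hOR b (openIncl hP (hO b)) fun a => a.2) rfl
    exact congrArg (fun m : openSub hP hV ⟶ T => m.hom ⟨a, ha⟩) e
  have hcont : Continuous fun b : B.obj => (ξ b).hom ⟨b, hb b⟩ := by
    refine continuous_iff_continuousAt.2 fun b => ?_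
    refine ContinuousOn.continuousAt (s := O b) ?_ ((hO b).mem_nhds (hb b))
    rw [continuousOn_iff_continuous_domRestrict]
    refine (cont_hom (ξ b)).congr fun b' => ?_
    exact hval (openIncl hP (hO b)) _ b' b'.1 (hb b'.1)
  refine ⟨homOfCont _ hcont, fun A f hf => ?_, fun t ht => ?_⟩
  · exact hom_ext_apply fun a => (hval f hf a (f.hom a) (hb _)).symm
  · refine hom_ext_apply fun b => ?_
    have e := ht (openIncl hP (hO b)) (hOR b _ fun a => a.2)
    exact congrArg (fun m : openSub hP (hO b) ⟶ T => m.hom ⟨b, hb b⟩) e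

theorem isSheaf_groupSheaf (hP : IsConvenient P) {G : P.FullSubcategory} [Group G.obj]
    (hG : IsGroupSpace G) : Presieve.IsSheaf (openCovers P) (groupSheaf hG ⋙ forget GrpCat) := by
  refine Presieve.isSheaf_iso (P := yoneda.obj G) (openCovers P) ?_ (isSheaf_yoneda hP G)
  exact NatIso.ofComponents (fun T => Equiv.toIso
    { toFun f := (⟨f.hom, cont_hom f⟩ : contMaps hG T.unop)
      invFun f := homOfCont (A := T.unop) (B := G) f.1 f.2
      left_inv _ := rfl
      right_inv _ := rfl }) fun _ => rfl

/-- The category of spaces has products `T × G`: they carry the final topology with respect to the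
pairs of continuous maps from spaces of the category. -/
theorem hasGrpProducts_groupSheaf (hP : IsConvenient P) {G : P.FullSubcategory} [Group G.obj]
    (hG : IsGroupSpace G) : HasGrpProducts (groupSheaf hG) := by
  intro T
  let 𝓕 : ∀ A : P.FullSubcategory, (A.obj → T.obj × G.obj) → Prop := fun A f =>
    Continuous (fun a => (f a).1) ∧ Continuous (fun a => (f a).2)
  refine ⟨finalObj hP 𝓕, homOfCont (A := finalObj hP 𝓕) (fun q => Prod.fst q)
    (continuous_fromFinal fun _ _ h => h.1),
    (⟨fun q => Prod.snd q, continuous_fromFinal fun _ _ h => h.2⟩ : contMaps hG (finalObj hP 𝓕)),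
    fun {V} j k => ?_⟩
  have hk : Continuous k.1 := k.2
  refine ⟨homOfCont (B := finalObj hP 𝓕) (fun v => (j.hom v, k.1 v))
    (continuous_toFinal ⟨cont_hom j, hk⟩), ⟨rfl, rfl⟩, ?_⟩
  rintro m ⟨rfl, rfl⟩
  rfl

/-! ### Gluing representing objects -/

variable {F : P.FullSubcategoryᵒᵖ ⥤ Type w}

theorem map_op_map_op {V W W' : P.FullSubcategory} (g : V ⟶ W) (g' : W ⟶ W')
    (ξ : F.obj (op W')) : F.map g.op (F.map g'.op ξ) = F.map (g ≫ g').op ξ :=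
  (Functor.map_comp_apply F g'.op g.op ξ).symm

/-- The one-point space. -/
abbrev pt (hP : IsConvenient P) : P.FullSubcategory :=
  ⟨TopCat.of PUnit.{u + 1}, hP.of_final _ fun _ _ => isOpen_discrete _⟩

/-- A point of a space, as a morphism. -/
abbrev ptHom (hP : IsConvenient P) {A : P.FullSubcategory} (a : A.obj) : pt hP ⟶ A :=
  homOfCont (fun _ => a) continuous_const

/-- Let `F` be a sheaf over a space `T` that is representable over the members of an open covering
of `T`, by the sections `ξ t`. Then `F` is representable. Its representing space is the set of
sections of `F` over the point, with the final topology with respect to all sections of `F`. -/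
theorem exists_universal_of_open (hP : IsConvenient P) (hF : Presieve.IsSheaf (openCovers P) F)
    {T : P.FullSubcategory} (π : ∀ {W : P.FullSubcategory}, F.obj (op W) → (W ⟶ T))
    (hπ : ∀ {V W : P.FullSubcategory} (g : V ⟶ W) (ξ : F.obj (op W)), π (F.map g.op ξ) = g ≫ π ξ)
    (O : T.obj → Set T.obj) (hO : ∀ t, IsOpen (O t)) (ht : ∀ t, t ∈ O t)
    (S : T.obj → P.FullSubcategory) (ξ : ∀ t, F.obj (op (S t)))
    (hξ : ∀ t {V : P.FullSubcategory} (ζ : F.obj (op V)), (∀ v, (π ζ).hom v ∈ O t) →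
      ∃! m : V ⟶ S t, F.map m.op (ξ t) = ζ)
    (hξ' : ∀ t x, (π (ξ t)).hom x ∈ O t) :
    ∃ (M : P.FullSubcategory) (ξ : F.obj (op M)), ∀ {V : P.FullSubcategory} (ζ : F.obj (op V)),
      ∃! m : V ⟶ M, F.map m.op ξ = ζ := by
  have hpt : ∀ {A B : P.FullSubcategory} (m : A ⟶ B) (η : F.obj (op B)) (a : A.obj),
      F.map (ptHom hP a).op (F.map m.op η) = F.map (ptHom hP (m.hom a)).op η :=
    fun m η a => map_op_map_op _ _ _
  have hπpt : ∀ {A : P.FullSubcategory} (η : F.obj (op A)) (a : A.obj),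
      (π (F.map (ptHom hP a).op η)).hom PUnit.unit = (π η).hom a := fun η a => by
    rw [hπ]; rfl
  have hinj : ∀ t {x x' : (S t).obj},
      F.map (ptHom hP x).op (ξ t) = F.map (ptHom hP x').op (ξ t) → x = x' := fun t x x' e => by
    have hmem : ∀ v, (π (F.map (ptHom hP x').op (ξ t))).hom v ∈ O t := fun v => by
      rw [hπ]; exact hξ' t _
    have := (hξ t _ hmem).unique e rfl
    exact congrArg (fun m : pt hP ⟶ S t => m.hom PUnit.unit) this
  -- The restriction of a section to the open set on which it is given by `ξ t`.
  have hres : ∀ {A : P.FullSubcategory} (η : F.obj (op A)) (t : T.obj),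
      ∃ m : openSub hP ((hO t).preimage (cont_hom (π η))) ⟶ S t,
        F.map m.op (ξ t) = F.map (openIncl hP ((hO t).preimage (cont_hom (π η)))).op η :=
    fun η t => (hξ t _ fun v => by rw [hπ]; exact v.2).exists
  -- Sections of `F` are determined by their restrictions to points: locally they are morphisms to
  -- the spaces `S t`.
  have hsep : ∀ {A : P.FullSubcategory} {η η' : F.obj (op A)},
      (∀ a, F.map (ptHom hP a).op η = F.map (ptHom hP a).op η') → η = η' := by
    intro A η η' h
    have hπe : π η = π η' := hom_ext_apply fun a => by
      rw [← hπpt η, ← hπpt η', h]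
    let R : Sieve A :=
      { arrows := fun B f => F.map f.op η = F.map f.op η'
        downward_closed := fun {B B' f} hf g => by
          rw [← map_op_map_op, ← map_op_map_op, hf] }
    have hR : R ∈ openCovers P A := by
      refine (mem_openCovers_iff hP).2 fun a => ?_
      refine ⟨_, (hO ((π η).hom a)).preimage (cont_hom (π η)), ht _, fun B f hf => ?_⟩
      have hf' : ∀ v, (π (F.map f.op η)).hom v ∈ O ((π η).hom a) := fun v => by
        rw [hπ]; exact hf v
      have hf'' : ∀ v, (π (F.map f.op η')).hom v ∈ O ((π η).hom a) := fun v => by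
        rw [hπ, ← hπe]; exact hf v
      obtain ⟨m, hm⟩ := (hξ _ _ hf').exists
      obtain ⟨m', hm'⟩ := (hξ _ _ hf'').exists
      have : m = m' := hom_ext_apply fun v => hinj _ (by
        rw [← hpt m, ← hpt m', hm, hm', hpt, hpt, h])
      exact hm.symm.trans ((congrArg (fun m => F.map m.op (ξ _)) this).trans hm')
    exact (hF R hR).isSeparatedFor.ext fun B f hf => hf
  -- The points of the spaces `S t` exhaust `F(pt)`, which may live in a larger universe.
  have hsmall : Small.{u} (F.obj (op (pt hP))) := by
    refine small_of_surjective (α := Σ t, (S t).obj)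
      (f := fun x => F.map (ptHom hP x.2).op (ξ x.1)) fun ζ => ?_
    obtain ⟨m, hm⟩ := (hξ ((π ζ).hom PUnit.unit) ζ fun v => ht _).exists
    exact ⟨⟨_, m.hom PUnit.unit⟩, hm⟩
  let e := equivShrink.{u} (F.obj (op (pt hP)))
  let 𝓕 : ∀ A : P.FullSubcategory, (A.obj → Shrink.{u} (F.obj (op (pt hP)))) → Prop :=
    fun A f => ∃ η : F.obj (op A), ∀ a, e.symm (f a) = F.map (ptHom hP a).op η
  let M := finalObj hP 𝓕
  let e' : M.obj ≃ F.obj (op (pt hP)) := e.symm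
  let b : M.obj → T.obj := fun p => (π (e' p)).hom PUnit.unit
  have hb : Continuous b := continuous_fromFinal fun A f ⟨η, hη⟩ =>
    (cont_hom (π η)).congr fun a => (hπpt η a).symm.trans
      (congrArg (fun η : F.obj (op (pt hP)) => (π η).hom PUnit.unit) (hη a).symm)
  -- Over `O t`, points of `M` are points of `S t`, and this identification is continuous.
  have hn : ∀ t (p : b ⁻¹' O t), ∃ x : (S t).obj, F.map (ptHom hP x).op (ξ t) = e' p := by
    intro t p
    obtain ⟨m, hm⟩ := (hξ t (e' p) fun _ => p.2).exists
    exact ⟨m.hom PUnit.unit, hm⟩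
  choose n hn using hn
  have hnc : ∀ t, Continuous (n t) := by
    intro t
    refine continuous_def.2 fun V hV => ?_
    refine ((hO t).preimage hb).isOpenEmbedding_subtypeVal.isOpen_iff_image_isOpen.2 ?_
    rintro A f ⟨η, hη⟩
    obtain ⟨m, hm⟩ := hres η t
    have hA := (hO t).preimage (cont_hom (π η))
    convert hA.isOpenEmbedding_subtypeVal.isOpenMap _ (hV.preimage (cont_hom m)) using 1
    have hbf : ∀ a, b (f a) = (π η).hom a := fun a =>
      (congrArg (fun η : F.obj (op (pt hP)) => (π η).hom PUnit.unit) (hη a)).trans (hπpt η a)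
    have hnm : ∀ (a) (h : b (f a) ∈ O t) (h' : (π η).hom a ∈ O t),
        n t ⟨f a, h⟩ = m.hom ⟨a, h'⟩ := fun a h h' => by
      refine hinj t ((hn t _).trans ((hη a).trans ?_))
      rw [← hpt m, hm, hpt]
    ext a
    constructor
    · rintro ⟨p, hp, hpa⟩
      have h : b (f a) ∈ O t := hpa ▸ p.2
      have h' : (π η).hom a ∈ O t := hbf a ▸ h
      obtain rfl : p = ⟨f a, h⟩ := Subtype.ext hpa
      refine ⟨⟨a, h'⟩, ?_, rfl⟩
      exact (hnm a h h' ▸ hp : m.hom ⟨a, h'⟩ ∈ V)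
    · rintro ⟨⟨a', h'⟩, ha', rfl⟩
      have h : b (f a') ∈ O t := (hbf a').symm ▸ h'
      exact ⟨⟨f a', h⟩, (hnm a' h h' ▸ ha' : n t ⟨f a', h⟩ ∈ V), rfl⟩
  -- The universal section is glued from the restrictions of the sections `ξ t`.
  have huniv : ∃ ξ₀ : F.obj (op M), ∀ p, F.map (ptHom hP p).op ξ₀ = e' p := by
    let R : Sieve M :=
      { arrows := fun A f => ∃ η : F.obj (op A), ∀ a, F.map (ptHom hP a).op η = e' (f.hom a)
        downward_closed := fun {A A' f} ⟨η, hη⟩ g =>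
          ⟨F.map g.op η, fun a => (hpt g η a).trans (hη _)⟩ }
    have hRW : ∀ t {A} (f : A ⟶ M), (∀ a, f.hom a ∈ b ⁻¹' O t) → R f := by
      intro t A f hf
      refine ⟨F.map (homOfCont (B := S t) (fun a => n t ⟨f.hom a, hf a⟩)
        ((hnc t).comp ((cont_hom f).subtype_mk hf))).op (ξ t), fun a => ?_⟩
      rw [hpt]
      exact hn t _
    have hR : R ∈ openCovers P M := (mem_openCovers_iff hP).2 fun p =>
      ⟨_, (hO (b p)).preimage hb, ht _, fun A f hf => hRW _ f hf⟩
    let x : Presieve.FamilyOfElements F R.arrows := fun A f hf => hf.choose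
    have hx : ∀ {A} (f : A ⟶ M) (hf : R f) (a), F.map (ptHom hP a).op (x f hf) = e' (f.hom a) :=
      fun f hf => hf.choose_spec
    obtain ⟨ξ₀, h₀, -⟩ := hF R hR x (by
      intro A₁ A₂ B g₁ g₂ f₁ f₂ h₁ h₂ w
      refine hsep fun a => ?_
      rw [hpt, hpt, hx, hx]
      exact congrArg (fun m : B ⟶ M => e' (m.hom a)) w)
    refine ⟨ξ₀, fun p => ?_⟩
    have hW := (hO (b p)).preimage hb
    have h₁ := h₀ (openIncl hP hW) (hRW (b p) _ fun a => a.2)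
    have h₂ := hx (openIncl hP hW) (hRW (b p) _ fun a => a.2) ⟨p, ht _⟩
    rw [← h₁, hpt] at h₂
    exact h₂
  obtain ⟨ξ₀, h₀⟩ := huniv
  refine ⟨M, ξ₀, fun {V} ζ => ?_⟩
  have hc : Continuous (Y := M.obj) fun v => e (F.map (ptHom hP v).op ζ) :=
    continuous_toFinal ⟨ζ, fun a => e.symm_apply_apply _⟩
  refine ⟨homOfCont (B := M) _ hc, hsep fun a => ?_, fun m hm => hom_ext_apply fun v => ?_⟩
  · rw [hpt, h₀]
    exact e.symm_apply_apply _
  · have h₁ := hpt m ξ₀ v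
    rw [hm, h₀] at h₁
    exact e'.injective (h₁.symm.trans (e.symm_apply_apply _).symm)

/-- A sheaf `F` over a space `T` is representable if its restrictions to the members of a covering
sieve of `T` are. -/
theorem exists_universal_of_sieve (hP : IsConvenient P) (hF : Presieve.IsSheaf (openCovers P) F)
    {T : P.FullSubcategory} (π : ∀ {W : P.FullSubcategory}, F.obj (op W) → (W ⟶ T))
    (hπ : ∀ {V W : P.FullSubcategory} (g : V ⟶ W) (ξ : F.obj (op W)), π (F.map g.op ξ) = g ≫ π ξ)
    {R : Sieve T} (hR : R ∈ openCovers P T)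
    (h : ∀ ⦃U : P.FullSubcategory⦄ (k : U ⟶ T), R k →
      ∃ (S : P.FullSubcategory) (s : S ⟶ U) (ξ : F.obj (op S)), π ξ = s ≫ k ∧
        ∀ {V : P.FullSubcategory} (j : V ⟶ U) (ζ : F.obj (op V)), π ζ = j ≫ k →
          ∃! m : V ⟶ S, m ≫ s = j ∧ F.map m.op ξ = ζ) :
    ∃ (M : P.FullSubcategory) (ξ : F.obj (op M)), ∀ {V : P.FullSubcategory} (ζ : F.obj (op V)),
      ∃! m : V ⟶ M, F.map m.op ξ = ζ := by
  choose O hO ht hOR using (mem_openCovers_iff hP).1 hR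
  choose S s ξ e hξ using fun t => h (openIncl hP (hO t)) (hOR t _ fun a => a.2)
  refine exists_universal_of_open hP hF π hπ O hO ht S ξ ?_ fun t x => ?_
  · intro t V ζ hζ
    let j : V ⟶ openSub hP (hO t) := homOfCont (fun v => ⟨(π ζ).hom v, hζ v⟩)
      ((cont_hom (π ζ)).subtype_mk hζ)
    obtain ⟨m, hm, hm'⟩ := hξ t j ζ rfl
    refine ⟨m, hm.2, fun m' h' => hm' m' ⟨hom_ext_apply fun v => Subtype.ext ?_, h'⟩⟩
    have h₁ : m' ≫ s t ≫ openIncl hP (hO t) = π ζ := by rw [← e, ← hπ, h']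
    exact congrArg (fun g : V ⟶ T => g.hom v) h₁
  · rw [e]
    exact ((s t).hom x).2

end TopologicalSheaves

/-! ### The quotient stack -/

section Epimorphisms

variable {C : Type u₁} [Category.{v₁} C] {J : GrothendieckTopology C}

/-- Epimorphisms compose: lifting twice is lifting along a covering of a covering. -/
theorem IsEpimorphism.comp {X : BasedCategory.{v₂, u₂} C} {Y : BasedCategory.{v₃, u₃} C}
    {Z : BasedCategory.{v₄, u₄} C} (hX : IsFiberedInGroupoids X) {F : X ⥤ᵇ Y} {H : Y ⥤ᵇ Z}
    (hF : IsEpimorphism J F) (hH : IsEpimorphism J H) : IsEpimorphism J (F.comp H) := by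
  intro z
  obtain ⟨R, hR, h⟩ := hH z
  refine ⟨liftSieve hX (F.comp H) z rfl, J.transitive hR _ fun U k hk => ?_, fun U a h => h⟩
  obtain ⟨y, ψ, hψ⟩ := h k hk
  have hy : Y.p.obj y = U := (H.w_obj y).symm.trans (IsHomLift.domain_eq Z.p k ψ)
  refine J.superset_covering ?_ (liftSieve_mem hX hF y hy)
  rintro V m ⟨x, φ, hφ⟩
  exact ⟨x, H.map φ ≫ ψ, lift_comp (H.preserves_isHomLift m φ) hψ rfl⟩

end Epimorphisms

section SpacesOfArrows

variable {P : ObjectProperty TopCat.{u}}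

/-- In a prestack, the arrows from `a` to `b` are represented by a space as soon as they are so
locally on the base of `a`. -/
theorem HasIsom.of_local (hP : IsConvenient P) {Z : BasedCategory.{v₂, u₂} P.FullSubcategory}
    (hg : IsFiberedInGroupoids Z) (hp : IsPrestack (openCovers P) Z) {T T' : P.FullSubcategory}
    (f : T ⟶ T') {a b : Z.obj} (ha : Z.p.obj a = T) (hb : Z.p.obj b = T') {R : Sieve T}
    (hR : R ∈ openCovers P T)
    (h : ∀ ⦃U : P.FullSubcategory⦄ (k : U ⟶ T), R k → ∃ (a' : Z.obj) (κ : a' ⟶ a),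
      Z.p.IsHomLift k κ ∧ HasIsom Z (k ≫ f) a' b) : HasIsom Z f a b := by
  obtain ⟨M, ξ, hξ⟩ := exists_universal_of_sieve hP
    (IsomSec.isSheaf_presheaf (s := hg.sectionOf ha) (f := f) hg hp (isSheaf_yoneda hP T) hb)
    (fun ζ => IsomSec.base ζ) (fun _ _ => rfl) hR (fun U k hk => by
      obtain ⟨a', κ, hκ, h'⟩ := h k hk
      exact IsomSec.exists_universal_of_hasIsom hg ha hκ h')
  exact IsomSec.hasIsom_of_universal hg ha ξ fun ζ => hξ ζ

/-- If the arrows of a prestack are represented by spaces, so are those of its stackification: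
they are arrows of the prestack, locally on the source. -/
theorem hasIsom_stackification (hP : IsConvenient P)
    {Y : BasedCategory.{v₂, u₂} P.FullSubcategory} (hY : IsFiberedInGroupoids Y)
    (hp : IsPrestack (openCovers P) Y)
    (h : ∀ (T : P.FullSubcategory) (y y' : Y.obj), Y.p.obj y = T → Y.p.obj y' = T →
      HasIsom Y (𝟙 T) y y') {T T' : P.FullSubcategory} (f : T ⟶ T')
    {a b : PlusObj (openCovers P) Y} (ha : a.base = T) (hb : b.base = T') :
    HasIsom (stackification (openCovers P) Y) f a b := by
  subst ha hb
  have hZ := isFiberedInGroupoids_stackification (J := openCovers P) hY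
  refine .of_local hP hZ (isPrestack_stackification hY hp) f rfl rfl
    ((openCovers P).intersection_covering a.mem ((openCovers P).pullback_stable f b.mem))
    fun U k hk => ⟨_, a.valHom hY k hk.1, a.valHom_lift hY k hk.1, ?_⟩
  have h₁ := (h U (a.val k hk.1) (b.val (k ≫ f) hk.2) (a.obj_val k hk.1)
    (b.obj_val (k ≫ f) hk.2)).map hY hZ (toStackification (openCovers P) hY.isFibered)
      ⟨fun ψ => toStackification_full _ hY hp ψ⟩ ⟨fun e => toStackification_faithful _ hY hp e⟩
  have h₂ := h₁.comp hZ (b.valHom_lift hY (k ≫ f) hk.2)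
  rwa [Category.id_comp] at h₂

end SpacesOfArrows

end TopStack

theorem propositionP
    (P : ObjectProperty TopCat.{u}) (hP : P = ⊤ ∨ P = TopStack.compactlyGenerated)
    (G : P.FullSubcategory) [Group G.obj] (hG : TopStack.IsGroupSpace G)
    (X : BasedCategory.{v, w} P.FullSubcategory)
    (hX : TopStack.IsTopologicalStack (TopStack.openCovers P) X)
    (A : TopStack.GroupAction (TopStack.groupSheaf hG) X) :
    TopStack.IsTopologicalStack (TopStack.openCovers P)
        (TopStack.quotientStack (TopStack.openCovers P) A) ∧
      ∀ (S : P.FullSubcategory) (p : TopStack.rep S ⥤ᵇ X),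
        TopStack.IsAtlas (TopStack.openCovers P) p →
          TopStack.IsAtlas (TopStack.openCovers P)
            (p.comp (TopStack.quotientMap (TopStack.openCovers P) A
              hX.isStack.isFiberedInGroupoids.isFibered)) := by
  have hP' : TopStack.IsConvenient P := by
    rcases hP with rfl | rfl
    · exact TopStack.isConvenient_top
    · exact TopStack.isConvenient_compactlyGenerated
  have hg := hX.isStack.isFiberedInGroupoids
  have hA := A.isFiberedInGroupoids_transCat hg
  have hp := A.isPrestack_transCat hg hX.isStack.isPrestack (TopStack.isSheaf_groupSheaf hP' hG)
  have hIsom : ∀ (T : P.FullSubcategory) (x y : A.transCat.obj), A.transCat.p.obj x = T →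
      A.transCat.p.obj y = T → TopStack.HasIsom A.transCat (𝟙 T) x y := fun T x y hx hy =>
    A.hasIsom_transCat hg (TopStack.hasGrpProducts_groupSheaf hP' hG)
      (fun f a b ha hb => TopStack.hasIsom_of_isRepresentable_diag hg hX.isRepresentable_diag f
        ha hb) (𝟙 T) ⟨x.obj, hx⟩ ⟨y.obj, hy⟩
  have hAtlas : ∀ (S : P.FullSubcategory) (p : TopStack.rep S ⥤ᵇ X),
      TopStack.IsAtlas (TopStack.openCovers P) p → TopStack.IsAtlas (TopStack.openCovers P)
        (p.comp (TopStack.quotientMap (TopStack.openCovers P) A hg.isFibered)) := fun S p h =>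
    TopStack.IsEpimorphism.comp (TopStack.isFiberedInGroupoids_rep S) h
      (TopStack.IsEpimorphism.comp hg (A.isEpimorphism_toTransCat hg)
        (TopStack.isEpimorphism_toStackification hA))
  obtain ⟨S, p, h⟩ := hX.exists_atlas
  refine ⟨⟨TopStack.isStack_stackification hA hp, ?_, S, _, hAtlas S p h⟩, hAtlas⟩
  exact TopStack.isRepresentable_diag_of_hasIsom
    (TopStack.isFiberedInGroupoids_stackification hA)
    fun T a b ha hb => TopStack.hasIsom_stackification hP' hA hp hIsom (𝟙 T) ha hb
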